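/- A rooted tree is finite; its vertices are ordered by $v \preceq w$ iff $v$ lies on the path from the root to $w$, and a set $X$ of vertices is called infima closed if the infimum (last common vertex of the paths from the root) of any two elements of $X$ belongs to $X$. A rooted tree with $n$ vertices is called a \emph{minimal tree of order $n$} if it has the least number of nonempty infima closed sets among all rooted trees with $n$ vertices. Trees are considered up to isomorphism of rooted trees. We write $\bullet$ for the one-vertex tree and $[B_1,\dots,B_k]$ for the rooted tree whose root branches are $B_1,\dots,B_k$; a branch is the subtree consisting of a vertex and all its descendants. For a rooted tree drawn in the plane, the canonical order of its vertices is by level (distance from the root), and from left to right within each level. Let $n > 6$ be an integer. There is a unique integer $h \ge 1$ with $5\cdot 2^{h-1}+1 < n \le 5\cdot 2^h+1$; let $m$ be the nearest integer to $\frac{n+1}{5}$, so that $n \in \{5m-3,5m-2,5m-1,5m,5m+1\}$ and $2^{h-1} < m \le 2^h$. Then a minimal tree $M$ of order $n$ is obtained as follows. 1. Start from the complete binary tree of height $h-1$ (all non-leaves have exactly two children, all leaves are at level $h-1$); it has $2^h-1$ vertices, of which $2^{h-1}$ are leaves. 2. Replace each of the $m-2^{h-1}$ leftmost leaves by the $9$-vertex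 tree $[[\bullet,\bullet,\bullet],[\bullet,\bullet,\bullet]]$, and each of the remaining $2^h-m$ leaves by the $4$-vertex tree $[\bullet,\bullet,\bullet]$. The resulting tree has $5m-1$ vertices. 3. If $n=5m-1$, nothing more is done. If $n=5m-2$, remove the last leaf in the canonical order. If $n=5m-3$, remove one child each from the last two vertices in the canonical order that have leaf children. If $n=5m$, add one child to the first vertex in the canonical order that has leaf children. If $n=5m+1$, add one child to each of the first two vertices in the canonical order that have leaf children. If $n \not\equiv 2 \pmod 5$, then $M$ is the only minimal tree of order $n$. If $n \equiv 2 \pmod 5$, then $M$ has exactly one branch of the form $[[\bullet,\bullet],[\bullet,\bullet]]$; replacing it by $[[\bullet,\bullet,\bullet],\bullet,\bullet]$ gives a second minimal tree of order $n$, not isomorphic to $M$, and there are no other minimal trees of order $n$. -/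

import Mathlib

universe u

/-! ### Rooted trees and infima closed sets

Rooted trees are Mathlib's `RootedTree`s: the vertices form a meet-semilattice whose least element
is the root, the order is `v ≤ w` iff `v` lies on the path from the root to `w`, and `v ⊓ w` is the
last common vertex of the paths from the root to `v` and to `w`. Two rooted trees are isomorphic iff
they are order isomorphic. -/

namespace RootedTree

/-- The number of nonempty infima closed sets of `T`. -/
noncomputable def numInfClosed (T : RootedTree.{u}) : ℕ :=
  Set.ncard {X : Set T | X.Nonempty ∧ InfClosed X}

/-- `T` is a minimal tree of order `n`: a rooted tree with `n` vertices that has the least number of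
nonempty infima closed sets among all rooted trees with `n` vertices. -/
def IsMinimal (n : ℕ) (T : RootedTree.{u}) : Prop :=
  Finite T ∧ Nat.card T = n ∧
    ∀ T' : RootedTree.{u}, Finite T' → Nat.card T' = n → T.numInfClosed ≤ T'.numInfClosed

end RootedTree

/-! ### Rooted trees embedded in the plane -/

/-- A finite rooted tree drawn in the plane: `node [B₁, …, Bₖ]` has the root branches `B₁, …, Bₖ`,
listed from left to right. -/
inductive PlaneTree : Type
  | node (branches : List PlaneTree) : PlaneTree

namespace PlaneTree

/-- The tree `•` of order 1. -/
def leaf : PlaneTree := node []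

/-- The root branches, from left to right. -/
def branches : PlaneTree → List PlaneTree
  | node ts => ts

/-- Whether the tree consists of its root only. -/
def isLeaf (t : PlaneTree) : Bool := t.branches.isEmpty

/-- The number of vertices. -/
def order : PlaneTree → ℕ
  | node ts => 1 + (ts.map order).sum

/-- A vertex is addressed by the list of (zero-based) positions among siblings along the path from
the root to it, so that the root is `[]`. `t.branchAt p` is the branch of `t` that is rooted at the
vertex with address `p`, and `none` if `t` has no such vertex. -/
def branchAt : PlaneTree → List ℕ → Option PlaneTree
  | t, [] => some t
  | node ts, i :: p => ts[i]?.bind fun s => branchAt s p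

/-- The addresses of the vertices at level `i`, from left to right. -/
def level : PlaneTree → ℕ → List (List ℕ)
  | _, 0 => [[]]
  | node ts, i + 1 => ts.zipIdx.flatMap fun sj => (level sj.1 i).map fun p => sj.2 :: p

/-- The addresses of all vertices in canonical order: level by level, and from left to right within
each level. -/
def canonicalOrder (t : PlaneTree) : List (List ℕ) :=
  (List.range t.order).flatMap t.level

/-- The addresses of the leaves in canonical order. -/
def leaves (t : PlaneTree) : List (List ℕ) :=
  t.canonicalOrder.filter fun p => (t.branchAt p).any isLeaf

/-- The addresses of the vertices that have a leaf among their children, in canonical order. -/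
def leafParents (t : PlaneTree) : List (List ℕ) :=
  t.canonicalOrder.filter fun p => (t.branchAt p).any fun s => s.branches.any isLeaf

/-- Apply `f` to the branch of a tree rooted at a given address. -/
def modifyAt (f : PlaneTree → PlaneTree) : List ℕ → PlaneTree → PlaneTree
  | [], t => f t
  | i :: p, node ts => node (ts.modify i (modifyAt f p))

/-- Apply `f` to the branches rooted at each of the addresses in a list. -/
def modifyEach (f : PlaneTree → PlaneTree) (ps : List (List ℕ)) (t : PlaneTree) : PlaneTree :=
  ps.foldl (fun s p => modifyAt f p s) t

/-- Replace the branches rooted at each of the addresses in a list by `s`. -/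
def replaceEach (s : PlaneTree) (ps : List (List ℕ)) (t : PlaneTree) : PlaneTree :=
  modifyEach (fun _ => s) ps t

/-- Add a new leaf as the rightmost child of the root. -/
def addChild : PlaneTree → PlaneTree
  | node ts => node (ts ++ [leaf])

/-- Remove the rightmost root branch (used only where that branch is a leaf). -/
def removeLastChild : PlaneTree → PlaneTree
  | node ts => node ts.dropLast

/-- Remove the `i`-th root branch (counted from 0). -/
def eraseChild (i : ℕ) : PlaneTree → PlaneTree
  | node ts => node (ts.eraseIdx i)

/-- Remove the last leaf in canonical order (from a tree that has at least two vertices). -/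
def removeLastLeaf (t : PlaneTree) : PlaneTree :=
  match t.leaves.getLast? with
  | none => t
  | some p =>
    match p.getLast? with
    | none => t
    | some i => modifyAt (eraseChild i) p.dropLast t

/-! ### The rooted tree underlying a plane tree -/

/-- The vertices of a plane tree. -/
def Vertex (t : PlaneTree) : Type := {p : List ℕ // (t.branchAt p).isSome}

/-- The longest common prefix of two lists. -/
def commonPrefix : List ℕ → List ℕ → List ℕ
  | a :: p, b :: q => if a = b then a :: commonPrefix p q else []
  | _, _ => []

theorem commonPrefix_prefix_left : ∀ p q : List ℕ, commonPrefix p q <+: p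
  | [], q => by simp [commonPrefix]
  | a :: p, [] => by simp [commonPrefix]
  | a :: p, b :: q => by
    unfold commonPrefix
    split_ifs with h
    · exact List.cons_prefix_cons.2 ⟨rfl, commonPrefix_prefix_left p q⟩
    · exact List.nil_prefix

theorem commonPrefix_prefix_right : ∀ p q : List ℕ, commonPrefix p q <+: q
  | [], q => by simp [commonPrefix]
  | a :: p, [] => by simp [commonPrefix]
  | a :: p, b :: q => by
    unfold commonPrefix
    split_ifs with h
    · exact List.cons_prefix_cons.2 ⟨h, commonPrefix_prefix_right p q⟩
    · exact List.nil_prefix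

theorem prefix_commonPrefix : ∀ r p q : List ℕ, r <+: p → r <+: q → r <+: commonPrefix p q
  | [], _, _, _, _ => List.nil_prefix
  | c :: r, [], _, h, _ => by simp at h
  | c :: r, _ :: _, [], _, h => by simp at h
  | c :: r, a :: p, b :: q, h, h' => by
    obtain ⟨rfl, hp⟩ := List.cons_prefix_cons.1 h
    obtain ⟨rfl, hq⟩ := List.cons_prefix_cons.1 h'
    simp only [commonPrefix, if_true]
    exact List.cons_prefix_cons.2 ⟨rfl, prefix_commonPrefix r p q hp hq⟩

theorem isSome_branchAt_of_prefix : ∀ (p q : List ℕ) (t : PlaneTree), p <+: q →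
    (t.branchAt q).isSome → (t.branchAt p).isSome
  | [], _, _, _, _ => by simp [branchAt]
  | a :: p, [], _, h, _ => by simp at h
  | a :: p, b :: q, node ts, h, h' => by
    obtain ⟨rfl, hp⟩ := List.cons_prefix_cons.1 h
    simp only [branchAt] at h' ⊢
    cases hs : ts[a]? with
    | none => simp [hs] at h'
    | some s =>
      simp only [hs, Option.bind_some] at h' ⊢
      exact isSome_branchAt_of_prefix p q s hp h'

instance (t : PlaneTree) : PartialOrder t.Vertex where
  le v w := v.1 <+: w.1
  le_refl v := List.prefix_rfl
  le_trans _ _ _ h h' := h.trans h'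
  le_antisymm _ _ h h' := Subtype.ext (h.eq_of_length_le h'.length_le)

theorem Vertex.le_def {t : PlaneTree} {v w : t.Vertex} : v ≤ w ↔ v.1 <+: w.1 := Iff.rfl

instance (t : PlaneTree) : SemilatticeInf t.Vertex where
  inf v w := ⟨commonPrefix v.1 w.1,
    isSome_branchAt_of_prefix _ _ _ (commonPrefix_prefix_left _ _) v.2⟩
  inf_le_left v w := commonPrefix_prefix_left v.1 w.1
  inf_le_right v w := commonPrefix_prefix_right v.1 w.1
  le_inf r v w h h' := prefix_commonPrefix r.1 v.1 w.1 h h'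

instance (t : PlaneTree) : OrderBot t.Vertex where
  bot := ⟨[], by simp [branchAt]⟩
  bot_le _ := Vertex.le_def.2 List.nil_prefix

/-- The parent of a vertex is obtained by deleting the last entry of its address. -/
instance (t : PlaneTree) : PredOrder t.Vertex where
  pred v := ⟨v.1.dropLast, isSome_branchAt_of_prefix _ _ _ (List.dropLast_prefix _) v.2⟩
  pred_le v := Vertex.le_def.2 (List.dropLast_prefix _)
  min_of_le_pred {v} h := by
    have h1 := (Vertex.le_def.1 h).length_le
    have h2 : v.1 = [] := by
      simp only [List.length_dropLast] at h1
      exact List.length_eq_zero_iff.1 (by omega)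
    intro w hw
    rw [Vertex.le_def, h2]
    exact List.nil_prefix
  le_pred_of_lt {v w} h := by
    have h1 : v.1 <+: w.1 := Vertex.le_def.1 h.le
    have h2 : v.1.length ≠ w.1.length := fun e =>
      h.ne (Subtype.ext (h1.eq_of_length e))
    have h3 := h1.length_le
    refine Vertex.le_def.2 (List.prefix_of_prefix_length_le h1 (List.dropLast_prefix _) ?_)
    simp only [List.length_dropLast]
    omega

instance (t : PlaneTree) : IsPredArchimedean t.Vertex where
  exists_pred_iterate_of_le {v w} h := by
    suffices H : ∀ (n : ℕ) (w : t.Vertex), v ≤ w → w.1.length = v.1.length + n →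
        ∃ k, Order.pred^[k] w = v from
      H (w.1.length - v.1.length) w h (by have := (Vertex.le_def.1 h).length_le; omega)
    intro n
    induction n with
    | zero =>
      intro w h hl
      exact ⟨0, Subtype.ext ((Vertex.le_def.1 h).eq_of_length (by omega)).symm⟩
    | succ n ih =>
      intro w h hl
      have hlt : v < w := lt_of_le_of_ne h (by rintro rfl; omega)
      obtain ⟨k, hk⟩ := ih (Order.pred w) (Order.le_pred_of_lt hlt) (by
        change w.1.dropLast.length = _
        simp only [List.length_dropLast]
        omega)
      exact ⟨k + 1, by rwa [Function.iterate_succ_apply]⟩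

/-- The rooted tree obtained from a plane tree by forgetting the embedding: the vertices are ordered
by ancestorship. -/
def toRootedTree (t : PlaneTree) : RootedTree.{0} where
  α := t.Vertex

/-! ### The construction -/

/-- The complete binary tree of height `k`. -/
def completeBinary : ℕ → PlaneTree
  | 0 => leaf
  | k + 1 => node [completeBinary k, completeBinary k]

/-- The tree `[•, •, •]`. -/
def four : PlaneTree := node [leaf, leaf, leaf]

/-- The tree `[[•, •, •], [•, •, •]]`. -/
def nine : PlaneTree := node [four, four]

/-- The tree `[[•, •], [•, •]]`. -/
def sevenA : PlaneTree := node [node [leaf, leaf], node [leaf, leaf]]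

/-- The tree `[[•, •, •], •, •]`. -/
def sevenB : PlaneTree := node [four, leaf, leaf]

/-- Start from the complete binary tree of height `h - 1`, replace the `m - 2 ^ (h - 1)` leftmost
leaves by `[[•, •, •], [•, •, •]]`, and the remaining leaves by `[•, •, •]`. -/
def base (h m : ℕ) : PlaneTree :=
  let c := completeBinary (h - 1)
  let k := m - 2 ^ (h - 1)
  replaceEach four (c.leaves.drop k) (replaceEach nine (c.leaves.take k) c)

/-- The five subcases of the construction. -/
def minTree (h m n : ℕ) : PlaneTree :=
  let b := base h m
  if n + 1 = 5 * m then b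
  else if n + 2 = 5 * m then b.removeLastLeaf
  else if n + 3 = 5 * m then modifyEach removeLastChild (b.leafParents.rtake 2) b
  else if n = 5 * m then modifyEach addChild (b.leafParents.take 1) b
  else modifyEach addChild (b.leafParents.take 2) b

end PlaneTree

/-!
A nonempty infima closed set of a tree with branches `B₁, …, Bₖ` either contains the root, and then
meets each branch in an arbitrary infima closed set, or it lies within one branch. Hence the number
`η` of nonempty infima closed sets satisfies `η = ∏ (η(Bᵢ) + 1) + ∑ η(Bᵢ)`. For two branches this
reads `η + 2 = (η(B₁) + 2) (η(B₂) + 2) - 1`. So everything is a matter of the function `phi`, where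
`phi (n + 1) - 2` is the minimum of `η` over the trees of order `n`: shifted orders `N = n + 1` add
up, and `phi N` is the minimum of `phi A * phi B - 1` over `A + B = N` as soon as the minimal trees
have exactly two branches. This is the case for `n ≥ 8` because merging two branches pays off
whenever there are three or more (`minCount_le_listCount`); the smaller orders are a finite
computation, which yields two minimal trees of order `7`.

The main point is to determine the optimal decompositions `N = A + B` (`IsOpt.isSplit`): with
`A ≥ B`, apart from two small cases, one of `A` and `B` is of the form `5 * 2 ^ k`, or both are
congruent to `1` modulo `5` and belong to two explicit families (`IsSplit`). The proof is by
induction on `N`.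

* Knowing the decompositions below `N`, one bounds the growth `phi (N + j) / phi N` within each
  residue class modulo `5`, since one part of a decomposition is divisible by `5` and the ratio is
  nearly inherited from the other part. Comparing these ratios shows that transferring one or two
  vertices between the branches is profitable unless `5` divides `A` or `B`, or both are congruent
  to `1` (`SplitBelow.mod`).
* Two branches at different places of the tree enter the count through affine functions of their
  values. Exchanging them, or exchanging branches of theirs, sorts the branches by size. A
  decomposition with both parts strictly between consecutive numbers `5 * 2 ^ k` thereby leads to a
  similar pair at half the size, and finally to shifted orders `6` and `6` (`SplitBelow.chain`).

A decomposition is determined by `N` (`IsSplit.unique`), so that minimal trees are unique up to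
isomorphism by induction, except that a branch of order `7` can be chosen in two ways. Such a branch
occurs only if `n` is congruent to `2` modulo `5`, and then exactly once
(`IsCanonical.exists_isTwin`); the two resulting trees differ in their numbers of leaves.

It remains to see that the construction yields the tree given by the decompositions
(`isCanonicalOf_minTree`). All trees in the construction have two branches that arise in the same
way from trees of height one less, because the canonical order within a level lists the vertices of
the left branch before those of the right one.
-/

namespace InfClosed

/-! ### The recursion for the minimum -/

/-- The values of `phi` below `8`. -/
def smallValue : ℕ → ℕ
  | 1 => 2
  | 2 => 3
  | 3 => 5
  | 4 => 8
  | 5 => 13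
  | 6 => 22
  | 7 => 38
  | _ => 0

/-- The numbers that arise from the small values by repeatedly joining two trees under a new root,
which turns the values `a` and `b` into `a * b - 1` and adds the shifted orders. -/
inductive Attained : ℕ → ℕ → Prop
  | small {N : ℕ} (h₁ : 1 ≤ N) (h₂ : N < 8) : Attained N (smallValue N)
  | join {A B a b : ℕ} (hA : Attained A a) (hB : Attained B b) (h : 8 ≤ A + B) :
      Attained (A + B) (a * b - 1)

/-- `phi (n + 1) - 2` is the least number of nonempty infima closed sets of a rooted tree of order
`n`. With these two shifts, joining two trees under a new root adds the arguments and turns the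
values `a`, `b` into `a * b - 1`; the argument `1` corresponds to an empty branch. -/
noncomputable def phi (N : ℕ) : ℕ := sInf {v | Attained N v}

theorem Attained.two_le {N v : ℕ} (h : Attained N v) : 2 ≤ v := by
  induction h with
  | @small N h₁ h₂ => interval_cases N <;> simp [smallValue]
  | @join A B a b _ _ _ ha hb =>
    have : 2 * 2 ≤ a * b := Nat.mul_le_mul ha hb
    omega

theorem Attained.one_le {N v : ℕ} (h : Attained N v) : 1 ≤ N := by
  induction h <;> omega

theorem exists_attained {N : ℕ} (hN : 1 ≤ N) : ∃ v, Attained N v := by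
  induction N using Nat.strong_induction_on with
  | _ N ih =>
    by_cases h : N < 8
    · exact ⟨_, .small hN h⟩
    · obtain ⟨a, ha⟩ := ih (N - 1) (by omega) (by omega)
      have := Attained.join ha (.small (N := 1) le_rfl (by omega)) (by omega)
      rw [Nat.sub_add_cancel hN] at this
      exact ⟨_, this⟩

theorem attained_phi {N : ℕ} (hN : 1 ≤ N) : Attained N (phi N) :=
  Nat.sInf_mem (s := {v | Attained N v}) (exists_attained hN)

theorem phi_le {N v : ℕ} (h : Attained N v) : phi N ≤ v := Nat.sInf_le h

theorem two_le_phi {N : ℕ} (hN : 1 ≤ N) : 2 ≤ phi N := (attained_phi hN).two_le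

theorem phi_of_lt {N : ℕ} (h₁ : 1 ≤ N) (h₂ : N < 8) : phi N = smallValue N := by
  generalize hv : phi N = v
  have h := attained_phi h₁
  rw [hv] at h
  cases h with
  | small => rfl
  | join hA hB h => omega

theorem phi_one : phi 1 = 2 := phi_of_lt (by norm_num) (by norm_num)
theorem phi_two : phi 2 = 3 := phi_of_lt (by norm_num) (by norm_num)
theorem phi_three : phi 3 = 5 := phi_of_lt (by norm_num) (by norm_num)
theorem phi_four : phi 4 = 8 := phi_of_lt (by norm_num) (by norm_num)
theorem phi_five : phi 5 = 13 := phi_of_lt (by norm_num) (by norm_num)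
theorem phi_six : phi 6 = 22 := phi_of_lt (by norm_num) (by norm_num)
theorem phi_seven : phi 7 = 38 := phi_of_lt (by norm_num) (by norm_num)

theorem phi_add_le {A B : ℕ} (hA : 1 ≤ A) (hB : 1 ≤ B) : phi (A + B) + 1 ≤ phi A * phi B := by
  by_cases h : 8 ≤ A + B
  · have h₁ := phi_le (.join (attained_phi hA) (attained_phi hB) h)
    have h₂ : 2 * 2 ≤ phi A * phi B := Nat.mul_le_mul (two_le_phi hA) (two_le_phi hB)
    omega
  · have hA' : A < 8 := by omega
    have hB' : B < 8 := by omega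
    rw [phi_of_lt hA hA', phi_of_lt hB hB', phi_of_lt (by omega) (by omega)]
    interval_cases A <;> interval_cases B <;> simp [smallValue] at h ⊢

/-- `A` and `B`, in decreasing order, are the shifted orders of the branches in an optimal binary
decomposition. -/
structure IsOpt (A B : ℕ) : Prop where
  one_le : 1 ≤ B
  le : B ≤ A
  eq : phi A * phi B = phi (A + B) + 1

theorem exists_isOpt {N : ℕ} (hN : 8 ≤ N) : ∃ A B, A + B = N ∧ IsOpt A B := by
  have hv := attained_phi (show 1 ≤ N by omega)
  generalize h' : phi N = v at hv
  cases hv with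
  | small => omega
  | @join A B a b hA hB h =>
    have key : phi A * phi B = phi (A + B) + 1 := by
      apply le_antisymm _ (phi_add_le hA.one_le hB.one_le)
      have h₁ : phi A * phi B ≤ a * b := Nat.mul_le_mul (phi_le hA) (phi_le hB)
      have h₂ := h'
      have h₃ : 2 * 2 ≤ a * b := Nat.mul_le_mul hA.two_le hB.two_le
      omega
    rcases le_total B A with hBA | hBA
    · exact ⟨A, B, rfl, hB.one_le, hBA, key⟩
    · exact ⟨B, A, add_comm _ _, hA.one_le, hBA, by rw [mul_comm, key, add_comm A B]⟩

theorem phi_lt_phi_succ {N : ℕ} (hN : 1 ≤ N) : phi N < phi (N + 1) := by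
  induction N using Nat.strong_induction_on with
  | _ N ih =>
    by_cases h : N < 7
    · rw [phi_of_lt hN (by omega), phi_of_lt (N := N + 1) (by omega) (by omega)]
      interval_cases N <;> simp [smallValue]
    · obtain ⟨A, B, hAB, hB, hBA, he⟩ := exists_isOpt (N := N + 1) (by omega)
      have h₁ := ih (A - 1) (by omega) (by omega)
      rw [Nat.sub_add_cancel (by omega)] at h₁
      have h₂ := phi_add_le (A := A - 1) (B := B) (by omega) hB
      rw [show A - 1 + B = N by omega] at h₂
      have h₃ := Nat.mul_lt_mul_of_pos_right h₁ (show 0 < phi B by linarith [two_le_phi hB])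
      rw [← hAB]
      omega

theorem phi_lt_phi {A B : ℕ} (hA : 1 ≤ A) (h : A < B) : phi A < phi B := by
  induction B, h using Nat.le_induction with
  | base => exact phi_lt_phi_succ hA
  | succ B hB ih => exact ih.trans (phi_lt_phi_succ (by omega))

theorem phi_le_phi {A B : ℕ} (hA : 1 ≤ A) (h : A ≤ B) : phi A ≤ phi B := by
  rcases h.eq_or_lt with rfl | h
  · rfl
  · exact (phi_lt_phi hA h).le

theorem phi_le_phi_iff {A B : ℕ} (hA : 1 ≤ A) (hB : 1 ≤ B) : phi A ≤ phi B ↔ A ≤ B :=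
  ⟨fun h => by by_contra! h'; exact absurd (phi_lt_phi hB h') (by omega), phi_le_phi hA⟩

/-! ### Growth of the minimum from one order to the next -/

/-- Lower bounds for the growth of `phi` pass from a part of an optimal decomposition to the
whole. -/
theorem IsOpt.lower_left {A B a b j : ℕ} (h : IsOpt A B) (hab : a ≤ b) (hj : j < A)
    (hA : b * phi (A - j) ≤ a * phi A) : b * phi (A + B - j) ≤ a * phi (A + B) := by
  have h₁ := phi_add_le (A := A - j) (B := B) (by omega) h.one_le
  rw [show A - j + B = A + B - j by omega] at h₁
  have h₂ := h.eq
  have h₃ := Nat.mul_le_mul_right (phi B) hA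
  nlinarith

theorem IsOpt.lower_right {A B a b j : ℕ} (h : IsOpt A B) (hab : a ≤ b) (hj : j < B)
    (hB : b * phi (B - j) ≤ a * phi B) : b * phi (A + B - j) ≤ a * phi (A + B) := by
  have h₁ := phi_add_le (A := A) (B := B - j) (h.one_le.trans h.le) (by omega)
  rw [show A + (B - j) = A + B - j by omega] at h₁
  have h₂ := h.eq
  have h₃ := Nat.mul_le_mul_left (phi A) hB
  nlinarith

/-- Upper bounds for the growth of `phi`, in the form `a * phi (N + j) + c ≤ b * phi N`, pass from a
part of an optimal decomposition to the whole. The term `c` compensates for the `- 1` in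
`phi (A + B) = phi A * phi B - 1`. -/
theorem IsOpt.upper_left {A B a b c j : ℕ} (h : IsOpt A B) (hc : b + c ≤ a + c * phi B)
    (hA : a * phi (A + j) + c ≤ b * phi A) : a * phi (A + B + j) + c ≤ b * phi (A + B) := by
  have h₁ := phi_add_le (A := A + j) (B := B) (by linarith [h.one_le, h.le]) h.one_le
  rw [show A + j + B = A + B + j by omega] at h₁
  have h₂ := h.eq
  have h₃ := Nat.mul_le_mul_right (phi B) hA
  nlinarith

theorem IsOpt.upper_right {A B a b c j : ℕ} (h : IsOpt A B) (hc : b + c ≤ a + c * phi A)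
    (hB : a * phi (B + j) + c ≤ b * phi B) : a * phi (A + B + j) + c ≤ b * phi (A + B) := by
  have h₁ := phi_add_le (A := A) (B := B + j) (h.one_le.trans h.le) (by linarith [h.one_le])
  rw [show A + (B + j) = A + B + j by omega] at h₁
  have h₂ := h.eq
  have h₃ := Nat.mul_le_mul_left (phi A) hB
  nlinarith

/-- The ratio of consecutive values is smallest between `phi 3 = 5` and `phi 4 = 8`. -/
theorem mul_phi_le_mul_phi_succ {N : ℕ} (hN : 2 ≤ N) : 8 * phi N ≤ 5 * phi (N + 1) := by
  induction N using Nat.strong_induction_on with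
  | _ N ih =>
    by_cases h : N < 7
    · rw [phi_of_lt (N := N) (by omega) (by omega), phi_of_lt (N := N + 1) (by omega) (by omega)]
      interval_cases N <;> simp [smallValue]
    · obtain ⟨A, B, hAB, hO⟩ := exists_isOpt (N := N + 1) (by omega)
      have hBA := hO.le
      have hB := hO.one_le
      have := ih (A - 1) (by omega) (by omega)
      rw [Nat.sub_add_cancel (by omega : 1 ≤ A)] at this
      simpa [hAB] using hO.lower_left (j := 1) (by norm_num) (by omega) this

/-- The ratio of consecutive values is at most `7 / 4`; the summand `8` carries the induction. -/
theorem mul_phi_succ_le_mul_phi {N : ℕ} (hN : 3 ≤ N) : 20 * phi (N + 1) + 8 ≤ 35 * phi N := by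
  induction N using Nat.strong_induction_on with
  | _ N ih =>
    by_cases h : N < 7
    · rw [phi_of_lt (N := N) (by omega) (by omega), phi_of_lt (N := N + 1) (by omega) (by omega)]
      interval_cases N <;> simp [smallValue]
    · by_cases h7 : N = 7
      · have := phi_add_le (A := 4) (B := 4) (by omega) (by omega)
        norm_num [phi_four] at this
        rw [h7, phi_seven]
        norm_num
        omega
      obtain ⟨A, B, hAB, hO⟩ := exists_isOpt (N := N) (by omega)
      have hBA := hO.le
      have hB := hO.one_le
      have h₁ := ih A (by omega) (by omega)
      by_cases hB1 : B = 1
      · have h₂ := hO.eq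
        rw [hB1, phi_one] at h₂
        have h₃ := phi_le_phi (A := 4) (by omega) (show 4 ≤ A by omega)
        rw [phi_four] at h₃
        omega
      · have h₃ := phi_le_phi (A := 2) (by omega) (show 2 ≤ B by omega)
        rw [phi_two] at h₃
        simpa [hAB] using hO.upper_left (j := 1) (by omega) h₁

theorem phi_eight : phi 8 = 63 := by
  obtain ⟨A, B, hAB, hO⟩ := exists_isOpt (N := 8) (by omega)
  have h := phi_add_le (A := 4) (B := 4) (by omega) (by omega)
  have hBA := hO.le
  have hB := hO.one_le
  have he := hO.eq
  obtain rfl : A = 8 - B := by omega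
  have hB' : B ≤ 4 := by omega
  rw [hAB] at he
  interval_cases B <;>
    norm_num [phi_one, phi_two, phi_three, phi_four, phi_five, phi_six, phi_seven] at h he <;> omega

theorem phi_nine : phi 9 = 103 := by
  obtain ⟨A, B, hAB, hO⟩ := exists_isOpt (N := 9) (by omega)
  have h := phi_add_le (A := 5) (B := 4) (by omega) (by omega)
  have hBA := hO.le
  have hB := hO.one_le
  have he := hO.eq
  obtain rfl : A = 9 - B := by omega
  have hB' : B ≤ 4 := by omega
  rw [hAB] at he
  interval_cases B <;>
    norm_num [phi_one, phi_two, phi_three, phi_four, phi_five, phi_six, phi_seven, phi_eight]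
      at h he <;> omega

theorem phi_ten : phi 10 = 168 := by
  obtain ⟨A, B, hAB, hO⟩ := exists_isOpt (N := 10) (by omega)
  have h := phi_add_le (A := 5) (B := 5) (by omega) (by omega)
  have hBA := hO.le
  have hB := hO.one_le
  have he := hO.eq
  obtain rfl : A = 10 - B := by omega
  have hB' : B ≤ 5 := by omega
  rw [hAB] at he
  interval_cases B <;>
    norm_num [phi_one, phi_two, phi_three, phi_four, phi_five, phi_six, phi_seven, phi_eight,
      phi_nine] at h he <;> omega

/-- From `phi 4 = 8` and `phi 5 = 13` on, the ratio of consecutive values is at least `13 / 8`. -/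
theorem mul_phi_pred_le_mul_phi {N : ℕ} (hN : 5 ≤ N) : 13 * phi (N - 1) ≤ 8 * phi N := by
  induction N using Nat.strong_induction_on with
  | _ N ih =>
    by_cases h : N < 9
    · interval_cases N <;> norm_num [phi_four, phi_five, phi_six, phi_seven, phi_eight]
    · obtain ⟨A, B, hAB, hO⟩ := exists_isOpt (N := N) (by omega)
      have hBA := hO.le
      have hB := hO.one_le
      have := ih A (by omega) (by omega)
      simpa [hAB] using hO.lower_left (j := 1) (by norm_num) (by omega) this

/-- Three steps multiply `phi` by at least `35 / 8`, which exceeds `phi 5 / phi 2 = 13 / 3`. -/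
theorem mul_phi_sub_three_le_mul_phi {N : ℕ} (hN : 6 ≤ N) : 35 * phi (N - 3) ≤ 8 * phi N := by
  induction N using Nat.strong_induction_on with
  | _ N ih =>
    by_cases h : N < 11
    · interval_cases N <;> norm_num [phi_three, phi_four, phi_five, phi_six, phi_seven, phi_eight,
        phi_nine, phi_ten]
    · obtain ⟨A, B, hAB, hO⟩ := exists_isOpt (N := N) (by omega)
      have hBA := hO.le
      have hB := hO.one_le
      have := ih A (by omega) (by omega)
      simpa [hAB] using hO.lower_left (j := 3) (by norm_num) (by omega) this

/-- For shifted order at least `8`, both branches of an optimal decomposition have shifted order at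
least `4`. -/
theorem IsOpt.four_le {A B : ℕ} (h : IsOpt A B) (hN : 8 ≤ A + B) : 4 ≤ B := by
  by_contra! hB
  have h₀ := h.one_le
  have h₁ := h.le
  have he := h.eq
  have h₂ := two_le_phi (N := A - 3) (by omega)
  have h₃ := phi_lt_phi (A := A - 3) (B := A - 1) (by omega) (by omega)
  -- Transferring vertices such that `B = 1, 2, 3` becomes `2, 5, 4` is a gain.
  interval_cases B
  · have h₄ := phi_add_le (A := A - 1) (B := 2) (by omega) (by omega)
    rw [show A - 1 + 2 = A + 1 by omega, phi_two] at h₄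
    have := mul_phi_le_mul_phi_succ (N := A - 1) (by omega)
    rw [Nat.sub_add_cancel (by omega)] at this
    rw [phi_one] at he
    omega
  · have h₄ := phi_add_le (A := A - 3) (B := 5) (by omega) (by omega)
    rw [show A - 3 + 5 = A + 2 by omega, phi_five] at h₄
    have := mul_phi_sub_three_le_mul_phi (N := A) (by omega)
    rw [phi_two] at he
    omega
  · have h₄ := phi_add_le (A := A - 1) (B := 4) (by omega) (by omega)
    rw [show A - 1 + 4 = A + 3 by omega, phi_four] at h₄
    have := mul_phi_pred_le_mul_phi (N := A) (by omega)
    rw [phi_three] at he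
    omega

/-! ### The candidates for optimal decompositions -/

/-- The shifted orders `A ≥ B` of the two branches of a minimal tree. Apart from two small cases,
one of them is of the form `5 * 2 ^ k`, the shifted order of a complete binary tree with `[•, •, •]`
in place of its leaves, with two exceptional families where both are congruent to `1` modulo `5`. -/
def IsSplit (A B : ℕ) : Prop :=
  (A = 4 ∧ B = 4) ∨ (A = 5 ∧ B = 4) ∨ ∃ k : ℕ,
    (B = 5 * 2 ^ k ∧ B ≤ A ∧ A ≤ 2 * B ∧ A + 3 ≠ 2 * B) ∨
    (A = 2 * (5 * 2 ^ k) ∧ B ≤ A ∧ A ≤ 2 * B ∧ B + 3 ≠ A) ∨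
    (A + 4 = 2 * (5 * 2 ^ k) ∧ B = 5 * 2 ^ k + 1) ∨
    (A = 2 * (5 * 2 ^ k) + 1 ∧ B + 4 = 2 * (5 * 2 ^ k))

theorem five_le_pow (k : ℕ) : 5 ≤ 5 * 2 ^ k := by
  have := Nat.one_le_two_pow (n := k)
  omega

theorem two_mul_pow_le_pow {j k : ℕ} (h : j < k) : 2 * (5 * 2 ^ j) ≤ 5 * 2 ^ k := by
  have := Nat.pow_le_pow_right (n := 2) (by norm_num) (Nat.succ_le_of_lt h)
  rw [Nat.succ_eq_add_one, pow_succ] at this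
  omega

theorem pow_cases (j k : ℕ) : 2 * (5 * 2 ^ j) ≤ 5 * 2 ^ k ∨ 5 * 2 ^ j = 5 * 2 ^ k ∨
    2 * (5 * 2 ^ k) ≤ 5 * 2 ^ j := by
  rcases lt_trichotomy j k with h | rfl | h
  · exact Or.inl (two_mul_pow_le_pow h)
  · exact Or.inr (Or.inl rfl)
  · exact Or.inr (Or.inr (two_mul_pow_le_pow h))

/-- A decomposition is determined by the order of the tree. -/
theorem IsSplit.unique {A B A' B' : ℕ} (h : IsSplit A B) (h' : IsSplit A' B')
    (hs : A + B = A' + B') : A = A' ∧ B = B' := by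
  have key : ∀ {A B A' B' : ℕ}, (A = 4 ∧ B = 4) ∨ (A = 5 ∧ B = 4) → IsSplit A' B' →
      A + B = A' + B' → A = A' ∧ B = B' := by
    rintro A B A' B' h (h' | h' | ⟨k, h'⟩) hs
    · omega
    · omega
    · have := five_le_pow k
      omega
  rcases h with h | h | ⟨k, h⟩
  · exact key (Or.inl h) h' hs
  · exact key (Or.inr h) h' hs
  rcases h' with h' | h' | ⟨j, h'⟩
  · exact (key (Or.inl h') (Or.inr (Or.inr ⟨k, h⟩)) hs.symm).imp Eq.symm Eq.symm
  · exact (key (Or.inr h') (Or.inr (Or.inr ⟨k, h⟩)) hs.symm).imp Eq.symm Eq.symm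
  have h₁ := five_le_pow k
  have h₂ := five_le_pow j
  have h₃ := pow_cases j k
  generalize 5 * 2 ^ k = E at *
  generalize 5 * 2 ^ j = F at *
  omega

theorem IsSplit.le {A B : ℕ} (h : IsSplit A B) : B ≤ A := by
  rcases h with h | h | ⟨k, h⟩
  · omega
  · omega
  · have := five_le_pow k
    omega

theorem IsSplit.four_le {A B : ℕ} (h : IsSplit A B) : 4 ≤ B := by
  rcases h with h | h | ⟨k, h⟩
  · omega
  · omega
  · have := five_le_pow k
    omega

theorem IsSplit.five_le {A B : ℕ} (h : IsSplit A B) (hN : 10 ≤ A + B) : 5 ≤ B := by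
  rcases h with h | h | ⟨k, h⟩
  · omega
  · omega
  · have := five_le_pow k
    omega

theorem IsSplit.mod {A B : ℕ} (h : IsSplit A B) (hN : 10 ≤ A + B) :
    A % 5 = 0 ∨ B % 5 = 0 ∨ (A % 5 = 1 ∧ B % 5 = 1) := by
  rcases h with h | h | ⟨k, h⟩ <;> omega

/-- Below `N`, all optimal decompositions are among the candidates. -/
def SplitBelow (N : ℕ) : Prop := ∀ A B, 8 ≤ A + B → A + B < N → IsOpt A B → IsSplit A B

theorem SplitBelow.exists {M N : ℕ} (h : SplitBelow M) (hN : 8 ≤ N) (hM : N < M) :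
    ∃ A B, A + B = N ∧ IsOpt A B ∧ IsSplit A B := by
  obtain ⟨A, B, rfl, hO⟩ := exists_isOpt hN
  exact ⟨A, B, rfl, hO, h A B hN hM hO⟩

theorem SplitBelow.isOpt {M A B : ℕ} (h : SplitBelow M) (hM : A + B < M) (hS : IsSplit A B) :
    IsOpt A B := by
  have h₁ := hS.le
  have h₂ := hS.four_le
  obtain ⟨A', B', hs, hO, hS'⟩ := h.exists (N := A + B) (by omega) hM
  obtain ⟨rfl, rfl⟩ := hS'.unique hS hs
  exact hO

/-! ### Growth of the minimum within a residue class modulo 5 -/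

/-- A lower bound for the growth of `phi` extends from one argument between `5` and `9` to its
residue class modulo `5`, except that for residue `2` both branches may have residue `1`. -/
theorem SplitBelow.lower {M X a b j : ℕ} (h : SplitBelow M) (hX : 5 ≤ X) (hX' : X < 10)
    (hj : j < 5) (hab : a ≤ b) (hbase : b * phi (X - j) ≤ a * phi X)
    (hone : ∀ A B, IsOpt A B → IsSplit A B → A % 5 = 1 → B % 5 = 1 → (A + B) % 5 = X % 5 →
      A + B < M → b * phi (A + B - j) ≤ a * phi (A + B))
    {N : ℕ} (hN : X ≤ N) (hM : N < M) (hmod : N % 5 = X % 5) : b * phi (N - j) ≤ a * phi N := by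
  induction N using Nat.strong_induction_on with
  | _ N ih =>
    rcases hN.eq_or_lt with rfl | hN
    · exact hbase
    obtain ⟨A, B, rfl, hO, hS⟩ := h.exists (N := N) (by omega) hM
    have h₁ := hS.five_le (by omega)
    have h₂ := hS.le
    rcases hS.mod (by omega) with h₀ | h₀ | h₀
    · exact hO.lower_right hab (by omega) (ih B (by omega) (by omega) (by omega) (by omega))
    · exact hO.lower_left hab (by omega) (ih A (by omega) (by omega) (by omega) (by omega))
    · exact hone A B hO hS h₀.1 h₀.2 hmod hM

/-- An upper bound for the growth of `phi` extends from one argument between `5` and `9` to its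
residue class modulo `5`. The ratio `b / a` is chosen slightly larger than the one at the initial
argument, to leave room for the constant `c`. -/
theorem SplitBelow.upper {M X a b c j : ℕ} (h : SplitBelow M) (hX : 5 ≤ X) (hX' : X < 10)
    (hX2 : X % 5 ≠ 2) (hc : b + c ≤ a + c * 13)
    (hbase : a * phi (X + j) + c ≤ b * phi X)
    {N : ℕ} (hN : X ≤ N) (hM : N < M) (hmod : N % 5 = X % 5) :
    a * phi (N + j) + c ≤ b * phi N := by
  induction N using Nat.strong_induction_on with
  | _ N ih =>
    rcases hN.eq_or_lt with rfl | hN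
    · exact hbase
    obtain ⟨A, B, rfl, hO, hS⟩ := h.exists (N := N) (by omega) hM
    have h₁ := hS.five_le (by omega)
    have h₂ := hS.le
    have h₃ := Nat.mul_le_mul_left c (phi_le_phi (A := 5) (by norm_num) h₁)
    have h₄ := Nat.mul_le_mul_left c (phi_le_phi (A := 5) (by norm_num) (h₁.trans h₂))
    rw [phi_five] at h₃ h₄
    rcases hS.mod (by omega) with h₀ | h₀ | h₀
    · exact hO.upper_right (by omega) (ih B (by omega) (by omega) (by omega) (by omega))
    · exact hO.upper_left (by omega) (ih A (by omega) (by omega) (by omega) (by omega))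
    · omega

theorem SplitBelow.lower_one {M N : ℕ} (h : SplitBelow M) (hN : 6 ≤ N) (hM : N < M)
    (hmod : N % 5 = 1) : 22 * phi (N - 1) ≤ 13 * phi N :=
  h.lower (X := 6) (by norm_num) (by norm_num) (by norm_num) (by norm_num)
    (by norm_num [phi_five, phi_six]) (fun A B _ _ _ _ _ _ => by omega) hN hM hmod

theorem SplitBelow.lower_two {M N : ℕ} (h : SplitBelow M) (hN : 7 ≤ N) (hM : N < M)
    (hmod : N % 5 = 2) : 22 * phi (N - 1) ≤ 13 * phi N := by
  refine h.lower (X := 7) (by norm_num) (by norm_num) (by norm_num) (by norm_num)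
    (by norm_num [phi_seven, phi_six]) (fun A B hO hS hA hB _ hM => ?_) hN hM hmod
  have := hS.four_le
  have := hS.le
  exact hO.lower_left (by norm_num) (by omega) (h.lower_one (by omega) (by omega) hA)

theorem SplitBelow.lower_three {M N : ℕ} (h : SplitBelow M) (hN : 8 ≤ N) (hM : N < M)
    (hmod : N % 5 = 3) : 63 * phi (N - 1) ≤ 38 * phi N :=
  h.lower (X := 8) (by norm_num) (by norm_num) (by norm_num) (by norm_num)
    (by norm_num [phi_seven, phi_eight]) (fun A B _ _ _ _ _ _ => by omega) hN hM hmod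

theorem SplitBelow.lower_four {M N : ℕ} (h : SplitBelow M) (hN : 9 ≤ N) (hM : N < M)
    (hmod : N % 5 = 4) : 103 * phi (N - 1) ≤ 63 * phi N :=
  h.lower (X := 9) (by norm_num) (by norm_num) (by norm_num) (by norm_num)
    (by norm_num [phi_nine, phi_eight]) (fun A B _ _ _ _ _ _ => by omega) hN hM hmod

theorem SplitBelow.upper_four {M N : ℕ} (h : SplitBelow M) (hN : 4 ≤ N) (hM : N < M)
    (hmod : N % 5 = 4) : 125 * phi (N + 1) + 7 ≤ 204 * phi N := by
  by_cases h4 : N = 4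
  · norm_num [h4, phi_four, phi_five]
  exact h.upper (X := 9) (by norm_num) (by norm_num) (by norm_num) (by norm_num)
    (by norm_num [phi_nine, phi_ten]) (by omega) hM hmod

theorem SplitBelow.upper_three {M N : ℕ} (h : SplitBelow M) (hM : N < M)
    (hmod : N % 5 = 3) : 250 * phi (N + 1) + 14 ≤ 409 * phi N := by
  by_cases h3 : N = 3
  · norm_num [h3, phi_three, phi_four]
  exact h.upper (X := 8) (by norm_num) (by norm_num) (by norm_num) (by norm_num)
    (by norm_num [phi_nine, phi_eight]) (by omega) hM hmod

theorem SplitBelow.upper_one {M N : ℕ} (h : SplitBelow M) (hN : 6 ≤ N) (hM : N < M)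
    (hmod : N % 5 = 1) : 1000 * phi (N + 2) + 156 ≤ 2871 * phi N :=
  h.upper (X := 6) (by norm_num) (by norm_num) (by norm_num) (by norm_num)
    (by norm_num [phi_six, phi_eight]) hN hM hmod

theorem SplitBelow.eq_of_split {M A B : ℕ} (h : SplitBelow M) (hM : A + B < M)
    (hS : IsSplit A B) : phi A * phi B = phi (A + B) + 1 := (h.isOpt hM hS).eq

/-- The growth at the orders of one of the parts in the exceptional decompositions, where both parts
are congruent to `1` modulo `5`; the general bound `lower_one` is too weak there. -/
theorem SplitBelow.lower_pow_add_one {M k : ℕ} (h : SplitBelow M) (hM : 5 * 2 ^ (k + 1) + 1 < M) :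
    285 * phi (5 * 2 ^ (k + 1)) ≤ 168 * phi (5 * 2 ^ (k + 1) + 1) := by
  induction k with
  | zero =>
    have h₁ := h.eq_of_split (A := 6) (B := 5) (by omega)
      (Or.inr (Or.inr ⟨0, by omega⟩))
    norm_num [phi_five, phi_six, phi_ten] at h₁ ⊢
    omega
  | succ k ih =>
    have h₀ := five_le_pow (k + 1)
    rw [pow_succ] at hM ⊢
    have hO := h.isOpt (A := 5 * 2 ^ (k + 1) + 1) (B := 5 * 2 ^ (k + 1)) (by omega)
      (Or.inr (Or.inr ⟨k + 1, by omega⟩))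
    have := hO.lower_left (a := 168) (b := 285) (j := 1) (by norm_num) (by omega) (ih (by omega))
    convert this using 3 <;> omega

/-- The counterpart of `lower_pow_add_one` for the other part in the exceptional decompositions. -/
theorem SplitBelow.lower_pow_sub_four {M k A : ℕ} (h : SplitBelow M)
    (hA : A + 4 = 2 * (5 * 2 ^ (k + 1))) (hM : A < M) :
    3695 * phi (A - 1) ≤ 2183 * phi A := by
  induction k generalizing A with
  | zero =>
    obtain rfl : A = 16 := by omega
    have h₁ := h.eq_of_split (A := 10) (B := 6) (by omega)
      (Or.inr (Or.inr ⟨0, by omega⟩))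
    have h₂ := phi_add_le (A := 10) (B := 5) (by omega) (by omega)
    norm_num [phi_five, phi_six, phi_ten] at h₁ h₂ ⊢
    omega
  | succ k ih =>
    have h₀ := five_le_pow k
    rw [pow_succ, pow_succ] at hA
    have hO := h.isOpt (A := 2 * (5 * 2 ^ (k + 1))) (B := A - 2 * (5 * 2 ^ (k + 1)))
      (by rw [pow_succ] at *; omega) (Or.inr (Or.inr ⟨k + 1, by rw [pow_succ] at *; omega⟩))
    have := hO.lower_right (a := 2183) (b := 3695) (j := 1) (by norm_num)
      (by rw [pow_succ]; omega) (ih (by rw [pow_succ]; omega) (by rw [pow_succ]; omega))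
    convert this using 3 <;> rw [pow_succ] <;> omega

/-- The residue `2` is the delicate one: the two steps down to the residue `0` are compared with
the two steps from residue `1` to residue `3` in `upper_one`, and the bounds nearly coincide. -/
theorem SplitBelow.lower_two_two {M N : ℕ} (h : SplitBelow M) (hN : 7 ≤ N) (hM : N < M)
    (hmod : N % 5 = 2) : 28714 * phi (N - 2) ≤ 10000 * phi N := by
  refine h.lower (X := 7) (by norm_num) (by norm_num) (by norm_num) (by norm_num)
    (by norm_num [phi_seven, phi_five]) (fun A B hO hS hA hB _ hM => ?_) hN hM hmod
  -- If both parts are congruent to `1`, each of them loses one vertex.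
  have key : ∀ {C D : ℕ}, IsOpt (max C D) (min C D) → 285 * phi (C - 1) ≤ 168 * phi C →
      3695 * phi (D - 1) ≤ 2183 * phi D → 2 ≤ C → 2 ≤ D →
      28714 * phi (C + D - 2) ≤ 10000 * phi (C + D) := by
    intro C D hO h₁ h₂ hC hD
    have h₃ : phi C * phi D = phi (C + D) + 1 := by
      have := hO.eq
      rcases le_total C D with h | h
      · rwa [max_eq_right h, min_eq_left h, mul_comm, add_comm D C] at this
      · rwa [max_eq_left h, min_eq_right h] at this
    have h₄ := phi_add_le (A := C - 1) (B := D - 1) (by omega) (by omega)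
    rw [show C - 1 + (D - 1) = C + D - 2 by omega] at h₄
    have h₅ := Nat.mul_le_mul h₁ h₂
    have h₆ : 285 * 3695 * (phi (C - 1) * phi (D - 1)) ≤ 168 * 2183 * (phi C * phi D) := by
      linarith
    have h₇ := two_le_phi (N := C + D) (by omega)
    omega
  rcases hS with hS | hS | ⟨k, hS | hS | ⟨h₁, h₂⟩ | ⟨h₁, h₂⟩⟩
  · omega
  · omega
  · omega
  · omega
  · rcases k with _ | k
    · obtain rfl : A = 6 := by omega
      obtain rfl : B = 6 := by omega
      have := hO.eq
      norm_num [phi_six, phi_ten] at this ⊢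
      omega
    · have h₀ := five_le_pow k
      have h₃ : 2 * (5 * 2 ^ k) = 5 * 2 ^ (k + 1) := by rw [pow_succ]; ring
      have hmax : max B A = A := max_eq_right hO.le
      have hmin : min B A = B := min_eq_left hO.le
      rw [add_comm A B]
      refine key (by rwa [hmax, hmin]) ?_ (h.lower_pow_sub_four h₁ (by omega)) (by omega)
        (by omega)
      subst h₂
      exact h.lower_pow_add_one (by omega)
  · rcases k with _ | k
    · obtain rfl : A = 11 := by omega
      obtain rfl : B = 6 := by omega
      have h₁ := hO.eq
      have h₂ := h.eq_of_split (A := 6) (B := 5) (by omega)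
        (Or.inr (Or.inr ⟨0, by omega⟩))
      have h₃ := phi_add_le (A := 10) (B := 5) (by omega) (by omega)
      norm_num [phi_five, phi_six, phi_ten] at h₁ h₂ h₃ ⊢
      omega
    · have h₀ := five_le_pow k
      have h₃ : 2 * (5 * 2 ^ k) = 5 * 2 ^ (k + 1) := by rw [pow_succ]; ring
      have h₄ : 2 * (5 * 2 ^ (k + 1)) = 5 * 2 ^ (k + 1 + 1) := by rw [pow_succ 2 (k + 1)]; ring
      have hmax : max A B = A := max_eq_left hO.le
      have hmin : min A B = B := min_eq_right hO.le
      refine key (by rwa [hmax, hmin]) ?_ (h.lower_pow_sub_four h₂ (by omega)) (by omega)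
        (by omega)
      subst h₁
      rw [h₄]
      exact h.lower_pow_add_one (by omega)

/-! ### Residues of the branches in an optimal decomposition -/

/-- Transferring vertices from one branch to the other does not improve an optimal
decomposition. -/
theorem no_gain {x y x' y' a b c d : ℕ} (hx : b * x' ≤ a * x) (hy : c * y' ≤ d * y)
    (hopt : x * y ≤ x' * y') (hlt : a * d < b * c) (hpos : 0 < x * y) : False := by
  have h₁ := Nat.mul_le_mul hx hy
  have h₂ := Nat.mul_le_mul_left (b * c) hopt
  have h₃ := Nat.mul_lt_mul_of_pos_right hlt hpos
  nlinarith

/-- For each of these pairs of residues, one or two vertices can be transferred from one branch to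
the other such that the bounds for the growth of `phi` show a gain. -/
theorem SplitBelow.excluded_residues {A B : ℕ} (h : SplitBelow (A + B)) (hN : 10 ≤ A + B)
    (hA : 4 ≤ A) (hB : 4 ≤ B) (hO : phi A * phi B ≤ phi (A + B) + 1) :
    ¬ (A % 5 = 1 ∧ B % 5 = 4) ∧ ¬ (A % 5 = 1 ∧ B % 5 = 3) ∧ ¬ (A % 5 = 1 ∧ B % 5 = 2) ∧
    ¬ (A % 5 = 2 ∧ B % 5 = 2) ∧ ¬ (A % 5 = 2 ∧ B % 5 = 3) ∧ ¬ (A % 5 = 2 ∧ B % 5 = 4) ∧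
    ¬ (A % 5 = 3 ∧ B % 5 = 3) ∧ ¬ (A % 5 = 3 ∧ B % 5 = 4) ∧
    ¬ (A % 5 = 4 ∧ B % 5 = 4 ∧ B ≤ A) := by
  have hpos : 0 < phi A * phi B :=
    Nat.mul_pos (by linarith [two_le_phi (N := A) (by omega)])
      (by linarith [two_le_phi (N := B) (by omega)])
  have move : ∀ {A' B' : ℕ}, 1 ≤ A' → 1 ≤ B' → A' + B' = A + B →
      phi A * phi B ≤ phi A' * phi B' := fun hA' hB' hs =>
    hO.trans (hs ▸ phi_add_le hA' hB')
  refine ⟨?_, ?_, ?_, ?_, ?_, ?_, ?_, ?_, ?_⟩ <;> rintro ⟨hA', hB'⟩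
  · have h₁ := h.lower_one (N := A) (by omega) (by omega) hA'
    have h₂ := h.upper_four (N := B) (by omega) (by omega) hB'
    exact no_gain h₁ (show 125 * phi (B + 1) ≤ 204 * phi B by omega)
      (move (by omega) (by omega) (by omega)) (by norm_num) hpos
  · have h₁ := h.lower_one (N := A) (by omega) (by omega) hA'
    have h₂ := h.upper_three (N := B) (by omega) hB'
    exact no_gain h₁ (show 250 * phi (B + 1) ≤ 409 * phi B by omega)
      (move (by omega) (by omega) (by omega)) (by norm_num) hpos
  · have h₁ := h.lower_two_two (N := B) (by omega) (by omega) hB'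
    have h₂ := h.upper_one (N := A) (by omega) (by omega) hA'
    exact no_gain (show 1000 * phi (A + 2) ≤ 2871 * phi A by omega) h₁
      (move (by omega) (by omega) (by omega)) (by norm_num) hpos
  · have h₁ := h.lower_two_two (N := B) (by omega) (by omega) hB'
    have h₂ := h.upper_three (N := A + 1) (by omega) (by omega)
    have h₃ := mul_phi_succ_le_mul_phi (N := A) (by omega)
    exact no_gain (show 5000 * phi (A + 1 + 1) ≤ 14315 * phi A by omega) h₁
      (move (by omega) (by omega) (by omega)) (by norm_num) hpos
  · have h₁ := h.lower_two (N := A) (by omega) (by omega) hA'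
    have h₂ := h.upper_three (N := B) (by omega) hB'
    exact no_gain h₁ (show 250 * phi (B + 1) ≤ 409 * phi B by omega)
      (move (by omega) (by omega) (by omega)) (by norm_num) hpos
  · have h₁ := h.lower_two (N := A) (by omega) (by omega) hA'
    have h₂ := h.upper_four (N := B) (by omega) (by omega) hB'
    exact no_gain h₁ (show 125 * phi (B + 1) ≤ 204 * phi B by omega)
      (move (by omega) (by omega) (by omega)) (by norm_num) hpos
  · have h₁ := h.lower_three (N := A) (by omega) (by omega) hA'
    have h₂ := h.upper_three (N := B) (by omega) hB'
    exact no_gain h₁ (show 250 * phi (B + 1) ≤ 409 * phi B by omega)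
      (move (by omega) (by omega) (by omega)) (by norm_num) hpos
  · have h₁ := h.lower_three (N := A) (by omega) (by omega) hA'
    have h₂ := h.upper_four (N := B) (by omega) (by omega) hB'
    exact no_gain h₁ (show 125 * phi (B + 1) ≤ 204 * phi B by omega)
      (move (by omega) (by omega) (by omega)) (by norm_num) hpos
  · have h₁ := h.lower_four (N := A) (by omega) (by omega) hA'
    have h₂ := h.upper_four (N := B) (by omega) (by omega) hB'.1
    exact no_gain h₁ (show 125 * phi (B + 1) ≤ 204 * phi B by omega)
      (move (by omega) (by omega) (by omega)) (by norm_num) hpos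

theorem SplitBelow.mod {A B : ℕ} (h : SplitBelow (A + B)) (hN : 10 ≤ A + B) (hA : 4 ≤ A)
    (hB : 4 ≤ B) (hO : phi A * phi B ≤ phi (A + B) + 1) :
    A % 5 = 0 ∨ B % 5 = 0 ∨ (A % 5 = 1 ∧ B % 5 = 1) := by
  have h₁ := h.excluded_residues hN hA hB hO
  have h₂ := SplitBelow.excluded_residues (A := B) (B := A) (by rwa [add_comm]) (by omega) hB hA
    (by rwa [mul_comm, add_comm B A])
  have hr : A % 5 < 5 := Nat.mod_lt _ (by norm_num)
  have hs : B % 5 < 5 := Nat.mod_lt _ (by norm_num)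
  have hAB := le_total A B
  generalize A % 5 = r at *
  generalize B % 5 = s at *
  interval_cases r <;> interval_cases s <;> simp at h₁ h₂ ⊢
  all_goals omega

/-! ### Exchanging branches -/

/-- Exchanging two branches of an optimal decomposition, one of them a branch of the larger part,
shows that the smaller part is at least as large as the branches of the larger one. -/
theorem IsOpt.branch_le {A₁ A₂ B : ℕ} (hA : IsOpt A₁ A₂) (hB : 1 ≤ B)
    (hO : phi (A₁ + A₂) * phi B ≤ phi (A₁ + A₂ + B) + 1) : A₁ ≤ B := by
  have h₀ := hA.one_le
  have h₁ := hA.le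
  rw [← phi_le_phi_iff (by omega) hB]
  have h₂ := phi_add_le (A := A₁) (B := A₂ + B) (by omega) (by omega)
  rw [← add_assoc] at h₂
  have h₃ := phi_add_le h₀ hB
  have h₄ := hA.eq
  have h₅ : phi A₁ * (phi (A₂ + B) + 1) ≤ phi A₁ * (phi A₂ * phi B) := Nat.mul_le_mul_left _ h₃
  have h₆ : (phi A₁ * phi A₂) * phi B = (phi (A₁ + A₂) + 1) * phi B := by rw [h₄]
  nlinarith

/-- The effect of exchanging the factors `c₂` and `d₁` in a product of two affine functions. -/
theorem exchange_lt {α β γ δ c₁ c₂ d₁ d₂ : ℤ} (hpq : γ * (α + β) ≤ α * (γ + δ))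
    (hq : 0 < γ * (α + β)) (hc₁ : 0 < c₁) (h₁ : c₂ < d₁) (h₂ : d₂ < c₁) :
    (α * (c₁ * d₁ - 1) - β) * (γ * (c₂ * d₂ - 1) - δ) <
      (α * (c₁ * c₂ - 1) - β) * (γ * (d₁ * d₂ - 1) - δ) := by
  have e : (α * (c₁ * c₂ - 1) - β) * (γ * (d₁ * d₂ - 1) - δ) -
      (α * (c₁ * d₁ - 1) - β) * (γ * (c₂ * d₂ - 1) - δ) =
      (d₁ - c₂) * (α * (γ + δ) * c₁ - γ * (α + β) * d₂) := by ring
  have h₃ := mul_lt_mul_of_pos_left h₂ hq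
  have h₄ := mul_le_mul_of_nonneg_right hpq hc₁.le
  have h₅ := mul_pos (sub_pos.2 h₁) (show 0 < α * (γ + δ) * c₁ - γ * (α + β) * d₂ by linarith)
  linarith

/-- In an optimal decomposition, the branches of one part are at least as large as those of the
other. -/
theorem IsOpt.not_crossing {A₁ A₂ B₁ B₂ : ℕ} (hA : IsOpt A₁ A₂) (hB : IsOpt B₁ B₂)
    (hO : IsOpt (A₁ + A₂) (B₁ + B₂)) (h₁ : A₂ < B₁) (h₂ : B₂ < A₁) : False := by
  have h₃ := hA.one_le
  have h₄ := hA.le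
  have h₅ := hB.one_le
  have h₆ := hB.le
  have h := exchange_lt (α := 1) (β := 0) (γ := 1) (δ := 0) (c₁ := phi A₁) (c₂ := phi A₂)
    (d₁ := phi B₁) (d₂ := phi B₂) (by norm_num) (by norm_num)
    (by have := two_le_phi (N := A₁) (by omega); omega) (by exact_mod_cast phi_lt_phi h₃ h₁)
    (by exact_mod_cast phi_lt_phi h₅ h₂)
  have ha := hA.eq
  have hb := hB.eq
  have ho := hO.eq
  have h₇ := phi_add_le (A := A₁) (B := B₁) (by omega) (by omega)
  have h₈ := phi_add_le (A := A₂) (B := B₂) (by omega) (by omega)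
  have h₉ := phi_add_le (A := A₁ + B₁) (B := A₂ + B₂) (by omega) (by omega)
  rw [show A₁ + B₁ + (A₂ + B₂) = A₁ + A₂ + (B₁ + B₂) by omega, ← ho] at h₉
  zify at ha hb h₇ h₈ h₉
  have h₁₀ := mul_le_mul (show (phi (A₁ + B₁) : ℤ) ≤ phi A₁ * phi B₁ - 1 by linarith)
    (show (phi (A₂ + B₂) : ℤ) ≤ phi A₂ * phi B₂ - 1 by linarith) (by positivity)
    (by linarith [show (0 : ℤ) ≤ phi (A₁ + B₁) by positivity])
  rw [ha, hb] at h
  simp only [one_mul, sub_zero, add_sub_cancel_right] at h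
  linarith

/-- A branch of size `X` inside a larger tree contributes to the tree through an affine function
`α * phi X - β`. Suppose that two disjoint branches `C`, `D` whose sizes lie strictly between
`E = 5 * 2 ^ k` and `2 * E` cannot be improved by redistributing their vertices. The comparison of
`β / α` with `δ / γ` says which of the two sits at the better place. Sorting the four branches of
`C` and `D` produces another such pair, between `E / 2` and `E`, so that eventually both have
shifted order `6`, and the sizes can be computed backwards. -/
theorem SplitBelow.chain {M : ℕ} (h : SplitBelow M) (k : ℕ) :
    ∀ {C D : ℕ} {α β γ δ : ℤ}, C < M → D < M → 0 < α → 0 < γ → 0 ≤ β → 0 ≤ δ → β ≤ α → δ ≤ γ →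
      (β * γ < α * δ ∨ β * γ = α * δ ∧ D ≤ C) →
      5 * 2 ^ k < C → C < 2 * (5 * 2 ^ k) → 5 * 2 ^ k < D → D < 2 * (5 * 2 ^ k) →
      (C % 5 = 0 ∨ D % 5 = 0 ∨ (C % 5 = 1 ∧ D % 5 = 1)) →
      (∀ C' D' : ℕ, 1 ≤ C' → 1 ≤ D' → C' + D' = C + D →
        (α * phi C - β) * (γ * phi D - δ) ≤ (α * phi C' - β) * (γ * phi D' - δ)) →
      C + 4 = 2 * (5 * 2 ^ k) ∧ D = 5 * 2 ^ k + 1 := by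
  induction k with
  | zero =>
    intro C D α β γ δ _ _ _ _ _ _ _ _ _ h₁ h₂ h₃ h₄ hmod _
    omega
  | succ k ih =>
    intro C D α β γ δ hCM hDM hα hγ hβ hδ hβα hδγ hlt h₁ h₂ h₃ h₄ hmod hmin
    have hE := five_le_pow k
    have hE5 : (5 * 2 ^ k) % 5 = 0 := Nat.mul_mod_right 5 _
    have hE' : 5 * 2 ^ (k + 1) = 2 * (5 * 2 ^ k) := by rw [pow_succ]; ring
    rw [hE'] at h₁ h₂ h₃ h₄ ⊢
    generalize hEE : 5 * 2 ^ k = E at *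
    obtain ⟨C₁, C₂, rfl, hC, hCS⟩ := h.exists (N := C) (by omega) hCM
    obtain ⟨D₁, D₂, rfl, hD, hDS⟩ := h.exists (N := D) (by omega) hDM
    have hCmod := hCS.mod (by omega)
    have hDmod := hDS.mod (by omega)
    have hC1 := hC.one_le
    have hD1 := hD.one_le
    have hCle := hC.le
    have hDle := hD.le
    have hCeq : (phi C₁ : ℤ) * phi C₂ = phi (C₁ + C₂) + 1 := by exact_mod_cast hC.eq
    have hDeq : (phi D₁ : ℤ) * phi D₂ = phi (D₁ + D₂) + 1 := by exact_mod_cast hD.eq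
    have hpos : ∀ {X : ℕ}, 1 ≤ X → (2 : ℤ) ≤ phi X := fun hX => by exact_mod_cast two_le_phi hX
    have hadd : ∀ {X Y : ℕ}, 1 ≤ X → 1 ≤ Y → (phi (X + Y) : ℤ) ≤ phi X * phi Y - 1 :=
      fun hX hY => by
        have := phi_add_le hX hY
        zify at this
        linarith
    have c₁ := hpos (X := C₁) (by omega)
    have c₂ := hpos (X := C₂) (by omega)
    have d₁ := hpos (X := D₁) (by omega)
    have d₂ := hpos (X := D₂) (by omega)
    have hCD : (phi (C₁ + C₂) : ℤ) = phi C₁ * phi C₂ - 1 := by linarith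
    have hDD : (phi (D₁ + D₂) : ℤ) = phi D₁ * phi D₂ - 1 := by linarith
    -- Replacing the branches of `C` and `D` by others, in terms of products.
    have hmul : ∀ X₁ X₂ Y₁ Y₂ : ℕ, 1 ≤ X₁ → 1 ≤ X₂ → 1 ≤ Y₁ → 1 ≤ Y₂ →
        X₁ + X₂ + (Y₁ + Y₂) = C₁ + C₂ + (D₁ + D₂) →
        (α * (phi C₁ * phi C₂ - 1) - β) * (γ * (phi D₁ * phi D₂ - 1) - δ) ≤
          (α * (phi X₁ * phi X₂ - 1) - β) * (γ * (phi Y₁ * phi Y₂ - 1) - δ) := by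
      intro X₁ X₂ Y₁ Y₂ hX₁ hX₂ hY₁ hY₂ hs
      have h := hmin (X₁ + X₂) (Y₁ + Y₂) (by omega) (by omega) hs
      rw [hCD, hDD] at h
      have hx := hpos (X := X₁ + X₂) (by omega)
      have hy := hpos (X := Y₁ + Y₂) (by omega)
      have hx' := mul_le_mul_of_nonneg_left (hadd hX₁ hX₂) hα.le
      have hy' := mul_le_mul_of_nonneg_left (hadd hY₁ hY₂) hγ.le
      have hx'' := mul_le_mul_of_nonneg_left hx hα.le
      have hy'' := mul_le_mul_of_nonneg_left hy hγ.le
      refine h.trans (mul_le_mul ?_ ?_ ?_ ?_) <;> linarith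
    have hpq : γ * (α + β) ≤ α * (γ + δ) := by
      rcases hlt with hlt | ⟨hlt, _⟩ <;> linarith
    -- Otherwise exchanging `C` and `D`, or only their branches `C₂` and `D₁`, would be a gain.
    have hsort : D₁ ≤ C₂ := by
      by_contra! hcon
      by_cases hCD' : C₁ ≤ D₂
      · have hlt' : β * γ < α * δ := by
          rcases hlt with hlt | ⟨_, hle⟩
          · exact hlt
          · omega
        have h := hmin (D₁ + D₂) (C₁ + C₂) (by omega) (by omega) (by omega)
        have h' : (phi (C₁ + C₂) : ℤ) < phi (D₁ + D₂) := by
          exact_mod_cast phi_lt_phi (by omega) (show C₁ + C₂ < D₁ + D₂ by omega)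
        have e : (α * phi (C₁ + C₂) - β) * (γ * phi (D₁ + D₂) - δ) -
            (α * phi (D₁ + D₂) - β) * (γ * phi (C₁ + C₂) - δ) =
            (α * δ - β * γ) * (phi (D₁ + D₂) - phi (C₁ + C₂)) := by ring
        linarith [mul_pos (sub_pos.2 hlt') (sub_pos.2 h')]
      · have h := hmul C₁ D₁ C₂ D₂ (by omega) (by omega) (by omega) (by omega) (by omega)
        have h' : (phi C₂ : ℤ) < phi D₁ := by exact_mod_cast phi_lt_phi hC1 hcon
        have h'' : (phi D₂ : ℤ) < phi C₁ := by exact_mod_cast phi_lt_phi hD1 (by omega)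
        exact absurd h (exchange_lt hpq (by positivity) (by linarith) h' h'').not_ge
    have hα₂ := mul_le_mul_of_nonneg_left c₁ hα.le
    have hγ₂ := mul_le_mul_of_nonneg_left d₂ hγ.le
    -- With all other branches fixed, `C₂` and `D₁` form a pair of the same kind at half the size.
    have hkey := ih (C := C₂) (D := D₁) (α := α * phi C₁) (β := α + β) (γ := γ * phi D₂)
      (δ := γ + δ) (by omega) (by omega) (by positivity) (by positivity) (by positivity)
      (by positivity) (by linarith) (by linarith) ?_ (by omega) (by omega) (by omega) (by omega)
      (by omega) ?_
    · omega
    · have hle : (phi D₂ : ℤ) ≤ phi C₁ := by exact_mod_cast phi_le_phi hD1 (by omega)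
      have hp : 0 ≤ α * (γ + δ) := by positivity
      have h₅ : (α + β) * (γ * phi D₂) ≤ α * phi C₁ * (γ + δ) := by
        have h₆ := mul_le_mul hpq hle (by linarith) hp
        linarith
      rcases h₅.lt_or_eq with h₅ | h₅
      · exact Or.inl h₅
      · exact Or.inr ⟨h₅, hsort⟩
    · intro C' D' hC' hD' hs
      have h := hmul C₁ C' D' D₂ (by omega) (by omega) (by omega) (by omega) (by omega)
      linarith

/-! ### The shape of optimal decompositions -/

/-- Two parts that lie strictly between `E = 5 * 2 ^ k` and `2 * E` form the first exceptional
family. -/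
theorem SplitBelow.both_between {A B k : ℕ} (h : SplitBelow (A + B)) (hO : IsOpt A B)
    (hmod : A % 5 = 0 ∨ B % 5 = 0 ∨ (A % 5 = 1 ∧ B % 5 = 1)) (hA : A < 2 * (5 * 2 ^ k))
    (hB : 5 * 2 ^ k < B) : IsSplit A B := by
  have hE := five_le_pow k
  have hle := hO.le
  have := h.chain k (C := A) (D := B) (α := 1) (β := 0) (γ := 1) (δ := 0) (by omega) (by omega)
    (by norm_num) (by norm_num) (by norm_num) (by norm_num) (by norm_num) (by norm_num)
    (Or.inr ⟨by norm_num, hle⟩) (by omega) hA hB (by omega) hmod (fun C' D' hC' hD' hs => by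
      have h₁ := phi_add_le hC' hD'
      rw [hs, ← hO.eq] at h₁
      zify at h₁
      linarith)
  exact Or.inr (Or.inr ⟨k, Or.inr (Or.inr (Or.inl this))⟩)

/-- A part smaller than `E = 5 * 2 ^ k` next to one between `E` and `2 * E` belongs to the second
exceptional family. -/
theorem SplitBelow.smaller_below {A B k : ℕ} (h : SplitBelow (A + B)) (hO : IsOpt A B)
    (hmod : A % 5 = 0 ∨ B % 5 = 0 ∨ (A % 5 = 1 ∧ B % 5 = 1)) (hA : 5 * 2 ^ k < A)
    (hA' : A < 2 * (5 * 2 ^ k)) (hB : B < 5 * 2 ^ k) (hB4 : 4 ≤ B) : IsSplit A B := by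
  rcases k with _ | k
  · omega
  have hE := five_le_pow k
  have hE' : 5 * 2 ^ (k + 1) = 2 * (5 * 2 ^ k) := by rw [pow_succ]; ring
  have hE5 : (5 * 2 ^ k) % 5 = 0 := Nat.mul_mod_right 5 _
  rw [hE'] at hA hA' hB
  obtain ⟨A₁, A₂, rfl, hAO, hAS⟩ := h.exists (N := A) (by omega) (by omega)
  have hle := hAO.branch_le hO.one_le hO.eq.le
  -- By `A₁ ≤ B`, neither branch of `A` reaches `2 * (5 * 2 ^ k)`.
  have hA₂ : A₂ = 5 * 2 ^ k := by
    have hle' := hAO.le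
    rcases hAS with hS | hS | ⟨j, hS⟩
    · omega
    · omega
    have hF := five_le_pow j
    have hjk := pow_cases j k
    have hF5 : (5 * 2 ^ j) % 5 = 0 := Nat.mul_mod_right 5 _
    generalize 5 * 2 ^ j = F at *
    generalize 5 * 2 ^ k = E at *
    omega
  subst hA₂
  have hpos : (2 : ℤ) ≤ phi (5 * 2 ^ k) := by exact_mod_cast two_le_phi (by omega)
  have := h.chain k (C := B) (D := A₁) (α := 1) (β := 0) (γ := phi (5 * 2 ^ k)) (δ := 1) (by omega)
    (by omega) (by norm_num) (by linarith) (by norm_num) (by norm_num) (by norm_num) (by linarith)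
    (Or.inl (by norm_num)) (by omega) (by omega) (by omega) (by omega) (by omega)
    (fun C' D' hC' hD' hs => by
      have h₁ := phi_add_le (A := C') (B := D' + 5 * 2 ^ k) hC' (by omega)
      rw [show C' + (D' + 5 * 2 ^ k) = A₁ + 5 * 2 ^ k + B by omega, ← hO.eq] at h₁
      have h₂ := phi_add_le (A := D') (B := 5 * 2 ^ k) hD' (by omega)
      have h₃ := hAO.eq
      zify at h₁ h₂ h₃
      have h₄ : (2 : ℤ) ≤ phi C' := by exact_mod_cast two_le_phi hC'
      nlinarith)
  exact Or.inr (Or.inr ⟨k, by omega⟩)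

theorem exists_pow_le {A : ℕ} (hA : 5 ≤ A) : ∃ k, 5 * 2 ^ k ≤ A ∧ A < 2 * (5 * 2 ^ k) := by
  refine ⟨Nat.log 2 (A / 5), ?_, ?_⟩
  · have := Nat.pow_log_le_self 2 (x := A / 5) (by omega)
    omega
  · have := Nat.lt_pow_succ_log_self (b := 2) (by norm_num) (A / 5)
    rw [pow_succ] at this
    omega

theorem SplitBelow.isSplit {A B : ℕ} (h : SplitBelow (A + B)) (hO : IsOpt A B)
    (hN : 8 ≤ A + B) : IsSplit A B := by
  have hB4 := hO.four_le hN
  have hle := hO.le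
  by_cases hN' : A + B < 10
  · have : A = 4 ∧ B = 4 ∨ A = 5 ∧ B = 4 := by omega
    exact this.imp_right Or.inl
  have hmod := h.mod (by omega) (by omega) hB4 hO.eq.le
  obtain ⟨k, hk, hk'⟩ := exists_pow_le (A := A) (by omega)
  have hE := five_le_pow k
  rcases hk.eq_or_lt with hA | hA
  · -- The larger part is `5 * 2 ^ k`.
    rcases k with _ | k
    · exact Or.inr (Or.inr ⟨0, by omega⟩)
    have hE := five_le_pow k
    have hE' : 5 * 2 ^ (k + 1) = 2 * (5 * 2 ^ k) := by rw [pow_succ]; ring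
    obtain ⟨A₁, A₂, rfl, hAO, hAS⟩ := h.exists (N := A) (by omega) (by omega)
    have h₁ := hAO.branch_le hO.one_le hO.eq.le
    have h₂ := hAO.le
    by_cases hB3 : B + 3 = A₁ + A₂
    · -- Beyond the smallest case, the branches of `A` lie strictly between those of `B`.
      exfalso
      have hS : IsSplit (5 * 2 ^ k) (5 * 2 ^ k) := Or.inr (Or.inr ⟨k, by omega⟩)
      obtain ⟨rfl, rfl⟩ := hAS.unique hS (by omega)
      rcases k with _ | k
      · obtain rfl : B = 7 := by omega
        have h₃ := h.eq_of_split (A := 6) (B := 5) (by omega) (Or.inr (Or.inr ⟨0, by omega⟩))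
        have h₄ := phi_add_le (A := 11) (B := 6) (by omega) (by omega)
        have h₅ := hO.eq
        norm_num [phi_five, phi_six, phi_seven, phi_ten] at h₃ h₄ h₅
        omega
      · have hE := five_le_pow k
        have hE' : 5 * 2 ^ (k + 1) = 2 * (5 * 2 ^ k) := by rw [pow_succ]; ring
        obtain ⟨B₁, B₂, rfl, hBO, hBS⟩ := h.exists (N := B) (by omega) (by omega)
        have hS : IsSplit (2 * (5 * 2 ^ k) + 1) (2 * (5 * 2 ^ k) - 4) :=
          Or.inr (Or.inr ⟨k, by omega⟩)
        obtain ⟨rfl, rfl⟩ := hBS.unique hS (by omega)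
        exact hAO.not_crossing hBO hO (by omega) (by omega)
    · exact Or.inr (Or.inr ⟨k, by omega⟩)
  rcases lt_trichotomy B (5 * 2 ^ k) with hB | hB | hB
  · exact h.smaller_below hO hmod hA hk' hB hB4
  · by_cases hA3 : A + 3 = 2 * B
    · -- Beyond the smallest case, one branch of `A` exceeds `B`.
      exfalso
      rcases k with _ | k
      · obtain rfl : B = 5 := by omega
        obtain rfl : A = 7 := by omega
        have h₃ := phi_add_le (A := 6) (B := 6) (by omega) (by omega)
        have h₅ := hO.eq
        norm_num [phi_five, phi_six, phi_seven] at h₃ h₅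
        omega
      · have hE := five_le_pow k
        have hE' : 5 * 2 ^ (k + 1) = 2 * (5 * 2 ^ k) := by rw [pow_succ]; ring
        obtain ⟨A₁, A₂, rfl, hAO, hAS⟩ := h.exists (N := A) (by omega) (by omega)
        have h₁ := hAO.branch_le hO.one_le hO.eq.le
        have hS : IsSplit (2 * (5 * 2 ^ k) + 1) (2 * (5 * 2 ^ k) - 4) :=
          Or.inr (Or.inr ⟨k, by omega⟩)
        obtain ⟨rfl, rfl⟩ := hAS.unique hS (by omega)
        omega
    · exact Or.inr (Or.inr ⟨k, by omega⟩)
  · exact h.both_between hO hmod hk' hB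

theorem splitBelow (N : ℕ) : SplitBelow N := by
  induction N using Nat.strong_induction_on with
  | _ N ih =>
    intro A B h₁ h₂ hO
    exact (ih _ h₂).isSplit hO h₁

theorem IsOpt.isSplit {A B : ℕ} (hO : IsOpt A B) (hN : 8 ≤ A + B) : IsSplit A B :=
  (splitBelow _).isSplit hO hN

theorem IsSplit.isOpt {A B : ℕ} (hS : IsSplit A B) : IsOpt A B :=
  (splitBelow (A + B + 1)).isOpt (by omega) hS


theorem IsSplit.mod_of_mod {A B : ℕ} (h : IsSplit A B) (hN : 9 ≤ A + B)
    (hmod : (A + B) % 5 ≠ 3) : A % 5 ≠ 3 ∧ B % 5 ≠ 3 := by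
  rcases h with h | h | ⟨k, h⟩ <;> omega

theorem IsSplit.ne_seven {A B : ℕ} (h : IsSplit A B) : A ≠ 7 ∧ B ≠ 7 := by
  rcases h with h | h | ⟨k, h⟩
  · omega
  · omega
  · have h₁ := five_le_pow k
    have h₂ : (5 * 2 ^ k) % 5 = 0 := Nat.mul_mod_right 5 _
    generalize 5 * 2 ^ k = E at *
    omega

/-! ### The number of branches -/

/-- The least number of nonempty infima closed sets of a rooted tree of order `n`; the value `0` for
`n = 0` corresponds to an empty branch. -/
noncomputable def minCount (n : ℕ) : ℕ := phi (n + 1) - 2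

theorem minCount_add_two (n : ℕ) : minCount n + 2 = phi (n + 1) :=
  Nat.sub_add_cancel (two_le_phi (by omega))

/-- The number of nonempty infima closed sets of a tree whose branches are minimal and have the
orders in `l`. The product counts the sets that contain the root, and the sum the others. -/
noncomputable def listCount (l : List ℕ) : ℕ :=
  (l.map fun i => minCount i + 1).prod + (l.map minCount).sum

theorem listCount_perm {l l' : List ℕ} (h : l.Perm l') : listCount l = listCount l' := by
  unfold listCount
  rw [(h.map _).prod_eq, (h.map _).sum_eq]

theorem minCount_mono {m n : ℕ} (h : m ≤ n) : minCount m ≤ minCount n := by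
  have h₁ := minCount_add_two m
  have h₂ := minCount_add_two n
  have := phi_le_phi (A := m + 1) (B := n + 1) (by omega) (by omega)
  omega

theorem minCount_one : minCount 1 = 1 := by simp [minCount, phi_two]
theorem minCount_two : minCount 2 = 3 := by simp [minCount, phi_three]
theorem minCount_three : minCount 3 = 6 := by simp [minCount, phi_four]

/-- Three steps multiply `phi` by less than `5`, the factor by which two further branches that are
leaves multiply the leading term in the count. -/
theorem mul_phi_add_three_le_mul_phi {N : ℕ} (hN : 6 ≤ N) : 10 * phi (N + 3) + 6 ≤ 49 * phi N := by
  induction N using Nat.strong_induction_on with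
  | _ N ih =>
    by_cases h : N < 11
    · have h₁ := phi_add_le (A := 6) (B := 5) (by norm_num) (by norm_num)
      have h₂ := phi_add_le (A := 6) (B := 6) (by norm_num) (by norm_num)
      have h₃ := phi_add_le (A := 8) (B := 5) (by norm_num) (by norm_num)
      norm_num [phi_five, phi_six, phi_eight] at h₁ h₂ h₃
      interval_cases N <;> norm_num [phi_six, phi_seven, phi_eight, phi_nine, phi_ten] <;> omega
    · obtain ⟨A, B, rfl, hO⟩ := exists_isOpt (N := N) (by omega)
      have hS := hO.isSplit (by omega)
      have h₁ := hS.five_le (by omega)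
      have h₂ := hS.le
      have h₃ := phi_le_phi (A := 5) (by norm_num) h₁
      rw [phi_five] at h₃
      exact hO.upper_left (by omega) (ih A (by omega) (by omega))

theorem add_one_le_prod {o : List ℕ} (hpos : ∀ i ∈ o, 1 ≤ i) :
    2 ^ o.length ≤ (o.map fun i => minCount i + 1).prod := by
  induction o with
  | nil => simp
  | cons a o ih =>
    have h₁ := ih fun i hi => hpos i (List.mem_cons_of_mem _ hi)
    have h₂ := minCount_mono (hpos a List.mem_cons_self)
    rw [minCount_one] at h₂
    rw [List.map_cons, List.prod_cons, List.length_cons, pow_succ, mul_comm]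
    exact Nat.mul_le_mul (by omega) h₁

theorem listCount_two (a b : ℕ) : listCount [a, b] + 3 = phi (a + 1) * phi (b + 1) := by
  rw [← minCount_add_two, ← minCount_add_two]
  simp only [listCount, List.map_cons, List.map_nil, List.prod_cons, List.prod_nil, List.sum_cons,
    List.sum_nil]
  ring

/-- Merging two branches of order at least `2` into one lowers the count, if there are at least two
further branches or a further branch that is not a leaf. -/
theorem listCount_merge {p q : ℕ} {o : List ℕ} (hp : 2 ≤ p) (hq : 2 ≤ q)
    (ho : 4 ≤ (o.map fun i => minCount i + 1).prod) :
    listCount ((p + q) :: o) < listCount (p :: q :: o) := by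
  have h₁ := phi_add_le (A := p + 1) (B := q) (by omega) (by omega)
  have h₂ := mul_phi_le_mul_phi_succ hq
  rw [show p + 1 + q = p + q + 1 by ring, ← minCount_add_two, ← minCount_add_two] at h₁
  rw [← minCount_add_two] at h₂
  have h₃ := minCount_mono hp
  have h₄ := minCount_mono hq
  rw [minCount_two] at h₃ h₄
  simp only [listCount, List.map_cons, List.prod_cons, List.sum_cons]
  generalize (o.map fun i => minCount i + 1).prod = P at *
  generalize minCount (p + q) = r at *
  generalize minCount p = x at *
  generalize minCount q = y at *
  generalize phi q = z at *
  have h₅ := Nat.mul_le_mul_left (x + 2) h₂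
  have h₆ : 8 * r + 24 ≤ 5 * ((x + 2) * (y + 2)) := by nlinarith
  obtain ⟨x, rfl⟩ := Nat.exists_eq_add_of_le h₃
  obtain ⟨y, rfl⟩ := Nat.exists_eq_add_of_le h₄
  obtain ⟨P, rfl⟩ := Nat.exists_eq_add_of_le ho
  have h₇ : r + 1 ≤ (3 + x + 1) * (3 + y + 1) := by nlinarith
  have h₈ := Nat.mul_le_mul_left P h₇
  nlinarith

/-- Merging a leaf with another branch lowers the count, if there are at least two further
branches. -/
theorem listCount_merge_leaf {q : ℕ} {o : List ℕ} (hq : 2 ≤ q)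
    (ho : 4 ≤ (o.map fun i => minCount i + 1).prod) :
    listCount ((q + 1) :: o) < listCount (q :: 1 :: o) := by
  have h₁ := mul_phi_succ_le_mul_phi (N := q + 1) (by omega)
  rw [← minCount_add_two, ← minCount_add_two] at h₁
  have h₃ := minCount_mono hq
  rw [minCount_two] at h₃
  simp only [listCount, List.map_cons, List.prod_cons, List.sum_cons, minCount_one]
  generalize (o.map fun i => minCount i + 1).prod = P at *
  generalize minCount (q + 1) = r at *
  generalize minCount q = x at *
  obtain ⟨x, rfl⟩ := Nat.exists_eq_add_of_le h₃
  obtain ⟨P, rfl⟩ := Nat.exists_eq_add_of_le ho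
  have h₇ : r + 1 ≤ (3 + x + 1) * 2 := by omega
  have h₈ := Nat.mul_le_mul_left P h₇
  nlinarith

theorem listCount_merge_leaves {o : List ℕ} (ho : 4 ≤ (o.map fun i => minCount i + 1).prod) :
    listCount (3 :: o) < listCount (1 :: 1 :: 1 :: o) := by
  simp only [listCount, List.map_cons, List.prod_cons, List.sum_cons, minCount_one, minCount_three]
  omega

theorem minCount_lt_of_two_leaves {q : ℕ} (hq : 5 ≤ q) : minCount (q + 3) < listCount [q, 1, 1] := by
  have h₁ := mul_phi_add_three_le_mul_phi (N := q + 1) (by omega)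
  have h₂ := minCount_add_two (q + 3)
  have h₃ := minCount_add_two q
  have h₄ := phi_le_phi (A := 6) (B := q + 1) (by omega) (by omega)
  rw [phi_six] at h₄
  rw [show q + 1 + 3 = q + 3 + 1 by ring] at h₁
  simp only [listCount, List.map_cons, List.map_nil, List.prod_cons, List.prod_nil, List.sum_cons,
    List.sum_nil, minCount_one]
  omega

theorem minCount_lt_of_leaf {p q : ℕ} (hp : 3 ≤ p) (hq : 2 ≤ q) :
    minCount (p + q + 2) < listCount [p, q, 1] := by
  have h₁ := mul_phi_succ_le_mul_phi (N := p + 1) (by omega)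
  have h₂ := minCount_add_two (p + q + 2)
  have h₃ := phi_add_le (A := p + 2) (B := q + 1) (by omega) (by omega)
  rw [show p + 2 + (q + 1) = p + q + 2 + 1 by ring] at h₃
  rw [show p + 1 + 1 = p + 2 by ring] at h₁
  rw [← h₂, ← minCount_add_two q] at h₃
  rw [← minCount_add_two p] at h₁
  have h₄ := minCount_mono hp
  have h₅ := minCount_mono hq
  rw [minCount_three] at h₄
  rw [minCount_two] at h₅
  simp only [listCount, List.map_cons, List.map_nil, List.prod_cons, List.prod_nil, List.sum_cons,
    List.sum_nil, minCount_one]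
  have h₆ := Nat.mul_le_mul_right (minCount q + 2) h₁
  generalize minCount (p + q + 2) = r at *
  generalize minCount p = x at *
  generalize minCount q = y at *
  generalize phi (p + 2) = z at *
  obtain ⟨x, rfl⟩ := Nat.exists_eq_add_of_le h₄
  obtain ⟨y, rfl⟩ := Nat.exists_eq_add_of_le h₅
  nlinarith

theorem perm_big_append_replicate {l : List ℕ} (hpos : ∀ i ∈ l, 1 ≤ i) :
    ∃ (b : List ℕ) (j : ℕ), l.Perm (b ++ List.replicate j 1) ∧ ∀ i ∈ b, 2 ≤ i := by
  refine ⟨l.filter (fun i => decide (2 ≤ i)), (l.filter fun i => !decide (2 ≤ i)).length, ?_, ?_⟩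
  · have h := (List.filter_append_perm (fun i => decide (2 ≤ i)) l).symm
    have h' : (l.filter fun i => !decide (2 ≤ i)) =
        List.replicate (l.filter fun i => !decide (2 ≤ i)).length 1 := by
      rw [List.eq_replicate_iff]
      refine ⟨rfl, fun i hi => ?_⟩
      have h₁ := List.mem_filter.1 hi
      have h₂ := hpos i h₁.1
      simp at h₁
      omega
    rwa [h'] at h
  · intro i hi
    simpa using (List.mem_filter.1 hi).2

/-- From order `8` on, minimal trees have exactly two root branches. -/
theorem minCount_le_listCount {l : List ℕ} (hpos : ∀ i ∈ l, 1 ≤ i) (hn : 7 ≤ l.sum) :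
    minCount (l.sum + 1) ≤ listCount l ∧
      (l.length ≠ 2 → minCount (l.sum + 1) < listCount l) := by
  induction hk : l.length using Nat.strong_induction_on generalizing l with
  | _ k ih =>
  subst hk
  have step : ∀ l' : List ℕ, (∀ i ∈ l', 1 ≤ i) → l'.sum = l.sum → l'.length < l.length →
      listCount l' < listCount l → minCount (l.sum + 1) < listCount l := by
    intro l' hpos' hs hlen hlt
    have := (ih l'.length hlen hpos' (by omega) rfl).1
    rw [hs] at this
    omega
  match l, hpos, hn, ih, step with
  | [], _, hn, _, _ => simp at hn
  | [a], _, hn, _, _ =>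
    simp only [List.sum_cons, List.sum_nil, add_zero] at hn ⊢
    have h₁ := mul_phi_succ_le_mul_phi (N := a + 1) (by omega)
    rw [← minCount_add_two, ← minCount_add_two] at h₁
    have h₂ := minCount_mono (show 1 ≤ a by omega)
    rw [minCount_one] at h₂
    have : minCount (a + 1) < listCount [a] := by
      simp only [listCount, List.map_cons, List.map_nil, List.prod_cons, List.prod_nil,
        List.sum_cons, List.sum_nil]
      omega
    exact ⟨this.le, fun _ => this⟩
  | [a, b], _, hn, _, _ =>
    refine ⟨?_, by simp⟩
    simp only [List.sum_cons, List.sum_nil, add_zero] at hn ⊢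
    have h₁ := listCount_two a b
    have h₂ := phi_add_le (A := a + 1) (B := b + 1) (by omega) (by omega)
    rw [show a + 1 + (b + 1) = a + b + 1 + 1 by ring, ← minCount_add_two] at h₂
    omega
  | a :: b :: c :: l, hpos, hn, ih, step =>
    suffices h : minCount ((a :: b :: c :: l).sum + 1) < listCount (a :: b :: c :: l) from
      ⟨h.le, fun _ => h⟩
    have hlen : 3 ≤ (a :: b :: c :: l).length := by simp
    generalize a :: b :: c :: l = l at *
    obtain ⟨big, j, hperm, hbig⟩ := perm_big_append_replicate hpos
    have hs := hperm.sum_eq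
    have hl := hperm.length_eq
    have hmem : ∀ i ∈ big ++ List.replicate j 1, 1 ≤ i := fun i hi => hpos i (hperm.mem_iff.2 hi)
    rw [listCount_perm hperm] at step ⊢
    match big, hbig, hs, hl, hmem, step with
    | [], _, hs, hl, hmem, step =>
      simp only [List.nil_append, List.sum_replicate, smul_eq_mul, mul_one,
        List.length_replicate] at hs hl step ⊢
      obtain ⟨j, rfl⟩ : ∃ i, j = i + 3 := ⟨j - 3, by omega⟩
      rw [List.replicate_succ, List.replicate_succ, List.replicate_succ] at step ⊢
      refine step (3 :: List.replicate j 1) ?_ ?_ ?_ (listCount_merge_leaves ?_)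
      · simp
      · simp; omega
      · simp; omega
      · rw [List.map_replicate, List.prod_replicate, minCount_one]
        calc 4 = 2 ^ 2 := by norm_num
          _ ≤ (1 + 1) ^ j := Nat.pow_le_pow_right (by norm_num) (by omega)
    | [q], hbig, hs, hl, hmem, step =>
      have hq : 2 ≤ q := hbig q (by simp)
      simp only [List.cons_append, List.nil_append, List.sum_cons, List.sum_replicate,
        smul_eq_mul, mul_one, List.length_cons, List.length_replicate] at hs hl step ⊢
      rcases (show j = 2 ∨ 3 ≤ j by omega) with rfl | hj
      · have := minCount_lt_of_two_leaves (q := q) (by omega)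
        rw [hs]
        exact this
      · obtain ⟨j, rfl⟩ : ∃ i, j = i + 1 := ⟨j - 1, by omega⟩
        rw [List.replicate_succ] at step ⊢
        refine step ((q + 1) :: List.replicate j 1) ?_ ?_ ?_ (listCount_merge_leaf hq ?_)
        · simp
        · simp; omega
        · simp; omega
        · rw [List.map_replicate, List.prod_replicate, minCount_one]
          calc 4 = 2 ^ 2 := by norm_num
            _ ≤ (1 + 1) ^ j := Nat.pow_le_pow_right (by norm_num) (by omega)
    | p :: q :: big, hbig, hs, hl, hmem, step =>
      have hp : 2 ≤ p := hbig p (by simp)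
      have hq : 2 ≤ q := hbig q (by simp)
      simp only [List.cons_append] at hs hl hmem step ⊢
      generalize big ++ List.replicate j 1 = o at *
      by_cases ho : 4 ≤ (o.map fun i => minCount i + 1).prod
      · refine step ((p + q) :: o) ?_ ?_ ?_ (listCount_merge hp hq ho)
        · intro i hi
          rcases List.mem_cons.1 hi with rfl | hi
          · omega
          · exact hmem i (by simp [hi])
        · rw [hs]; simp [add_assoc]
        · rw [hl]; simp
      · -- There is a single further branch, which is a leaf.
        have h₁ := add_one_le_prod (o := o) fun i hi => hmem i (by simp [hi])
        obtain ⟨r, rfl⟩ : ∃ r, o = [r] := by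
          rw [← List.length_eq_one_iff]
          by_contra hne
          have : 2 ≤ o.length := by
            simp only [List.length_cons] at hl
            omega
          have := Nat.pow_le_pow_right (n := 2) (by norm_num) this
          omega
        have hr : r = 1 := by
          by_contra hne
          have h₂ := minCount_mono (show 2 ≤ r by have := hmem r (by simp); omega)
          rw [minCount_two] at h₂
          simp at ho
          omega
        subst hr
        simp only [List.sum_cons, List.sum_nil] at hs
        rw [hs]
        rcases (show 3 ≤ p ∨ 3 ≤ q by omega) with h3 | h3
        · exact minCount_lt_of_leaf h3 hq
        · rw [listCount_perm (List.Perm.swap q p [1])]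
          have := minCount_lt_of_leaf h3 hp
          rwa [show p + (q + (1 + 0)) + 1 = q + p + 2 by ring]

/-! ### Small orders -/

/-- The lists of positive integers with sum `n`. -/
def compositions : ℕ → List (List ℕ)
  | 0 => [[]]
  | n + 1 => (compositions n).flatMap fun l =>
    match l with
    | [] => [[1]]
    | a :: t => [1 :: a :: t, (a + 1) :: t]

theorem mem_compositions {n : ℕ} {l : List ℕ} (hpos : ∀ i ∈ l, 1 ≤ i) (hs : l.sum = n) :
    l ∈ compositions n := by
  induction n generalizing l with
  | zero =>
    match l with
    | [] => simp [compositions]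
    | a :: t =>
      have := hpos a (by simp)
      simp at hs
      omega
  | succ n ih =>
    rw [compositions, List.mem_flatMap]
    match l with
    | [] => simp at hs
    | a :: t =>
      have ha := hpos a (by simp)
      have ht : ∀ i ∈ t, 1 ≤ i := fun i hi => hpos i (by simp [hi])
      simp only [List.sum_cons] at hs
      rcases ha.eq_or_lt with rfl | ha
      · refine ⟨t, ih ht (by omega), ?_⟩
        cases t <;> simp
      · refine ⟨(a - 1) :: t, ih ?_ (by simp; omega), ?_⟩
        · intro i hi
          rcases List.mem_cons.1 hi with rfl | hi
          · omega
          · exact ht i hi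
        · simp only [List.mem_cons, List.cons.injEq]
          right; left
          exact ⟨by omega, trivial⟩

/-- The computable analogue of `listCount` for branches of order at most `6`. -/
def smallListCount (l : List ℕ) : ℕ :=
  (l.map fun i => smallValue (i + 1) - 2 + 1).prod + (l.map fun i => smallValue (i + 1) - 2).sum

theorem listCount_eq_small {l : List ℕ} (h : l.sum ≤ 6) : listCount l = smallListCount l := by
  have key : ∀ i ∈ l, minCount i = smallValue (i + 1) - 2 := by
    intro i hi
    have := List.le_sum_of_mem hi
    rw [minCount, phi_of_lt (by omega) (by omega)]
  rw [listCount, smallListCount, List.map_congr_left key,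
    List.map_congr_left fun i hi => by rw [key i hi]]

theorem small_compositions : ∀ n < 7, ∀ l ∈ compositions n,
    smallValue (n + 2) - 2 ≤ smallListCount l ∨ n = 6 := by
  decide +kernel

theorem compositions_six : ∀ l ∈ compositions 6,
    61 ≤ smallListCount l ∧ (smallListCount l = 61 → l = [3, 3] ∨ l.Perm [4, 1, 1]) := by
  decide +kernel

theorem compositions_between : ∀ n ∈ [2, 3, 4], ∀ l ∈ compositions n,
    smallListCount l = smallValue (n + 2) - 2 → l = List.replicate n 1 := by
  decide +kernel

theorem minCount_seven : minCount 7 = 61 := by simp [minCount, phi_eight]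

/-- The minimum over all lists of branch orders. -/
theorem minCount_le {l : List ℕ} (hpos : ∀ i ∈ l, 1 ≤ i) :
    minCount (l.sum + 1) ≤ listCount l := by
  by_cases h : 7 ≤ l.sum
  · exact (minCount_le_listCount hpos h).1
  rw [listCount_eq_small (by omega)]
  have hm := mem_compositions hpos rfl
  rcases (show l.sum = 6 ∨ l.sum < 6 by omega) with h6 | h6
  · rw [h6] at hm ⊢
    rw [minCount_seven]
    exact (compositions_six l hm).1
  · have := small_compositions l.sum (by omega) l hm
    rw [minCount, phi_of_lt (by omega) (by omega)]
    change smallValue (l.sum + 2) - 2 ≤ _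
    omega

theorem eq_of_listCount_eq {l : List ℕ} (hpos : ∀ i ∈ l, 1 ≤ i) (hn : 7 ≤ l.sum)
    (h : listCount l = minCount (l.sum + 1)) :
    ∃ a b, l = [a, b] ∧ phi (a + 1) * phi (b + 1) = phi (a + 1 + (b + 1)) + 1 := by
  have h₁ := (minCount_le_listCount hpos hn).2
  have h₂ : l.length = 2 := by
    by_contra hne
    have := h₁ hne
    omega
  obtain ⟨a, b, rfl⟩ := List.length_eq_two.1 h₂
  refine ⟨a, b, rfl, ?_⟩
  have h₃ := listCount_two a b
  have h₄ := minCount_add_two (a + b + 1)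
  simp only [List.sum_cons, List.sum_nil, add_zero] at h
  rw [show a + 1 + (b + 1) = a + b + 1 + 1 by ring]
  omega

theorem eq_replicate_of_listCount_eq {l : List ℕ} (hpos : ∀ i ∈ l, 1 ≤ i) (hn : 2 ≤ l.sum)
    (hn' : l.sum ≤ 4) (h : listCount l = minCount (l.sum + 1)) : l = List.replicate l.sum 1 := by
  rw [listCount_eq_small (by omega), minCount, phi_of_lt (by omega) (by omega)] at h
  refine compositions_between l.sum ?_ l (mem_compositions hpos rfl) h
  simp
  omega

theorem eq_or_perm_of_listCount_eq {l : List ℕ} (hpos : ∀ i ∈ l, 1 ≤ i) (hn : l.sum = 6)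
    (h : listCount l = minCount 7) : l = [3, 3] ∨ l.Perm [4, 1, 1] := by
  rw [listCount_eq_small (by omega), minCount_seven] at h
  exact (compositions_six l (hn ▸ mem_compositions hpos rfl)).2 h

/-! ### Infima closed sets in forests -/

section Sum

variable {P Q : Type*}

theorem preimage_inl_union (A : Set P) (B : Set Q) :
    Sum.inl ⁻¹' (Sum.inl '' A ∪ Sum.inr '' B : Set (P ⊕ Q)) = A := by
  ext x; simp

theorem preimage_inr_union (A : Set P) (B : Set Q) :
    Sum.inr ⁻¹' (Sum.inl '' A ∪ Sum.inr '' B : Set (P ⊕ Q)) = B := by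
  ext x; simp

theorem image_preimage_sum (X : Set (P ⊕ Q)) :
    Sum.inl '' (Sum.inl ⁻¹' X) ∪ Sum.inr '' (Sum.inr ⁻¹' X) = X := by
  ext (x | x) <;> simp

end Sum

section Forest

variable {P Q : Type*} [PartialOrder P] [PartialOrder Q]

/-- The sets that contain the infimum of any two of their elements that have one. -/
def closedSets (P : Type*) [PartialOrder P] : Set (Set P) :=
  {X | ∀ a ∈ X, ∀ b ∈ X, ∀ c, IsGLB {a, b} c → c ∈ X}

/-- The sets in `closedSets P` any two elements of which have a common lower bound; if `P` is a
forest, these are the ones that lie within one of its trees. -/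
def rootedSets (P : Type*) [PartialOrder P] : Set (Set P) :=
  {X | X ∈ closedSets P ∧ ∀ a ∈ X, ∀ b ∈ X, ∃ c, c ≤ a ∧ c ≤ b}

theorem isGLB_pair_iff {a b c : P} : IsGLB {a, b} c ↔
    c ≤ a ∧ c ≤ b ∧ ∀ d, d ≤ a → d ≤ b → d ≤ c := by
  simp only [IsGLB, IsGreatest, lowerBounds_insert, lowerBounds_singleton, mem_upperBounds,
    Set.mem_inter_iff, Set.mem_Iic]
  exact ⟨fun h => ⟨h.1.1, h.1.2, fun d h₁ h₂ => h.2 d ⟨h₁, h₂⟩⟩,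
    fun h => ⟨⟨h.1, h.2.1⟩, fun d hd => h.2.2 d hd.1 hd.2⟩⟩

theorem image_mem_closedSets (e : P ≃o Q) {X : Set P} (hX : X ∈ closedSets P) :
    e '' X ∈ closedSets Q := by
  rintro _ ⟨a, ha, rfl⟩ _ ⟨b, hb, rfl⟩ c hc
  refine ⟨e.symm c, hX a ha b hb _ ?_, e.apply_symm_apply c⟩
  rw [isGLB_pair_iff] at hc ⊢
  refine ⟨e.symm_apply_le.2 hc.1, e.symm_apply_le.2 hc.2.1, fun d h₁ h₂ => ?_⟩
  rw [e.le_symm_apply]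
  exact hc.2.2 _ (e.le_iff_le.2 h₁) (e.le_iff_le.2 h₂)

theorem image_mem_rootedSets (e : P ≃o Q) {X : Set P} (hX : X ∈ rootedSets P) :
    e '' X ∈ rootedSets Q := by
  refine ⟨image_mem_closedSets e hX.1, ?_⟩
  rintro _ ⟨a, ha, rfl⟩ _ ⟨b, hb, rfl⟩
  obtain ⟨c, h₁, h₂⟩ := hX.2 a ha b hb
  exact ⟨e c, e.le_iff_le.2 h₁, e.le_iff_le.2 h₂⟩

theorem ncard_closedSets_congr (e : P ≃o Q) : (closedSets P).ncard = (closedSets Q).ncard := by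
  rw [← Set.ncard_image_of_injective (closedSets P) (Set.image_injective.2 e.injective)]
  congr 1
  refine Set.Subset.antisymm ?_ fun X hX => ⟨e.symm '' X, image_mem_closedSets e.symm hX, ?_⟩
  · rintro _ ⟨X, hX, rfl⟩
    exact image_mem_closedSets e hX
  · rw [← Set.image_comp]
    simp

theorem ncard_rootedSets_congr (e : P ≃o Q) : (rootedSets P).ncard = (rootedSets Q).ncard := by
  rw [← Set.ncard_image_of_injective (rootedSets P) (Set.image_injective.2 e.injective)]
  congr 1
  refine Set.Subset.antisymm ?_ fun X hX => ⟨e.symm '' X, image_mem_rootedSets e.symm hX, ?_⟩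
  · rintro _ ⟨X, hX, rfl⟩
    exact image_mem_rootedSets e hX
  · rw [← Set.image_comp]
    simp

theorem mem_closedSets_sum {X : Set (P ⊕ Q)} : X ∈ closedSets (P ⊕ Q) ↔
    Sum.inl ⁻¹' X ∈ closedSets P ∧ Sum.inr ⁻¹' X ∈ closedSets Q := by
  constructor
  · refine fun h => ⟨fun a ha b hb c hc => h _ ha _ hb (Sum.inl c) ?_,
      fun a ha b hb c hc => h _ ha _ hb (Sum.inr c) ?_⟩
    · rw [isGLB_pair_iff] at hc ⊢
      refine ⟨by simpa using hc.1, by simpa using hc.2.1, ?_⟩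
      rintro (d | d) h₁ h₂
      · simp only [Sum.inl_le_inl_iff] at *
        exact hc.2.2 d h₁ h₂
      · simp at h₁
    · rw [isGLB_pair_iff] at hc ⊢
      refine ⟨by simpa using hc.1, by simpa using hc.2.1, ?_⟩
      rintro (d | d) h₁ h₂
      · simp at h₁
      · simp only [Sum.inr_le_inr_iff] at *
        exact hc.2.2 d h₁ h₂
  · rintro ⟨hl, hr⟩ a ha b hb c hc
    rw [isGLB_pair_iff] at hc
    rcases c with c | c <;> rcases a with a | a <;> rcases b with b | b <;> simp at hc
    · exact hl a ha b hb c (isGLB_pair_iff.2 hc)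
    · exact hr a ha b hb c (isGLB_pair_iff.2 hc)

theorem ncard_closedSets_sum :
    (closedSets (P ⊕ Q)).ncard = (closedSets P).ncard * (closedSets Q).ncard := by
  have hinj : Function.Injective
      (fun A : Set P × Set Q => (Sum.inl '' A.1 ∪ Sum.inr '' A.2 : Set (P ⊕ Q))) := by
    intro A B h
    have h₁ := congrArg (Sum.inl ⁻¹' ·) h
    have h₂ := congrArg (Sum.inr ⁻¹' ·) h
    simp only [preimage_inl_union, preimage_inr_union] at h₁ h₂
    exact Prod.ext h₁ h₂
  rw [← Set.ncard_prod, ← Set.ncard_image_of_injective _ hinj]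
  congr 1
  ext X
  constructor
  · intro hX
    exact ⟨(Sum.inl ⁻¹' X, Sum.inr ⁻¹' X), mem_closedSets_sum.1 hX, image_preimage_sum X⟩
  · rintro ⟨A, hA, rfl⟩
    rw [mem_closedSets_sum]
    simpa only [preimage_inl_union, preimage_inr_union] using Set.mem_prod.1 hA

theorem empty_mem_rootedSets : (∅ : Set P) ∈ rootedSets P :=
  ⟨fun _ ha => ha.elim, fun _ ha => ha.elim⟩

theorem empty_mem_closedSets : (∅ : Set P) ∈ closedSets P := empty_mem_rootedSets.1

theorem ncard_rootedSets_sum [Finite P] [Finite Q] :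
    (rootedSets (P ⊕ Q)).ncard + 1 = (rootedSets P).ncard + (rootedSets Q).ncard := by
  have h := Set.ncard_union_add_ncard_inter ((Sum.inl '' · : Set P → Set (P ⊕ Q)) '' rootedSets P)
    ((Sum.inr '' · : Set Q → Set (P ⊕ Q)) '' rootedSets Q)
  rw [Set.ncard_image_of_injective _ (Set.image_injective.2 Sum.inl_injective),
    Set.ncard_image_of_injective _ (Set.image_injective.2 Sum.inr_injective)] at h
  have h₁ : ((Sum.inl '' · : Set P → Set (P ⊕ Q)) '' rootedSets P) ∩
      ((Sum.inr '' · : Set Q → Set (P ⊕ Q)) '' rootedSets Q) = {∅} := by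
    ext X
    simp only [Set.mem_inter_iff, Set.mem_image, Set.mem_singleton_iff]
    constructor
    · rintro ⟨⟨A, hA, rfl⟩, ⟨B, hB, h⟩⟩
      rw [Set.image_eq_empty, Set.eq_empty_iff_forall_notMem]
      intro x hx
      have : (Sum.inl x : P ⊕ Q) ∈ Sum.inl '' A := ⟨x, hx, rfl⟩
      rw [← h] at this
      simp at this
    · rintro rfl
      exact ⟨⟨∅, empty_mem_rootedSets, Set.image_empty _⟩,
        ⟨∅, empty_mem_rootedSets, Set.image_empty _⟩⟩
  have h₂ : ((Sum.inl '' · : Set P → Set (P ⊕ Q)) '' rootedSets P) ∪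
      ((Sum.inr '' · : Set Q → Set (P ⊕ Q)) '' rootedSets Q) = rootedSets (P ⊕ Q) := by
    ext X
    constructor
    · rintro (⟨A, hA, rfl⟩ | ⟨A, hA, rfl⟩)
      · refine ⟨mem_closedSets_sum.2 ⟨?_, ?_⟩, ?_⟩
        · simpa [Set.preimage_image_eq _ Sum.inl_injective] using hA.1
        · simpa using empty_mem_closedSets
        · rintro _ ⟨a, ha, rfl⟩ _ ⟨b, hb, rfl⟩
          obtain ⟨c, h₁, h₂⟩ := hA.2 a ha b hb
          exact ⟨Sum.inl c, by simpa using h₁, by simpa using h₂⟩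
      · refine ⟨mem_closedSets_sum.2 ⟨?_, ?_⟩, ?_⟩
        · simpa using empty_mem_closedSets
        · simpa [Set.preimage_image_eq _ Sum.inr_injective] using hA.1
        · rintro _ ⟨a, ha, rfl⟩ _ ⟨b, hb, rfl⟩
          obtain ⟨c, h₁, h₂⟩ := hA.2 a ha b hb
          exact ⟨Sum.inr c, by simpa using h₁, by simpa using h₂⟩
    · rintro ⟨hX, hX'⟩
      rw [mem_closedSets_sum] at hX
      by_cases hr : ∃ x, Sum.inr x ∈ X
      · obtain ⟨x, hx⟩ := hr
        refine Or.inr ⟨Sum.inr ⁻¹' X, ⟨hX.2, fun a ha b hb => ?_⟩, ?_⟩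
        · obtain ⟨c | c, h₁, h₂⟩ := hX' _ ha _ hb
          · simp at h₁
          · exact ⟨c, by simpa using h₁, by simpa using h₂⟩
        · ext (y | y)
          · simp only [Set.mem_image, reduceCtorEq, and_false, exists_false, false_iff]
            intro hy
            obtain ⟨c | c, h₁, h₂⟩ := hX' _ hx _ hy
            · simp at h₁
            · simp at h₂
          · simp
      · refine Or.inl ⟨Sum.inl ⁻¹' X, ⟨hX.1, fun a ha b hb => ?_⟩, ?_⟩
        · obtain ⟨c | c, h₁, h₂⟩ := hX' _ ha _ hb
          · exact ⟨c, by simpa using h₁, by simpa using h₂⟩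
          · simp at h₁
        · ext (y | y)
          · simp
          · simp only [Set.mem_image, reduceCtorEq, and_false, exists_false, false_iff]
            exact fun hy => hr ⟨y, hy⟩
  rw [h₁, h₂, Set.ncard_singleton] at h
  exact h

theorem isGLB_pair_withBot {a b c : P} :
    IsGLB {(a : WithBot P), (b : WithBot P)} (c : WithBot P) ↔ IsGLB {a, b} c := by
  simp only [isGLB_pair_iff, WithBot.forall, WithBot.coe_le_coe, bot_le, implies_true, true_and]

theorem isGLB_bot_withBot {a b : P} :
    IsGLB {(a : WithBot P), (b : WithBot P)} ⊥ ↔ ¬ ∃ c, c ≤ a ∧ c ≤ b := by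
  simp [isGLB_pair_iff, WithBot.forall]

theorem ncard_closedSets_withBot [Finite P] :
    (closedSets (WithBot P)).ncard = (closedSets P).ncard + (rootedSets P).ncard := by
  have hinj : Function.Injective (fun Y : Set P => ((↑) '' Y : Set (WithBot P))) :=
    Set.image_injective.2 WithBot.coe_injective
  have hinj' : Function.Injective (fun Y : Set P => (insert ⊥ ((↑) '' Y) : Set (WithBot P))) := by
    intro A B h
    have h' := congrArg (((↑) : P → WithBot P) ⁻¹' ·) h
    ext x
    simpa using Set.ext_iff.1 h' x
  rw [← Set.ncard_image_of_injective (closedSets P) hinj',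
    ← Set.ncard_image_of_injective (rootedSets P) hinj, ← Set.ncard_union_eq]
  · congr 1
    ext X
    constructor
    · intro hX
      have hY : ((↑) : P → WithBot P) ⁻¹' X ∈ closedSets P := fun a ha b hb c hc =>
        hX _ ha _ hb _ (isGLB_pair_withBot.2 hc)
      by_cases hbot : ⊥ ∈ X
      · refine Or.inl ⟨_, hY, ?_⟩
        ext x
        induction x <;> simp [hbot]
      · refine Or.inr ⟨_, ⟨hY, fun a ha b hb => ?_⟩, ?_⟩
        · by_contra hc
          exact hbot (hX _ ha _ hb _ (isGLB_bot_withBot.2 hc))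
        · ext x
          induction x <;> simp [hbot]
    · rintro (⟨Y, hY, rfl⟩ | ⟨Y, hY, rfl⟩)
      · intro a ha b hb c hc
        induction c with
        | bot => exact Set.mem_insert _ _
        | coe c =>
          rcases ha with rfl | ⟨a, ha, rfl⟩
          · simp [isGLB_pair_iff] at hc
          rcases hb with rfl | ⟨b, hb, rfl⟩
          · simp [isGLB_pair_iff] at hc
          exact Or.inr ⟨c, hY a ha b hb c (isGLB_pair_withBot.1 hc), rfl⟩
      · rintro _ ⟨a, ha, rfl⟩ _ ⟨b, hb, rfl⟩ c hc
        induction c with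
        | bot => exact absurd (hY.2 a ha b hb) (isGLB_bot_withBot.1 hc)
        | coe c => exact ⟨c, hY.1 a ha b hb c (isGLB_pair_withBot.1 hc), rfl⟩
  · rw [Set.disjoint_left]
    rintro _ ⟨A, _, rfl⟩ ⟨B, _, h⟩
    have h' := Set.ext_iff.1 h ⊥
    simp at h'

theorem rootedSets_eq_of_bot [OrderBot P] : rootedSets P = closedSets P :=
  Set.Subset.antisymm (fun _ h => h.1) fun _ h => ⟨h, fun _ _ _ _ => ⟨⊥, bot_le, bot_le⟩⟩

theorem closedSets_of_isEmpty [IsEmpty P] : (closedSets P).ncard = 1 := by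
  rw [Set.ncard_eq_one]
  exact ⟨∅, Set.eq_singleton_iff_unique_mem.2
    ⟨empty_mem_closedSets, fun X _ => Set.eq_empty_of_isEmpty X⟩⟩

theorem rootedSets_of_isEmpty [IsEmpty P] : (rootedSets P).ncard = 1 := by
  rw [Set.ncard_eq_one]
  exact ⟨∅, Set.eq_singleton_iff_unique_mem.2
    ⟨empty_mem_rootedSets, fun X _ => Set.eq_empty_of_isEmpty X⟩⟩

/-- A poset with a least element arises from the other elements by adding a least element. -/
noncomputable def withBotIso (P : Type*) [PartialOrder P] [OrderBot P] :
    WithBot {x : P // x ≠ ⊥} ≃o P where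
  toFun x := (x.map Subtype.val).unbotD ⊥
  invFun x := open Classical in
    if h : x = ⊥ then ⊥ else ((⟨x, h⟩ : {x : P // x ≠ ⊥}) : WithBot {x : P // x ≠ ⊥})
  left_inv x := by
    induction x with
    | bot => simp
    | coe x => simp [x.2]
  right_inv x := by
    by_cases h : x = ⊥ <;> simp [h]
  map_rel_iff' {a b} := by
    induction a with
    | bot => simp
    | coe a =>
      induction b with
      | bot => simp [a.2]
      | coe b => simp

/-- The number of maximal elements; for a tree, the number of leaves. -/
noncomputable def maxCount (P : Type*) [PartialOrder P] : ℕ := Set.ncard {x : P | IsMax x}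

theorem maxCount_congr (e : P ≃o Q) : maxCount P = maxCount Q := by
  have h : e '' {x : P | IsMax x} = {x : Q | IsMax x} := ?_
  · rw [maxCount, maxCount, ← h, Set.ncard_image_of_injective _ e.injective]
  ext y
  constructor
  · rintro ⟨x, hx, rfl⟩
    exact e.isMax_apply.2 hx
  · intro hy
    refine ⟨e.symm y, ?_, e.apply_symm_apply y⟩
    exact e.symm.isMax_apply.2 hy

theorem maxCount_sum [Finite P] [Finite Q] : maxCount (P ⊕ Q) = maxCount P + maxCount Q := by
  have h : {x : P ⊕ Q | IsMax x} = Sum.inl '' {x | IsMax x} ∪ Sum.inr '' {x | IsMax x} := by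
    ext (x | x)
    · simp [IsMax]
    · simp [IsMax]
  rw [maxCount, h, Set.ncard_union_eq, Set.ncard_image_of_injective _ Sum.inl_injective,
    Set.ncard_image_of_injective _ Sum.inr_injective, maxCount, maxCount]
  rw [Set.disjoint_left]
  rintro _ ⟨x, _, rfl⟩ ⟨y, _, h⟩
  simp at h

theorem maxCount_withBot [Nonempty P] : maxCount (WithBot P) = maxCount P := by
  have h : {x : WithBot P | IsMax x} = (↑) '' {x : P | IsMax x} := ?_
  · rw [maxCount, maxCount, h, Set.ncard_image_of_injective _ WithBot.coe_injective]
  ext x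
  induction x with
  | bot =>
    obtain ⟨p⟩ := ‹Nonempty P›
    simp only [Set.mem_ofPred_eq, Set.mem_image, WithBot.coe_ne_bot, and_false, exists_false,
      iff_false]
    intro h
    have := h (bot_le (a := (p : WithBot P)))
    simp at this
  | coe x =>
    simp [IsMax, WithBot.forall]

end Forest

end InfClosed

open InfClosed

namespace PlaneTree

/-! ### The order structure of plane trees -/

theorem induction_on_branches {motive : PlaneTree → Prop}
    (h : ∀ ts, (∀ t ∈ ts, motive t) → motive (node ts)) : ∀ t, motive t
  | node ts => h ts fun t _ => induction_on_branches h t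

/-- The address of a vertex. -/
def address {t : PlaneTree} (v : t.Vertex) : List ℕ :=
  Subtype.val (p := fun p => (t.branchAt p).isSome) v

/-- The vertex with a given address. -/
def vertexAt {t : PlaneTree} (p : List ℕ) (h : (t.branchAt p).isSome) : t.Vertex :=
  Subtype.mk (p := fun p => (t.branchAt p).isSome) p h

theorem isSome_address {t : PlaneTree} (v : t.Vertex) : (t.branchAt (address v)).isSome := v.2

theorem address_vertexAt {t : PlaneTree} (p : List ℕ) (h : (t.branchAt p).isSome) :
    address (vertexAt p h) = p := rfl

theorem address_injective {t : PlaneTree} : Function.Injective (address (t := t)) :=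
  Subtype.val_injective

theorem le_iff_address {t : PlaneTree} {v w : t.Vertex} : v ≤ w ↔ address v <+: address w :=
  Iff.rfl

theorem ne_bot_iff_address {t : PlaneTree} {v : t.Vertex} : v ≠ ⊥ ↔ address v ≠ [] :=
  (address_injective.ne_iff (y := ⊥)).symm

/-- The vertices of a plane tree other than the root: a forest. -/
abbrev Forest (ts : List PlaneTree) : Type := {v : (node ts).Vertex // v ≠ ⊥}

/-- Addresses in the forest `t :: ts` of the vertices of `ts`. -/
def shiftAddress : List ℕ → List ℕ
  | [] => []
  | i :: p => (i + 1) :: p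

theorem shiftAddress_prefix_iff : ∀ {p q : List ℕ}, p ≠ [] → q ≠ [] →
    (shiftAddress p <+: shiftAddress q ↔ p <+: q)
  | [], _, h, _ => absurd rfl h
  | _, [], _, h => absurd rfl h
  | i :: p, j :: q, _, _ => by simp [shiftAddress, List.cons_prefix_cons]

theorem branchAt_shiftAddress (t : PlaneTree) (ts : List PlaneTree) : ∀ {p : List ℕ}, p ≠ [] →
    (node (t :: ts)).branchAt (shiftAddress p) = (node ts).branchAt p
  | [], h => absurd rfl h
  | i :: p, _ => by simp [shiftAddress, branchAt]

theorem shiftAddress_ne_nil : ∀ {p : List ℕ}, p ≠ [] → shiftAddress p ≠ []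
  | [], h => absurd rfl h
  | i :: p, _ => by simp [shiftAddress]

theorem not_zero_cons_prefix_shiftAddress (p : List ℕ) :
    ∀ q : List ℕ, ¬ 0 :: p <+: shiftAddress q
  | [] => by simp [shiftAddress]
  | j :: q => by simp [shiftAddress, List.cons_prefix_cons]

theorem not_shiftAddress_prefix_zero_cons (q : List ℕ) :
    ∀ {p : List ℕ}, p ≠ [] → ¬ shiftAddress p <+: 0 :: q
  | [], h => absurd rfl h
  | j :: p, _ => by simp [shiftAddress, List.cons_prefix_cons]

theorem forest_address_ne {ts : List PlaneTree} (v : Forest ts) : address v.1 ≠ [] :=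
  ne_bot_iff_address.1 v.2

/-- The first tree of a forest and the other trees, as part of the forest. -/
def forestConsFun (t : PlaneTree) (ts : List PlaneTree) :
    t.Vertex ⊕ Forest ts → Forest (t :: ts)
  | Sum.inl v => ⟨vertexAt (0 :: address v) (by simpa [branchAt] using isSome_address v),
      ne_bot_iff_address.2 (List.cons_ne_nil _ _)⟩
  | Sum.inr v => ⟨vertexAt (shiftAddress (address v.1)) (by
      rw [branchAt_shiftAddress t ts (forest_address_ne v)]; exact isSome_address v.1),
      ne_bot_iff_address.2 (shiftAddress_ne_nil (forest_address_ne v))⟩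

theorem forestConsFun_le_iff (t : PlaneTree) (ts : List PlaneTree) (v w : t.Vertex ⊕ Forest ts) :
    forestConsFun t ts v ≤ forestConsFun t ts w ↔ v ≤ w := by
  rw [← Subtype.coe_le_coe, le_iff_address]
  rcases v with v | v <;> rcases w with w | w <;> simp only [forestConsFun, address_vertexAt]
  · rw [Sum.inl_le_inl_iff, le_iff_address, List.cons_prefix_cons]
    simp
  · simp [not_zero_cons_prefix_shiftAddress]
  · simp [not_shiftAddress_prefix_zero_cons _ (forest_address_ne v)]
  · rw [Sum.inr_le_inr_iff, ← Subtype.coe_le_coe, le_iff_address,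
      shiftAddress_prefix_iff (forest_address_ne v) (forest_address_ne w)]

theorem forestConsFun_surjective (t : PlaneTree) (ts : List PlaneTree) :
    Function.Surjective (forestConsFun t ts) := by
  intro v
  have h := isSome_address v.1
  match hp : address v.1 with
  | [] => exact absurd hp (forest_address_ne v)
  | 0 :: p =>
    rw [hp] at h
    exact ⟨Sum.inl (vertexAt p (by simpa [branchAt] using h)),
      Subtype.ext (address_injective hp.symm)⟩
  | (i + 1) :: p =>
    rw [hp] at h
    exact ⟨Sum.inr ⟨vertexAt (i :: p) (by simpa [branchAt] using h),
      ne_bot_iff_address.2 (List.cons_ne_nil _ _)⟩, Subtype.ext (address_injective hp.symm)⟩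

/-- A forest is the disjoint union of its first tree and the remaining forest. -/
noncomputable def forestConsIso (t : PlaneTree) (ts : List PlaneTree) :
    t.Vertex ⊕ Forest ts ≃o Forest (t :: ts) :=
  RelIso.ofSurjective (OrderEmbedding.ofMapLEIff (forestConsFun t ts) (forestConsFun_le_iff t ts))
    (forestConsFun_surjective t ts)

instance : IsEmpty (Forest []) :=
  ⟨fun v => by
    have h := isSome_address v.1
    match hp : address v.1 with
    | [] => exact absurd hp (forest_address_ne v)
    | i :: p =>
      rw [hp] at h
      simp [branchAt] at h⟩

instance (t : PlaneTree) : Finite t.Vertex := by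
  induction t using induction_on_branches with
  | h ts ih =>
    have : Finite (Forest ts) := by
      induction ts with
      | nil => infer_instance
      | cons t ts iht =>
        have := ih t (by simp)
        have := iht fun s hs => ih s (by simp [hs])
        exact Finite.of_equiv _ (forestConsIso t ts).toEquiv
    exact Finite.of_equiv _ (withBotIso (node ts).Vertex).toEquiv

theorem card_withBot {P : Type*} [Finite P] : Nat.card (WithBot P) = Nat.card P + 1 :=
  Finite.card_option

theorem order_node (ts : List PlaneTree) : (node ts).order = 1 + (ts.map order).sum := by
  rw [order]

theorem card_forest {ts : List PlaneTree} (h : ∀ t ∈ ts, Nat.card t.Vertex = t.order) :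
    Nat.card (Forest ts) = (ts.map order).sum := by
  induction ts with
  | nil => simp
  | cons t ts ih =>
    rw [← Nat.card_congr (forestConsIso t ts).toEquiv, Nat.card_sum, h t (by simp),
      ih fun s hs => h s (by simp [hs]), List.map_cons, List.sum_cons]

theorem card_vertex (t : PlaneTree) : Nat.card t.Vertex = t.order := by
  induction t using induction_on_branches with
  | h ts ih =>
    rw [← Nat.card_congr (withBotIso (node ts).Vertex).toEquiv, card_withBot, card_forest ih,
      order_node, add_comm]

/-- The number of nonempty infima closed sets of a plane tree, in terms of its branches: the
product counts the sets that contain the root, and the others lie within one of the branches. -/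
def infCount : PlaneTree → ℕ
  | node ts => (ts.map fun t => infCount t + 1).prod + (ts.map infCount).sum

theorem infCount_node (ts : List PlaneTree) :
    (node ts).infCount = (ts.map fun t => infCount t + 1).prod + (ts.map infCount).sum := by
  rw [infCount]

theorem ncard_closedSets_forest {ts : List PlaneTree}
    (h : ∀ t ∈ ts, (closedSets t.Vertex).ncard = t.infCount + 1) :
    (closedSets (Forest ts)).ncard = (ts.map fun t => infCount t + 1).prod ∧
      (rootedSets (Forest ts)).ncard = (ts.map infCount).sum + 1 := by
  induction ts with
  | nil => exact ⟨by simp [closedSets_of_isEmpty], by simp [rootedSets_of_isEmpty]⟩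
  | cons t ts ih =>
    obtain ⟨ih₁, ih₂⟩ := ih fun s hs => h s (by simp [hs])
    have ht := h t (by simp)
    refine ⟨?_, ?_⟩
    · rw [← ncard_closedSets_congr (forestConsIso t ts), ncard_closedSets_sum, ht, ih₁]
      simp
    · have h₁ := ncard_rootedSets_sum (P := t.Vertex) (Q := Forest ts)
      rw [ncard_rootedSets_congr (forestConsIso t ts), rootedSets_eq_of_bot (P := t.Vertex), ht,
        ih₂] at h₁
      simp only [List.map_cons, List.sum_cons]
      omega

theorem ncard_closedSets_vertex (t : PlaneTree) :
    (closedSets t.Vertex).ncard = t.infCount + 1 := by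
  induction t using induction_on_branches with
  | h ts ih =>
    obtain ⟨h₁, h₂⟩ := ncard_closedSets_forest ih
    rw [← ncard_closedSets_congr (withBotIso (node ts).Vertex), ncard_closedSets_withBot, h₁, h₂,
      infCount_node, add_assoc]

/-! ### Isomorphisms of rooted trees -/

/-- Isomorphism of the rooted trees underlying two plane trees. -/
def Iso (s t : PlaneTree) : Prop := Nonempty (s.Vertex ≃o t.Vertex)

theorem Iso.refl (t : PlaneTree) : Iso t t := ⟨OrderIso.refl _⟩

theorem Iso.symm {s t : PlaneTree} : Iso s t → Iso t s := fun ⟨e⟩ => ⟨e.symm⟩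

theorem Iso.trans {s t r : PlaneTree} : Iso s t → Iso t r → Iso s r :=
  fun ⟨e⟩ ⟨f⟩ => ⟨e.trans f⟩

theorem forest_congr {ss ts : List PlaneTree} (h : List.Forall₂ Iso ss ts) :
    Nonempty (Forest ss ≃o Forest ts) := by
  induction h with
  | nil => exact ⟨OrderIso.refl _⟩
  | @cons s t ss ts hst _ ih =>
    obtain ⟨e⟩ := hst
    obtain ⟨f⟩ := ih
    exact ⟨(forestConsIso s ss).symm.trans ((e.sumCongr f).trans (forestConsIso t ts))⟩

theorem forest_perm {ss ts : List PlaneTree} (h : ss.Perm ts) :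
    Nonempty (Forest ss ≃o Forest ts) := by
  induction h with
  | nil => exact ⟨OrderIso.refl _⟩
  | @cons s ss ts _ ih =>
    obtain ⟨f⟩ := ih
    exact ⟨(forestConsIso s ss).symm.trans
      (((OrderIso.refl _).sumCongr f).trans (forestConsIso s ts))⟩
  | swap s t ss =>
    let e : ∀ s t : PlaneTree, (s.Vertex ⊕ (t.Vertex ⊕ Forest ss)) ≃o Forest (s :: t :: ss) :=
      fun s t => ((OrderIso.refl s.Vertex).sumCongr (forestConsIso t ss)).trans
        (forestConsIso s (t :: ss))
    exact ⟨(e t s).symm.trans (((OrderIso.sumAssoc _ _ _).symm.trans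
      (((OrderIso.sumComm _ _).sumCongr (OrderIso.refl _)).trans
        (OrderIso.sumAssoc _ _ _))).trans (e s t))⟩
  | trans _ _ ih₁ ih₂ =>
    obtain ⟨e⟩ := ih₁
    obtain ⟨f⟩ := ih₂
    exact ⟨e.trans f⟩

theorem iso_of_forest {ss ts : List PlaneTree} (h : Nonempty (Forest ss ≃o Forest ts)) :
    Iso (node ss) (node ts) := by
  obtain ⟨e⟩ := h
  exact ⟨(withBotIso _).symm.trans (e.withBotCongr.trans (withBotIso _))⟩

theorem iso_of_forall₂ {ss ts : List PlaneTree} (h : List.Forall₂ Iso ss ts) :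
    Iso (node ss) (node ts) := iso_of_forest (forest_congr h)

theorem iso_of_perm {ss ts : List PlaneTree} (h : ss.Perm ts) : Iso (node ss) (node ts) :=
  iso_of_forest (forest_perm h)

theorem iso_pair {s s' t t' : PlaneTree} (hs : Iso s s') (ht : Iso t t') :
    Iso (node [s, t]) (node [s', t']) :=
  iso_of_forall₂ (.cons hs (.cons ht .nil))

theorem iso_pair_swap (s t : PlaneTree) : Iso (node [s, t]) (node [t, s]) :=
  iso_of_perm (List.Perm.swap t s [])

theorem Iso.order_eq {s t : PlaneTree} : Iso s t → s.order = t.order := fun ⟨e⟩ => by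
  rw [← card_vertex, ← card_vertex, Nat.card_congr e.toEquiv]

/-- Finite forests in the sense of orders are represented by lists of plane trees. -/
theorem exists_forest {P : Type u} [PartialOrder P] [Finite P]
    (hP : ∀ a b c : P, a ≤ c → b ≤ c → a ≤ b ∨ b ≤ a) :
    ∃ ts : List PlaneTree, Nonempty (P ≃o Forest ts) := by
  induction hn : Nat.card P using Nat.strong_induction_on generalizing P with
  | _ n ih =>
  subst hn
  rcases isEmpty_or_nonempty P with hE | hE
  · exact ⟨[], ⟨⟨Equiv.equivOfIsEmpty _ _, fun {a} => hE.elim a⟩⟩⟩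
  obtain ⟨a, ha⟩ := Set.Finite.exists_minimal (Set.finite_univ (α := P)) Set.univ_nonempty
  have hmin : ∀ b, b ≤ a → b = a := fun b hb => le_antisymm hb (ha.2 trivial hb)
  -- The tree with root `a` is `{x // a ≤ x}`, and nothing outside it is comparable to it.
  have hcard : ∀ s : Set P, a ∉ s → Nat.card s < Nat.card P := fun s has => by
    rw [← Nat.card_univ (α := P)]
    exact Set.ncard_lt_ncard (Set.ssubset_univ_iff.2 fun h => has (h ▸ trivial))
  obtain ⟨us, ⟨e⟩⟩ := ih _ (hcard {x | a < x} (by simp)) (P := {x // a < x})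
    (fun x y z hx hy => hP x y z hx hy) rfl
  obtain ⟨ts, ⟨f⟩⟩ := ih _ (hcard {x | ¬ a ≤ x} (by simp)) (P := {x // ¬ a ≤ x})
    (fun x y z hx hy => hP x y z hx hy) rfl
  refine ⟨node us :: ts, ⟨?_⟩⟩
  have g₁ : {x // a ≤ x} ≃o (node us).Vertex := by
    letI : OrderBot {x // a ≤ x} := { bot := ⟨a, le_rfl⟩, bot_le := fun x => x.2 }
    refine (withBotIso {x // a ≤ x}).symm.trans (OrderIso.trans ?_ (withBotIso (node us).Vertex))
    refine OrderIso.withBotCongr (OrderIso.trans ?_ e)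
    exact
      { toFun := fun x => ⟨x.1.1, lt_of_le_of_ne x.1.2 fun h => x.2 (Subtype.ext h.symm)⟩
        invFun := fun x => ⟨⟨x.1, x.2.le⟩, fun h => x.2.ne (congrArg Subtype.val h).symm⟩
        left_inv := fun x => rfl
        right_inv := fun x => rfl
        map_rel_iff' := Iff.rfl }
  have g₂ : {x // a ≤ x} ⊕ {x // ¬ a ≤ x} ≃o P :=
    RelIso.ofSurjective (OrderEmbedding.ofMapLEIff
      (Sum.elim (fun x => x.1) (fun x => x.1) : {x // a ≤ x} ⊕ {x // ¬ a ≤ x} → P) (by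
      rintro (⟨x, hx⟩ | ⟨x, hx⟩) (⟨y, hy⟩ | ⟨y, hy⟩)
      · simp
      · simpa using fun h => hy (hx.trans h)
      · simp only [Sum.elim_inr, Sum.elim_inl, Sum.not_inr_le_inl, iff_false]
        intro h
        rcases hP a x y hy h with h' | h'
        · exact hx h'
        · exact hx (hmin x h').ge
      · simp)) (by
      intro x
      by_cases hx : a ≤ x
      · exact ⟨Sum.inl ⟨x, hx⟩, rfl⟩
      · exact ⟨Sum.inr ⟨x, hx⟩, rfl⟩)
  exact g₂.symm.trans ((g₁.sumCongr f).trans (forestConsIso _ _))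

/-- Every finite rooted tree can be drawn in the plane. -/
theorem exists_planeTree (T : RootedTree.{u}) [Finite T] :
    ∃ t : PlaneTree, Nonempty (T ≃o t.Vertex) := by
  obtain ⟨ts, ⟨e⟩⟩ := exists_forest (P := {x : T // x ≠ ⊥})
    fun _ _ c ha hb => le_total_of_directed (α := T) (r := c.1) hb ha
  exact ⟨node ts, ⟨(withBotIso T).symm.trans (e.withBotCongr.trans (withBotIso _))⟩⟩

theorem infClosed_iff_mem_closedSets {P : Type*} [SemilatticeInf P] {X : Set P} :
    InfClosed X ↔ X ∈ closedSets P :=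
  ⟨fun h _ ha _ hb _ hc => hc.unique isGLB_pair ▸ h ha hb,
    fun h a ha b hb => h a ha b hb _ isGLB_pair⟩

theorem numInfClosed_eq (T : RootedTree.{u}) [Finite T] {t : PlaneTree} (e : T ≃o t.Vertex) :
    T.numInfClosed = t.infCount := by
  have h₁ := ncard_closedSets_vertex t
  rw [← ncard_closedSets_congr e] at h₁
  have h₂ : {X : Set T | X.Nonempty ∧ InfClosed X} = closedSets T \ {∅} := by
    ext X
    simp [infClosed_iff_mem_closedSets, Set.nonempty_iff_ne_empty, and_comm]
  rw [RootedTree.numInfClosed, h₂, Set.ncard_sdiff_singleton_of_mem empty_mem_closedSets, h₁,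
    Nat.add_sub_cancel]

/-! ### Leaves -/

/-- The number of leaves. -/
def leafCount : PlaneTree → ℕ
  | node ts => if ts = [] then 1 else (ts.map leafCount).sum

theorem leafCount_node_nil : (node []).leafCount = 1 := by simp [leafCount]

theorem leafCount_node {ts : List PlaneTree} (h : ts ≠ []) :
    (node ts).leafCount = (ts.map leafCount).sum := by
  rw [leafCount, if_neg h]

theorem maxCount_forest {ts : List PlaneTree} (h : ∀ t ∈ ts, maxCount t.Vertex = t.leafCount) :
    maxCount (Forest ts) = (ts.map leafCount).sum := by
  induction ts with
  | nil => simp [maxCount, Set.eq_empty_of_isEmpty]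
  | cons t ts ih =>
    rw [← maxCount_congr (forestConsIso t ts), maxCount_sum, h t (by simp),
      ih fun s hs => h s (by simp [hs]), List.map_cons, List.sum_cons]

theorem maxCount_vertex (t : PlaneTree) : maxCount t.Vertex = t.leafCount := by
  induction t using induction_on_branches with
  | h ts ih =>
    rw [← maxCount_congr (withBotIso (node ts).Vertex)]
    cases ts with
    | nil =>
      have : Subsingleton (WithBot (Forest [])) := inferInstanceAs (Subsingleton (Option _))
      rw [leafCount_node_nil, maxCount, Set.ncard_eq_one]
      exact ⟨⊥, Set.eq_singleton_iff_unique_mem.2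
        ⟨fun x _ => (Subsingleton.elim x ⊥).le, fun x _ => Subsingleton.elim x ⊥⟩⟩
    | cons t ts =>
      have : Nonempty (Forest (t :: ts)) := ⟨forestConsIso t ts (Sum.inl ⊥)⟩
      rw [maxCount_withBot, maxCount_forest ih, leafCount_node (by simp)]

theorem Iso.leafCount_eq {s t : PlaneTree} : Iso s t → s.leafCount = t.leafCount := fun ⟨e⟩ => by
  rw [← maxCount_vertex, ← maxCount_vertex, maxCount_congr e]

/-! ### Minimal trees -/

theorem order_pos (t : PlaneTree) : 1 ≤ t.order := by
  cases t
  rw [order_node]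
  omega

theorem eq_leaf_of_order {t : PlaneTree} (h : t.order = 1) : t = leaf := by
  obtain ⟨ts⟩ := t
  cases ts with
  | nil => rfl
  | cons t ts =>
    have := order_pos t
    rw [order_node, List.map_cons, List.sum_cons] at h
    omega

theorem map_order_pos (ts : List PlaneTree) : ∀ i ∈ ts.map order, 1 ≤ i := by
  intro i hi
  obtain ⟨t, _, rfl⟩ := List.mem_map.1 hi
  exact order_pos t

/-- A plane tree with the least possible number of nonempty infima closed sets. -/
def IsMin (t : PlaneTree) : Prop := t.infCount = minCount t.order

theorem listCount_le {ts : List PlaneTree} (h : ∀ t ∈ ts, minCount t.order ≤ t.infCount) :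
    ((ts.map order).map fun i => minCount i + 1).prod ≤ (ts.map fun t => infCount t + 1).prod ∧
      ((ts.map order).map minCount).sum ≤ (ts.map infCount).sum ∧
      (((ts.map order).map minCount).sum = (ts.map infCount).sum → ∀ t ∈ ts, t.IsMin) := by
  induction ts with
  | nil => simp
  | cons t ts ih =>
    obtain ⟨h₁, h₂, h₃⟩ := ih fun s hs => h s (by simp [hs])
    have ht := h t (by simp)
    simp only [List.map_cons, List.prod_cons, List.sum_cons, List.mem_cons, forall_eq_or_imp]
    refine ⟨Nat.mul_le_mul (by omega) h₁, by omega, fun he => ⟨?_, h₃ (by omega)⟩⟩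
    unfold IsMin
    omega

theorem minCount_le_infCount (t : PlaneTree) : minCount t.order ≤ t.infCount := by
  induction t using induction_on_branches with
  | h ts ih =>
    obtain ⟨h₁, h₂, _⟩ := listCount_le ih
    have h₃ := minCount_le (map_order_pos ts)
    rw [infCount_node, order_node, add_comm 1]
    unfold listCount at h₃
    omega

theorem isMin_node_iff {ts : List PlaneTree} : (node ts).IsMin ↔
    (∀ t ∈ ts, t.IsMin) ∧ listCount (ts.map order) = minCount ((ts.map order).sum + 1) := by
  obtain ⟨h₁, h₂, h₃⟩ := listCount_le (ts := ts) fun t _ => minCount_le_infCount t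
  have h₄ := minCount_le (map_order_pos ts)
  rw [IsMin, infCount_node, order_node, add_comm 1]
  unfold listCount at *
  refine ⟨fun h => ⟨h₃ (by omega), by omega⟩, fun ⟨h, he⟩ => ?_⟩
  rw [← he, List.map_map, List.map_map]
  congr 2 <;> refine List.map_congr_left fun t ht => ?_
  · have := h t ht
    unfold IsMin at this
    simp [this]
  · exact h t ht

theorem order_pair (s t : PlaneTree) : (node [s, t]).order = s.order + t.order + 1 := by
  rw [order_node]
  simp
  ring

theorem isMin_pair {s t : PlaneTree} (hs : s.IsMin) (ht : t.IsMin)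
    (h : IsSplit (s.order + 1) (t.order + 1)) : (node [s, t]).IsMin := by
  refine isMin_node_iff.2 ⟨by simp [hs, ht], ?_⟩
  have h₁ := h.isOpt.eq
  have h₂ := listCount_two s.order t.order
  have h₃ := minCount_add_two (s.order + t.order + 1)
  rw [show s.order + 1 + (t.order + 1) = s.order + t.order + 1 + 1 by ring] at h₁
  simp only [List.map_cons, List.map_nil, List.sum_cons, List.sum_nil, add_zero]
  omega

/-- From order `8` on, minimal trees have two minimal branches whose orders form an optimal
decomposition. -/
theorem IsMin.exists_pair {t : PlaneTree} (h : t.IsMin) (hn : 8 ≤ t.order) :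
    ∃ s r, s.IsMin ∧ r.IsMin ∧ IsSplit (s.order + 1) (r.order + 1) ∧ Iso t (node [s, r]) := by
  obtain ⟨ts⟩ := t
  obtain ⟨h₁, h₂⟩ := isMin_node_iff.1 h
  rw [order_node] at hn
  obtain ⟨a, b, hab, he⟩ := eq_of_listCount_eq (map_order_pos ts) (by omega) h₂
  rw [hab] at hn
  simp only [List.sum_cons, List.sum_nil] at hn
  match ts, hab with
  | [s, r], hab =>
    simp only [List.map_cons, List.map_nil, List.cons.injEq, and_true] at hab
    obtain ⟨rfl, rfl⟩ := hab
    rcases le_total r.order s.order with hle | hle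
    · exact ⟨s, r, h₁ s (by simp), h₁ r (by simp),
        IsOpt.isSplit ⟨by omega, by omega, he⟩ (by omega), Iso.refl _⟩
    · exact ⟨r, s, h₁ r (by simp), h₁ s (by simp),
        IsOpt.isSplit ⟨by omega, by omega, by rw [mul_comm, he, add_comm (s.order + 1)]⟩
          (by omega), iso_pair_swap _ _⟩

theorem eq_replicate_leaf {ts : List PlaneTree} {k : ℕ} (h : ts.map order = List.replicate k 1) :
    ts = List.replicate k leaf := by
  rw [List.eq_replicate_iff] at h ⊢
  refine ⟨by simpa using h.1, fun t ht => eq_leaf_of_order (h.2 _ (List.mem_map_of_mem ht))⟩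

theorem IsMin.eq_star {t : PlaneTree} (h : t.IsMin) (h₁ : 3 ≤ t.order) (h₂ : t.order ≤ 5) :
    t = node (List.replicate (t.order - 1) leaf) := by
  obtain ⟨ts⟩ := t
  have h₃ := (isMin_node_iff.1 h).2
  rw [order_node] at *
  have h₄ := eq_replicate_of_listCount_eq (map_order_pos ts) (by omega) (by omega) h₃
  rw [Nat.add_sub_cancel_left, ← eq_replicate_leaf h₄]

theorem order_leaf : leaf.order = 1 := by
  rw [leaf, order_node]
  rfl

theorem order_star (k : ℕ) : (node (List.replicate k leaf)).order = k + 1 := by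
  rw [order_node]
  simp [order_leaf, add_comm]

theorem isMin_leaf : leaf.IsMin := by
  rw [IsMin, order_leaf, minCount_one, leaf, infCount_node]
  rfl

theorem isMin_star {k : ℕ} (h₁ : 2 ≤ k) (h₂ : k ≤ 4) :
    (node (List.replicate k leaf)).IsMin := by
  refine isMin_node_iff.2 ⟨fun t ht => List.eq_of_mem_replicate ht ▸ isMin_leaf, ?_⟩
  rw [List.map_replicate, order_leaf, listCount_eq_small (by simp; omega), minCount,
    phi_of_lt (by omega) (by simp; omega)]
  interval_cases k <;> rfl

/-- Away from the residue `2` modulo `5`, minimal trees are unique up to isomorphism. -/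
theorem IsMin.iso {s t : PlaneTree} (hs : s.IsMin) (ht : t.IsMin) (he : s.order = t.order)
    (h₃ : 3 ≤ s.order) (h₆ : s.order ≠ 6) (hmod : s.order % 5 ≠ 2) : Iso s t := by
  induction hn : s.order using Nat.strong_induction_on generalizing s t with
  | _ n ih =>
  subst hn
  by_cases h₅ : s.order ≤ 5
  · rw [hs.eq_star h₃ h₅, ht.eq_star (by omega) (by omega), he]
    exact Iso.refl _
  have h₈ : 8 ≤ s.order := by omega
  obtain ⟨s₁, s₂, hs₁, hs₂, hsS, hsI⟩ := hs.exists_pair h₈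
  obtain ⟨t₁, t₂, ht₁, ht₂, htS, htI⟩ := ht.exists_pair (he ▸ h₈)
  have ho₁ := hsI.order_eq
  have ho₂ := htI.order_eq
  rw [order_pair] at ho₁ ho₂
  obtain ⟨e₁, e₂⟩ := hsS.unique htS (by omega)
  have h₄ := hsS.four_le
  have h₄' := hsS.le
  have h₇ := hsS.ne_seven
  have hm := hsS.mod_of_mod (by omega) (by omega)
  refine hsI.trans (Iso.trans (iso_pair ?_ ?_) htI.symm)
  · exact ih s₁.order (by omega) hs₁ ht₁ (by omega) (by omega) (by omega) (by omega) rfl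
  · exact ih s₂.order (by omega) hs₂ ht₂ (by omega) (by omega) (by omega) (by omega) rfl

/-- The minimal trees that are built from the stars with two to four leaves by optimal
decompositions. For every order at least `3` except `6` there is exactly one of them, up to
isomorphism. -/
inductive IsCanonical : PlaneTree → Prop
  | star {k : ℕ} (h₁ : 2 ≤ k) (h₂ : k ≤ 4) : IsCanonical (node (List.replicate k leaf))
  | pair {s t : PlaneTree} (hs : IsCanonical s) (ht : IsCanonical t)
      (h : IsSplit (s.order + 1) (t.order + 1)) : IsCanonical (node [s, t])

theorem IsCanonical.isMin {t : PlaneTree} (h : IsCanonical t) : t.IsMin := by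
  induction h with
  | star h₁ h₂ => exact isMin_star h₁ h₂
  | pair _ _ h ihs iht => exact isMin_pair ihs iht h

theorem order_add_length_le {s : PlaneTree} : ∀ {q : List ℕ} {t : PlaneTree},
    t.branchAt q = some s → s.order + q.length ≤ t.order
  | [], t, h => by
    simp only [branchAt, Option.some.injEq] at h
    simp [h]
  | i :: q, node ts, h => by
    rw [branchAt, Option.bind_eq_some_iff] at h
    obtain ⟨r, hr, h⟩ := h
    have h₁ := order_add_length_le h
    have h₂ := List.le_sum_of_mem (List.mem_map_of_mem (f := order) (List.mem_of_getElem? hr))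
    rw [order_node, List.length_cons]
    omega

theorem branchAt_pair (s t r : PlaneTree) (q : List ℕ) : (node [s, t]).branchAt q = some r ↔
    (q = [] ∧ node [s, t] = r) ∨ (∃ p, q = 0 :: p ∧ s.branchAt p = some r) ∨
      ∃ p, q = 1 :: p ∧ t.branchAt p = some r := by
  match q with
  | [] => simp [branchAt]
  | 0 :: q => simp [branchAt]
  | 1 :: q => simp [branchAt]
  | (i + 2) :: q => simp [branchAt]

theorem order_sevenA : sevenA.order = 7 := by
  simp [sevenA, order_node, order_leaf]

theorem order_sevenB : sevenB.order = 7 := by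
  simp [sevenB, four, order_node, order_leaf]

theorem IsCanonical.branchAt_ne_sevenA {t : PlaneTree} (h : IsCanonical t)
    (hmod : t.order % 5 = 4) (q : List ℕ) : t.branchAt q ≠ some sevenA := by
  induction h generalizing q with
  | star h₁ h₂ =>
    intro hq
    have := order_add_length_le hq
    rw [order_sevenA, order_star] at this
    omega
  | @pair s t hs ht h ihs iht =>
    rw [order_pair] at hmod
    have h₁ := h.four_le
    have h₂ := h.le
    have h₃ := h.mod
    intro hq
    rw [branchAt_pair] at hq
    rcases hq with ⟨_, hq⟩ | ⟨p, _, hq⟩ | ⟨p, _, hq⟩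
    · have := congrArg order hq
      rw [order_pair, order_sevenA] at this
      omega
    · exact ihs (by omega) p hq
    · exact iht (by omega) p hq

theorem replaceEach_singleton (s t : PlaneTree) (p : List ℕ) :
    replaceEach s [p] t = modifyAt (fun _ => s) p t := rfl

theorem modifyAt_zero_cons (f : PlaneTree → PlaneTree) (p : List ℕ) (s t : PlaneTree) :
    modifyAt f (0 :: p) (node [s, t]) = node [modifyAt f p s, t] := by
  simp [modifyAt]

theorem modifyAt_one_cons (f : PlaneTree → PlaneTree) (p : List ℕ) (s t : PlaneTree) :
    modifyAt f (1 :: p) (node [s, t]) = node [s, modifyAt f p t] := by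
  simp [modifyAt]

theorem leafCount_pair (s t : PlaneTree) :
    (node [s, t]).leafCount = s.leafCount + t.leafCount := by
  rw [leafCount_node (by simp)]
  simp

theorem isMin_sevenB : sevenB.IsMin := by
  have h₄ : four.IsMin := isMin_star (k := 3) (by norm_num) (by norm_num)
  refine isMin_node_iff.2 ⟨by simp [h₄, isMin_leaf], ?_⟩
  have h : [four, leaf, leaf].map order = [4, 1, 1] := by
    simp [four, order_node, order_leaf]
  rw [h, listCount_eq_small (by simp)]
  exact minCount_seven.symm

theorem leafCount_leaf : leaf.leafCount = 1 := leafCount_node_nil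

theorem leafCount_sevenA : sevenA.leafCount = 4 := by
  simp [sevenA, leafCount_node, leafCount_leaf]

theorem leafCount_sevenB : sevenB.leafCount = 5 := by
  simp [sevenB, four, leafCount_node, leafCount_leaf]

/-- There are exactly two minimal trees of order `7`. -/
theorem IsMin.iso_seven {t : PlaneTree} (h : t.IsMin) (ht : t.order = 7) :
    Iso t sevenA ∨ Iso t sevenB := by
  obtain ⟨ts⟩ := t
  obtain ⟨h₁, h₂⟩ := isMin_node_iff.1 h
  rw [order_node] at ht
  have hs : (ts.map order).sum = 6 := by omega
  rw [hs] at h₂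
  rcases eq_or_perm_of_listCount_eq (map_order_pos ts) hs h₂ with h₃ | h₃
  · left
    obtain ⟨s, r, rfl⟩ := List.length_eq_two.1 (by simpa using congrArg List.length h₃)
    simp only [List.map_cons, List.map_nil, List.cons.injEq, and_true] at h₃
    have hs := (h₁ s (by simp)).eq_star (by omega) (by omega)
    have hr := (h₁ r (by simp)).eq_star (by omega) (by omega)
    rw [h₃.1] at hs
    rw [h₃.2] at hr
    rw [hs, hr]
    exact Iso.refl _
  · right
    -- Sort the branches like their orders.
    obtain ⟨us, hus, hp⟩ := (congrFun₂ (List.eq_map_comp_perm order) [4, 1, 1] ts).mpr h₃.symm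
    obtain ⟨s, r, q, rfl⟩ := List.length_eq_three.1 (by simpa using congrArg List.length hus.symm)
    simp only [List.map_cons, List.map_nil, List.cons.injEq, and_true] at hus
    have hs := (h₁ s (hp.mem_iff.1 (by simp))).eq_star (by omega) (by omega)
    rw [← hus.1] at hs
    refine (iso_of_perm hp.symm).trans ?_
    rw [hs, eq_leaf_of_order hus.2.1.symm, eq_leaf_of_order hus.2.2.symm]
    exact Iso.refl _

/-- The tree obtained from `t` by replacing the branch at `p` by `sevenB` has the properties that
make it the only minimal tree of its order besides `t`. -/
structure IsTwin (t : PlaneTree) (p : List ℕ) : Prop where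
  branchAt_iff : ∀ q, t.branchAt q = some sevenA ↔ q = p
  order_eq : (replaceEach sevenB [p] t).order = t.order
  isMin : (replaceEach sevenB [p] t).IsMin
  leafCount_eq : (replaceEach sevenB [p] t).leafCount = t.leafCount + 1
  iso : ∀ s : PlaneTree, s.IsMin → s.order = t.order →
    Iso s t ∨ Iso s (replaceEach sevenB [p] t)

theorem isTwin_sevenA : IsTwin sevenA [] where
  branchAt_iff q := by
    refine ⟨fun h => ?_, fun h => by rw [h, branchAt]⟩
    have := order_add_length_le h
    exact List.length_eq_zero_iff.1 (by omega)
  order_eq := by rw [replaceEach_singleton, modifyAt, order_sevenA, order_sevenB]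
  isMin := isMin_sevenB
  leafCount_eq := by rw [replaceEach_singleton, modifyAt, leafCount_sevenA, leafCount_sevenB]
  iso s hs h := hs.iso_seven (h.trans order_sevenA)

theorem IsTwin.pair_left {s t : PlaneTree} {p : List ℕ} (h : IsTwin s p) (ht : t.IsMin)
    (hsplit : IsSplit (s.order + 1) (t.order + 1)) (ho : 8 ≤ (node [s, t]).order)
    (hno : ∀ q, t.branchAt q ≠ some sevenA)
    (huniq : ∀ r : PlaneTree, r.IsMin → r.order = t.order → Iso r t) :
    IsTwin (node [s, t]) (0 :: p) := by
  have hrep : replaceEach sevenB [0 :: p] (node [s, t]) =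
      node [replaceEach sevenB [p] s, t] := by
    simp only [replaceEach_singleton, modifyAt_zero_cons]
  refine ⟨fun q => ?_, ?_, ?_, ?_, fun r hr hro => ?_⟩
  · rw [branchAt_pair]
    constructor
    · rintro (⟨_, hq⟩ | ⟨p', rfl, hq⟩ | ⟨p', rfl, hq⟩)
      · rw [hq, order_sevenA] at ho
        omega
      · rw [(h.branchAt_iff p').1 hq]
      · exact absurd hq (hno p')
    · rintro rfl
      exact Or.inr (Or.inl ⟨p, rfl, (h.branchAt_iff p).2 rfl⟩)
  · rw [hrep, order_pair, order_pair, h.order_eq]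
  · rw [hrep]
    exact isMin_pair h.isMin ht (by rwa [h.order_eq])
  · rw [hrep, leafCount_pair, leafCount_pair, h.leafCount_eq]
    omega
  · rw [hrep]
    obtain ⟨r₁, r₂, hr₁, hr₂, hrS, hrI⟩ := hr.exists_pair (by omega)
    have ho' := hrI.order_eq
    rw [order_pair] at ho' hro
    obtain ⟨e₁, e₂⟩ := hrS.unique hsplit (by omega)
    have hr₂' := huniq r₂ hr₂ (by omega)
    rcases h.iso r₁ hr₁ (by omega) with hi | hi
    · exact Or.inl (hrI.trans (iso_pair hi hr₂'))
    · exact Or.inr (hrI.trans (iso_pair hi hr₂'))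

theorem IsTwin.pair_right {s t : PlaneTree} {p : List ℕ} (h : IsTwin t p) (hs : s.IsMin)
    (hsplit : IsSplit (s.order + 1) (t.order + 1)) (ho : 8 ≤ (node [s, t]).order)
    (hno : ∀ q, s.branchAt q ≠ some sevenA)
    (huniq : ∀ r : PlaneTree, r.IsMin → r.order = s.order → Iso r s) :
    IsTwin (node [s, t]) (1 :: p) := by
  have hrep : replaceEach sevenB [1 :: p] (node [s, t]) =
      node [s, replaceEach sevenB [p] t] := by
    simp only [replaceEach_singleton, modifyAt_one_cons]
  refine ⟨fun q => ?_, ?_, ?_, ?_, fun r hr hro => ?_⟩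
  · rw [branchAt_pair]
    constructor
    · rintro (⟨_, hq⟩ | ⟨p', rfl, hq⟩ | ⟨p', rfl, hq⟩)
      · rw [hq, order_sevenA] at ho
        omega
      · exact absurd hq (hno p')
      · rw [(h.branchAt_iff p').1 hq]
    · rintro rfl
      exact Or.inr (Or.inr ⟨p, rfl, (h.branchAt_iff p).2 rfl⟩)
  · rw [hrep, order_pair, order_pair, h.order_eq]
  · rw [hrep]
    exact isMin_pair hs h.isMin (by rwa [h.order_eq])
  · rw [hrep, leafCount_pair, leafCount_pair, h.leafCount_eq]
    omega
  · rw [hrep]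
    obtain ⟨r₁, r₂, hr₁, hr₂, hrS, hrI⟩ := hr.exists_pair (by omega)
    have ho' := hrI.order_eq
    rw [order_pair] at ho' hro
    obtain ⟨e₁, e₂⟩ := hrS.unique hsplit (by omega)
    have hr₁' := huniq r₁ hr₁ (by omega)
    rcases h.iso r₂ hr₂ (by omega) with hi | hi
    · exact Or.inl (hrI.trans (iso_pair hr₁' hi))
    · exact Or.inr (hrI.trans (iso_pair hr₁' hi))

theorem IsCanonical.exists_isTwin {t : PlaneTree} (h : IsCanonical t) (hmod : t.order % 5 = 2) :
    ∃ p, IsTwin t p := by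
  induction h with
  | star h₁ h₂ =>
    rw [order_star] at hmod
    omega
  | @pair s t hs ht h ihs iht =>
    have hmod' := hmod
    rw [order_pair] at hmod'
    have h₁ := h.four_le
    have h₂ := h.le
    by_cases h₇ : s.order + t.order = 6
    · have hs' := hs.isMin.eq_star (by omega) (by omega)
      have ht' := ht.isMin.eq_star (by omega) (by omega)
      rw [show s.order - 1 = 2 by omega] at hs'
      rw [show t.order - 1 = 2 by omega] at ht'
      rw [hs', ht']
      exact ⟨[], isTwin_sevenA⟩
    have h₃ := h.mod (by omega)
    by_cases hs₂ : s.order % 5 = 2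
    · obtain ⟨p, hp⟩ := ihs hs₂
      exact ⟨0 :: p, hp.pair_left ht.isMin h (by rw [order_pair]; omega)
        (ht.branchAt_ne_sevenA (by omega)) fun r hr hro =>
          hr.iso ht.isMin hro (by omega) (by omega) (by omega)⟩
    · obtain ⟨p, hp⟩ := iht (by omega)
      exact ⟨1 :: p, hp.pair_right hs.isMin h (by rw [order_pair]; omega)
        (hs.branchAt_ne_sevenA (by omega)) fun r hr hro =>
          hr.iso hs.isMin hro (by omega) (by omega) (by omega)⟩

/-! ### Minimal rooted trees -/

/-- The rooted tree underlying a plane tree, in an arbitrary universe. -/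
def liftTree (t : PlaneTree) : RootedTree.{u} :=
  let e : t.Vertex ≃o ULift.{u} t.Vertex := ⟨Equiv.ulift.symm, Iff.rfl⟩
  letI : PredOrder (ULift.{u} t.Vertex) := PredOrder.ofOrderIso e
  letI : OrderBot (ULift.{u} t.Vertex) := { bot := ⟨⊥⟩, bot_le := fun v => bot_le (a := v.down) }
  have : IsPredArchimedean (ULift.{u} t.Vertex) := .of_orderIso e
  { α := ULift.{u} t.Vertex }

theorem isMinimal_iff {n : ℕ} {t : PlaneTree} (ht : t.IsMin) (hn : t.order = n)
    (T : RootedTree.{u}) :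
    T.IsMinimal n ↔ ∃ s : PlaneTree, Nonempty (T ≃o s.Vertex) ∧ s.IsMin ∧ s.order = n := by
  constructor
  · rintro ⟨hT, hcard, hmin⟩
    obtain ⟨s, ⟨e⟩⟩ := exists_planeTree T
    have hs : s.order = n := by rw [← card_vertex, ← Nat.card_congr e.toEquiv, hcard]
    refine ⟨s, ⟨e⟩, ?_, hs⟩
    let f : (liftTree.{u} t) ≃o t.Vertex := ⟨Equiv.ulift, Iff.rfl⟩
    have : Finite (liftTree.{u} t) := Finite.of_equiv _ f.symm.toEquiv
    have h := hmin (liftTree.{u} t) inferInstance (by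
      rw [Nat.card_congr f.toEquiv, card_vertex, hn])
    rw [numInfClosed_eq T e, numInfClosed_eq _ f] at h
    unfold IsMin at *
    rw [ht, hn, ← hs] at h
    exact le_antisymm h (minCount_le_infCount s)
  · rintro ⟨s, ⟨e⟩, hs, hso⟩
    have : Finite T := Finite.of_equiv _ e.symm.toEquiv
    refine ⟨inferInstance, by rw [Nat.card_congr e.toEquiv, card_vertex, hso], fun T' hT' hc => ?_⟩
    obtain ⟨s', ⟨e'⟩⟩ := exists_planeTree T'
    have hs' : s'.order = n := by rw [← card_vertex, ← Nat.card_congr e'.toEquiv, hc]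
    rw [numInfClosed_eq T e, numInfClosed_eq T' e', hs, hso, ← hs']
    exact minCount_le_infCount s'

/-- The classification of the minimal rooted trees of order `n`, in terms of a canonical plane
tree. -/
theorem IsCanonical.isMinimal_iff_of_mod_ne {n : ℕ} {t : PlaneTree} (h : IsCanonical t)
    (hn : t.order = n) (h₆ : 6 < n) (hmod : n % 5 ≠ 2) (T : RootedTree.{u}) :
    T.IsMinimal n ↔ Nonempty (T ≃o t.toRootedTree) := by
  rw [isMinimal_iff h.isMin hn]
  constructor
  · rintro ⟨s, ⟨e⟩, hs, hso⟩
    obtain ⟨f⟩ := hs.iso h.isMin (by omega) (by omega) (by omega) (by omega)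
    exact ⟨e.trans f⟩
  · rintro ⟨e⟩
    exact ⟨t, ⟨e⟩, h.isMin, hn⟩

theorem IsTwin.isMinimal_iff {n : ℕ} {t : PlaneTree} {p : List ℕ} (h : IsTwin t p)
    (ht : t.IsMin) (hn : t.order = n) (T : RootedTree.{u}) :
    T.IsMinimal n ↔ (Nonempty (T ≃o t.toRootedTree) ∨
      Nonempty (T ≃o (replaceEach sevenB [p] t).toRootedTree)) := by
  rw [PlaneTree.isMinimal_iff ht hn]
  constructor
  · rintro ⟨s, ⟨e⟩, hs, hso⟩
    rcases h.iso s hs (by omega) with ⟨⟨f⟩⟩ | ⟨⟨f⟩⟩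
    · exact Or.inl ⟨e.trans f⟩
    · exact Or.inr ⟨e.trans f⟩
  · rintro (⟨⟨e⟩⟩ | ⟨⟨e⟩⟩)
    · exact ⟨t, ⟨e⟩, ht, hn⟩
    · exact ⟨_, ⟨e⟩, h.isMin, by rw [h.order_eq, hn]⟩

theorem IsTwin.isEmpty {t : PlaneTree} {p : List ℕ} (h : IsTwin t p) :
    IsEmpty (t.toRootedTree ≃o (replaceEach sevenB [p] t).toRootedTree) := by
  refine ⟨fun e => ?_⟩
  have := Iso.leafCount_eq ⟨e⟩
  rw [h.leafCount_eq] at this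
  omega

/-! ### Vertices of a given kind, level by level -/

/-- The addresses, from left to right, of the vertices at level `i` of `t` whose branches satisfy
`P`. -/
def levelFilter (P : PlaneTree → Bool) (t : PlaneTree) (i : ℕ) : List (List ℕ) :=
  (t.level i).filter fun p => (t.branchAt p).any P

theorem levelFilter_zero (P : PlaneTree → Bool) (t : PlaneTree) :
    levelFilter P t 0 = if P t then [[]] else [] := by
  cases h : P t <;> simp [levelFilter, level, branchAt, h]

theorem levelFilter_succ (P : PlaneTree → Bool) (s t : PlaneTree) (i : ℕ) :
    levelFilter P (node [s, t]) (i + 1) =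
      (levelFilter P s i).map (0 :: ·) ++ (levelFilter P t i).map (1 :: ·) := by
  simp only [levelFilter, level, List.zipIdx_cons, List.zipIdx_nil, List.flatMap_cons,
    List.flatMap_nil, List.append_nil, List.filter_append, List.filter_map]
  rfl

theorem filter_canonicalOrder (P : PlaneTree → Bool) (t : PlaneTree) :
    (t.canonicalOrder.filter fun p => (t.branchAt p).any P) =
      (List.range t.order).flatMap (levelFilter P t) := by
  rw [canonicalOrder, List.filter_flatMap]
  rfl

theorem flatMap_range_of_eq_nil {α : Type*} {f : ℕ → List α} {d : ℕ}
    (hf : ∀ i, i ≠ d → i ≠ d + 1 → f i = []) {n : ℕ} (hn : d + 2 ≤ n) :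
    (List.range n).flatMap f = f d ++ f (d + 1) := by
  induction n, hn using Nat.le_induction with
  | base =>
    have h : (List.range d).flatMap f = [] :=
      List.flatMap_eq_nil_iff.2 fun i hi => by
        have := List.mem_range.1 hi
        exact hf i (by omega) (by omega)
    simp [List.range_succ, h]
  | succ n hn ih => simp [List.range_succ, ih, hf n (by omega) (by omega)]

theorem getLast?_flatMap_range {α : Type*} {f : ℕ → List α} {d : ℕ} {a : α}
    (ha : (f d).getLast? = some a) (hf : ∀ i, d < i → f i = []) {n : ℕ} (hn : d + 1 ≤ n) :
    ((List.range n).flatMap f).getLast? = some a := by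
  induction n, hn using Nat.le_induction with
  | base => simp [List.range_succ, ha]
  | succ n hn ih => simp [List.range_succ, ih, hf n (by omega)]

theorem modifyEach_append (f : PlaneTree → PlaneTree) (ps qs : List (List ℕ)) (t : PlaneTree) :
    modifyEach f (ps ++ qs) t = modifyEach f qs (modifyEach f ps t) :=
  List.foldl_append ..

theorem modifyEach_zero_cons (f : PlaneTree → PlaneTree) (ps : List (List ℕ)) (s t : PlaneTree) :
    modifyEach f (ps.map (0 :: ·)) (node [s, t]) = node [modifyEach f ps s, t] := by
  induction ps generalizing s with
  | nil => rfl
  | cons p ps ih => exact (congrArg _ (modifyAt_zero_cons f p s t)).trans (ih _)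

theorem modifyEach_one_cons (f : PlaneTree → PlaneTree) (ps : List (List ℕ)) (s t : PlaneTree) :
    modifyEach f (ps.map (1 :: ·)) (node [s, t]) = node [s, modifyEach f ps t] := by
  induction ps generalizing t with
  | nil => rfl
  | cons p ps ih => exact (congrArg _ (modifyAt_one_cons f p s t)).trans (ih _)

/-! ### Complete binary trees with grafted leaves -/

theorem order_completeBinary (d : ℕ) : (completeBinary d).order + 1 = 2 ^ (d + 1) := by
  induction d with
  | zero => rw [completeBinary, order_leaf]; rfl
  | succ d ih => rw [completeBinary, order_pair, pow_succ]; omega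

theorem levelFilter_isLeaf_completeBinary {d i : ℕ} (h : i ≠ d) :
    levelFilter isLeaf (completeBinary d) i = [] := by
  induction d generalizing i with
  | zero => cases i with
    | zero => exact absurd rfl h
    | succ i => rfl
  | succ d ih => cases i with
    | zero => rfl
    | succ i => rw [completeBinary, levelFilter_succ, ih (by omega)]; rfl

theorem length_levelFilter_isLeaf_completeBinary (d : ℕ) :
    (levelFilter isLeaf (completeBinary d) d).length = 2 ^ d := by
  induction d with
  | zero => rfl
  | succ d ih =>
    rw [completeBinary, levelFilter_succ, List.length_append, List.length_map, List.length_map, ih,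
      pow_succ]
    omega

theorem leaves_completeBinary (d : ℕ) :
    (completeBinary d).leaves = levelFilter isLeaf (completeBinary d) d := by
  have h := order_completeBinary d
  have h₁ := Nat.lt_two_pow_self (n := d + 1)
  rw [leaves, filter_canonicalOrder]
  obtain ⟨n, hn⟩ : ∃ n, (completeBinary d).order = d + 1 + n :=
    ⟨(completeBinary d).order - (d + 1), by omega⟩
  rw [hn, List.range_add, List.flatMap_append, List.range_succ, List.flatMap_append,
    List.flatMap_singleton, List.flatMap_eq_nil_iff.2, List.flatMap_eq_nil_iff.2]
  · simp
  · intro i hi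
    obtain ⟨j, _, rfl⟩ := List.mem_map.1 hi
    exact levelFilter_isLeaf_completeBinary (by omega)
  · intro i hi
    have := List.mem_range.1 hi
    exact levelFilter_isLeaf_completeBinary (by omega)

/-- The complete binary tree of height `d` with the tree `nine` in place of the `k` leftmost leaves
(of all leaves if there are fewer than `k` of them), and the tree `four` in place of the others. -/
def grafted : ℕ → ℕ → PlaneTree
  | 0, k => if k = 0 then four else nine
  | d + 1, k => node [grafted d k, grafted d (k - 2 ^ d)]

/-- Replacing the leaves one after the other gives the recursively defined tree. -/
theorem replaceEach_completeBinary (d k : ℕ) :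
    replaceEach four ((levelFilter isLeaf (completeBinary d) d).drop k)
      (replaceEach nine ((levelFilter isLeaf (completeBinary d) d).take k) (completeBinary d)) =
        grafted d k := by
  induction d generalizing k with
  | zero =>
    have h : levelFilter isLeaf (completeBinary 0) 0 = [[]] := rfl
    cases k with
    | zero => rfl
    | succ k => rw [h, List.take_succ_cons, List.drop_succ_cons, List.take_nil, List.drop_nil]; rfl
  | succ d ih =>
    simp only [replaceEach] at *
    simp only [completeBinary, grafted]
    rw [levelFilter_succ, List.take_append, List.drop_append, List.length_map,
      length_levelFilter_isLeaf_completeBinary]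
    simp only [← List.map_take, ← List.map_drop, modifyEach_append, modifyEach_zero_cons,
      modifyEach_one_cons, ih]

theorem base_eq_grafted (h m : ℕ) : base h m = grafted (h - 1) (m - 2 ^ (h - 1)) := by
  simp only [base, leaves_completeBinary]
  exact replaceEach_completeBinary _ _

/-- `t` is canonical and has order `N - 1`. -/
def IsCanonicalOf (t : PlaneTree) (N : ℕ) : Prop := IsCanonical t ∧ t.order + 1 = N

theorem IsCanonicalOf.pair {s t : PlaneTree} {A B : ℕ} (hs : IsCanonicalOf s A)
    (ht : IsCanonicalOf t B) (h : IsSplit A B) : IsCanonicalOf (node [s, t]) (A + B) := by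
  obtain ⟨hs, rfl⟩ := hs
  obtain ⟨ht, rfl⟩ := ht
  exact ⟨hs.pair ht h, by rw [order_pair]; ring⟩

theorem isCanonicalOf_star {k : ℕ} (h₁ : 2 ≤ k) (h₂ : k ≤ 4) :
    IsCanonicalOf (node (List.replicate k leaf)) (k + 2) :=
  ⟨.star h₁ h₂, by rw [order_star]⟩

theorem isCanonicalOf_four : IsCanonicalOf four 5 := 
  isCanonicalOf_star (k := 3) (by norm_num) (by norm_num)

theorem isCanonicalOf_grafted (d k : ℕ) :
    IsCanonicalOf (grafted d k) (5 * (2 ^ d + min k (2 ^ d))) := by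
  induction d generalizing k with
  | zero =>
    rcases Nat.eq_zero_or_pos k with rfl | hk
    · exact isCanonicalOf_four
    · rw [grafted, if_neg hk.ne', pow_zero, min_eq_right hk]
      exact isCanonicalOf_four.pair isCanonicalOf_four
        (Or.inr (Or.inr ⟨0, by norm_num⟩))
  | succ d ih =>
    have h₁ := Nat.one_le_two_pow (n := d)
    have h := (ih k).pair (ih (k - 2 ^ d)) (Or.inr (Or.inr ⟨d, by omega⟩))
    rw [grafted]
    convert h using 1
    rw [pow_succ]
    omega

theorem add_four_le_order_grafted (d k : ℕ) : d + 4 ≤ (grafted d k).order := by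
  have h₁ := (isCanonicalOf_grafted d k).2
  have h₂ := Nat.lt_two_pow_self (n := d)
  omega

/-! ### The vertices with leaf children -/

/-- Whether a leaf is among the children of the root. -/
def hasLeafChild (t : PlaneTree) : Bool := t.branches.any isLeaf

theorem levelFilter_hasLeafChild_grafted {d k i : ℕ} (h : i ≠ d) (h' : i ≠ d + 1) :
    levelFilter hasLeafChild (grafted d k) i = [] := by
  induction d generalizing k i with
  | zero =>
    obtain ⟨i, rfl⟩ : ∃ j, i = j + 2 := ⟨i - 2, by omega⟩
    rw [grafted]
    split_ifs
    · rw [levelFilter, four]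
      simp [level, leaf]
    · rw [nine, levelFilter_succ]
      rw [levelFilter, four]
      cases i <;> simp [level, leaf, branchAt, hasLeafChild, branches]
  | succ d ih => cases i with
    | zero => cases d <;> simp only [grafted] <;> (try split_ifs) <;> rfl
    | succ i =>
      rw [grafted, levelFilter_succ, ih (by omega) (by omega), ih (by omega) (by omega)]
      rfl

/-- The vertices with leaf children in the grafted copies of `four`. -/
def upperParents (d k : ℕ) : List (List ℕ) := levelFilter hasLeafChild (grafted d k) d

/-- The vertices with leaf children in the grafted copies of `nine`. -/
def lowerParents (d k : ℕ) : List (List ℕ) := levelFilter hasLeafChild (grafted d k) (d + 1)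

/-- In canonical order, the vertices with leaf children in the copies of `four` come first, because
they are one level above those in the copies of `nine`. -/
theorem leafParents_grafted (d k : ℕ) :
    (grafted d k).leafParents = upperParents d k ++ lowerParents d k := by
  have h := add_four_le_order_grafted d k
  exact (filter_canonicalOrder hasLeafChild _).trans
    (flatMap_range_of_eq_nil (fun i => levelFilter_hasLeafChild_grafted) (by omega))

theorem upperParents_succ (d k : ℕ) : upperParents (d + 1) k =
    (upperParents d k).map (0 :: ·) ++ (upperParents d (k - 2 ^ d)).map (1 :: ·) :=
  levelFilter_succ ..

theorem lowerParents_succ (d k : ℕ) : lowerParents (d + 1) k =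
    (lowerParents d k).map (0 :: ·) ++ (lowerParents d (k - 2 ^ d)).map (1 :: ·) :=
  levelFilter_succ ..

theorem length_upperParents (d k : ℕ) : (upperParents d k).length = 2 ^ d - k := by
  induction d generalizing k with
  | zero => cases k with
    | zero => rfl
    | succ k => simp [upperParents, grafted, nine, four, levelFilter_zero, hasLeafChild, branches,
        isLeaf]
  | succ d ih =>
    rw [upperParents_succ, List.length_append, List.length_map, List.length_map, ih, ih, pow_succ]
    omega

theorem lowerParents_zero_succ (k : ℕ) : lowerParents 0 (k + 1) = [[0], [1]] := rfl

theorem length_lowerParents (d k : ℕ) : (lowerParents d k).length = 2 * min k (2 ^ d) := by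
  induction d generalizing k with
  | zero => cases k with
    | zero => rfl
    | succ k => rw [lowerParents_zero_succ]; simp
  | succ d ih =>
    rw [lowerParents_succ, List.length_append, List.length_map, List.length_map, ih, ih, pow_succ]
    omega

/-! ### Adding and removing leaves -/

theorem upperParents_eq_nil {d k : ℕ} (h : 2 ^ d ≤ k) : upperParents d k = [] :=
  List.length_eq_zero_iff.1 (by rw [length_upperParents]; omega)

theorem lowerParents_zero (d : ℕ) : lowerParents d 0 = [] :=
  List.length_eq_zero_iff.1 (by rw [length_lowerParents]; simp)

/-- `grafted d k` with one more child at each of the first `j` vertices that have leaf children. -/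
def enlarged (j d k : ℕ) : PlaneTree :=
  modifyEach addChild ((upperParents d k ++ lowerParents d k).take j) (grafted d k)

theorem enlarged_succ_left {j d k : ℕ} (h : j + k ≤ 2 ^ d) :
    enlarged j (d + 1) k = node [enlarged j d k, grafted d (k - 2 ^ d)] := by
  have hl := length_upperParents d k
  rw [enlarged, enlarged, upperParents_succ, List.append_assoc,
    List.take_append_of_le_length (by rw [List.length_map]; omega),
    List.take_append_of_le_length (by omega), ← List.map_take, grafted, modifyEach_zero_cons]

theorem enlarged_succ_right {j d k : ℕ} (h : 2 ^ d ≤ k) (h' : j + k ≤ 2 * 2 ^ d) :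
    enlarged j (d + 1) k = node [grafted d k, enlarged j d (k - 2 ^ d)] := by
  have hl := length_upperParents d (k - 2 ^ d)
  rw [enlarged, enlarged, upperParents_succ, upperParents_eq_nil h, List.map_nil, List.nil_append,
    List.take_append_of_le_length (by rw [List.length_map]; omega),
    List.take_append_of_le_length (by omega), ← List.map_take, grafted, modifyEach_one_cons]

/-- If there are no copies of `four`, the enlarged vertices lie at the very left. -/
theorem enlarged_succ_full {j d k : ℕ} (hj : j ≤ 2) (h : 2 * 2 ^ d ≤ k) :
    enlarged j (d + 1) k = node [enlarged j d k, grafted d (k - 2 ^ d)] := by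
  have hl := length_lowerParents d k
  have h₁ := Nat.one_le_two_pow (n := d)
  rw [enlarged, enlarged, upperParents_eq_nil (by rw [pow_succ]; omega), lowerParents_succ,
    upperParents_eq_nil (by omega), List.nil_append, List.nil_append,
    List.take_append_of_le_length (by rw [List.length_map]; omega), ← List.map_take, grafted,
    modifyEach_zero_cons]

/-- If exactly one copy of `four` is left in the left branch, the second vertex to be enlarged is the
first one in the right branch. -/
theorem enlarged_two_succ_left {d k : ℕ} (h : k + 1 = 2 ^ d) :
    enlarged 2 (d + 1) k = node [enlarged 1 d k, enlarged 1 d (k - 2 ^ d)] := by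
  have hl := length_upperParents d k
  have hr := length_upperParents d (k - 2 ^ d)
  rw [enlarged, enlarged, enlarged, upperParents_succ, List.append_assoc, List.take_append,
    List.length_map, hl, List.take_of_length_le (by rw [List.length_map]; omega),
    show 2 - (2 ^ d - k) = 1 by omega,
    List.take_append_of_le_length (by rw [List.length_map]; omega),
    List.take_append_of_le_length (by omega), List.take_append_of_le_length (by omega),
    List.take_of_length_le (l := upperParents d k) (by omega), ← List.map_take,
    modifyEach_append, grafted, modifyEach_zero_cons, modifyEach_one_cons]

/-- If exactly one copy of `four` is left, and it is in the right branch, the second vertex to be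
enlarged lies one level lower, at the very left. -/
theorem enlarged_two_succ_right {d k : ℕ} (h : k + 1 = 2 * 2 ^ d) :
    enlarged 2 (d + 1) k = node [enlarged 1 d k, enlarged 1 d (k - 2 ^ d)] := by
  have hl := length_lowerParents d k
  have hr := length_upperParents d (k - 2 ^ d)
  have h₁ := Nat.one_le_two_pow (n := d)
  rw [enlarged, enlarged, enlarged, upperParents_succ, upperParents_eq_nil (by omega),
    List.map_nil, List.nil_append, List.nil_append, List.take_append, List.length_map, hr,
    List.take_of_length_le (by rw [List.length_map]; omega),
    show 2 - (2 ^ d - (k - 2 ^ d)) = 1 by omega, lowerParents_succ,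
    List.take_append_of_le_length (by rw [List.length_map]; omega),
    List.take_append_of_le_length (by omega),
    List.take_of_length_le (l := upperParents d (k - 2 ^ d)) (by omega), ← List.map_take,
    modifyEach_append, grafted, modifyEach_one_cons, modifyEach_zero_cons]

theorem isCanonicalOf_enlarged_one (d k : ℕ) :
    IsCanonicalOf (enlarged 1 d k) (5 * (2 ^ d + min k (2 ^ d)) + 1) := by
  induction d generalizing k with
  | zero =>
    have h₄ : IsCanonicalOf (enlarged 1 0 0) 6 := isCanonicalOf_star (k := 4) (by norm_num) le_rfl
    cases k with
    | zero => exact h₄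
    | succ k =>
      rw [pow_zero, min_eq_right (by omega)]
      exact h₄.pair isCanonicalOf_four (Or.inr (Or.inr ⟨0, by norm_num⟩))
  | succ d ih =>
    have h₁ := Nat.one_le_two_pow (n := d)
    by_cases hk : 1 + k ≤ 2 ^ d
    · rw [enlarged_succ_left hk]
      convert (ih k).pair (isCanonicalOf_grafted d (k - 2 ^ d))
        (Or.inr (Or.inr ⟨d, by omega⟩)) using 1
      rw [pow_succ]
      omega
    by_cases hk' : 1 + k ≤ 2 * 2 ^ d
    · rw [enlarged_succ_right (by omega) hk']
      convert (isCanonicalOf_grafted d k).pair (ih (k - 2 ^ d))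
        (Or.inr (Or.inr ⟨d, by omega⟩)) using 1
      rw [pow_succ]
      omega
    · rw [enlarged_succ_full (by norm_num) (by omega)]
      convert (ih k).pair (isCanonicalOf_grafted d (k - 2 ^ d))
        (Or.inr (Or.inr ⟨d + 1, by rw [pow_succ]; omega⟩)) using 1
      rw [pow_succ]
      omega

theorem isCanonicalOf_enlarged_two {d k : ℕ} (h : 0 < d ∨ 0 < k) :
    IsCanonicalOf (enlarged 2 d k) (5 * (2 ^ d + min k (2 ^ d)) + 2) := by
  induction d generalizing k with
  | zero =>
    obtain ⟨k, rfl⟩ : ∃ j, k = j + 1 := ⟨k - 1, by omega⟩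
    have h₄ := isCanonicalOf_star (k := 4) (by norm_num) le_rfl
    rw [pow_zero, min_eq_right (by omega)]
    exact h₄.pair h₄ (Or.inr (Or.inr ⟨0, by norm_num⟩))
  | succ d ih =>
    have h₁ := Nat.one_le_two_pow (n := d)
    have hd : d = 0 → 2 ^ d = 1 := by rintro rfl; rfl
    by_cases hk : 2 + k ≤ 2 ^ d
    · rw [enlarged_succ_left hk]
      convert (ih (k := k) (by omega)).pair (isCanonicalOf_grafted d (k - 2 ^ d))
        (Or.inr (Or.inr ⟨d, by omega⟩)) using 1
      rw [pow_succ]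
      omega
    by_cases hk' : k + 1 = 2 ^ d
    · rw [enlarged_two_succ_left hk']
      convert (isCanonicalOf_enlarged_one d k).pair (isCanonicalOf_enlarged_one d (k - 2 ^ d))
        (Or.inr (Or.inr ⟨d, by omega⟩)) using 1
      rw [pow_succ]
      omega
    by_cases hk₂ : 2 + k ≤ 2 * 2 ^ d
    · rw [enlarged_succ_right (by omega) hk₂]
      convert (isCanonicalOf_grafted d k).pair (ih (k := k - 2 ^ d) (by omega))
        (Or.inr (Or.inr ⟨d, by omega⟩)) using 1
      rw [pow_succ]
      omega
    by_cases hk₃ : k + 1 = 2 * 2 ^ d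
    · rw [enlarged_two_succ_right hk₃]
      convert (isCanonicalOf_enlarged_one d k).pair (isCanonicalOf_enlarged_one d (k - 2 ^ d))
        (Or.inr (Or.inr ⟨d, by omega⟩)) using 1
      rw [pow_succ]
      omega
    · rw [enlarged_succ_full (by norm_num) (by omega)]
      convert (ih (k := k) (by omega)).pair (isCanonicalOf_grafted d (k - 2 ^ d))
        (Or.inr (Or.inr ⟨d + 1, by rw [pow_succ]; omega⟩)) using 1
      rw [pow_succ]
      omega

theorem rtake_append_of_le_length {α : Type*} {j : ℕ} {l₁ l₂ : List α} (h : j ≤ l₂.length) :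
    (l₁ ++ l₂).rtake j = l₂.rtake j := by
  rw [List.rtake, List.length_append, List.drop_append, List.drop_of_length_le (by omega), List.rtake]
  simp
  omega

theorem map_rtake {α β : Type*} (f : α → β) (l : List α) (j : ℕ) :
    (l.map f).rtake j = (l.rtake j).map f := by
  simp [List.rtake, List.map_drop]

/-- Removing one child each from the last two vertices that have leaf children. -/
theorem isCanonicalOf_modifyEach_removeLastChild {d k : ℕ} (hk : 0 < k) :
    IsCanonicalOf (modifyEach removeLastChild ((lowerParents d k).rtake 2) (grafted d k))
      (5 * (2 ^ d + min k (2 ^ d)) - 2) := by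
  induction d generalizing k with
  | zero =>
    obtain ⟨k, rfl⟩ : ∃ j, k = j + 1 := ⟨k - 1, by omega⟩
    have h₂ := isCanonicalOf_star (k := 2) le_rfl (by norm_num)
    rw [pow_zero, min_eq_right (by omega)]
    exact h₂.pair h₂ (Or.inl ⟨rfl, rfl⟩)
  | succ d ih =>
    have h₁ := Nat.one_le_two_pow (n := d)
    rw [lowerParents_succ]
    by_cases hk' : k ≤ 2 ^ d
    · have hl := length_lowerParents d k
      rw [Nat.sub_eq_zero_of_le hk', lowerParents_zero, List.map_nil, List.append_nil, map_rtake,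
        grafted, modifyEach_zero_cons, Nat.sub_eq_zero_of_le hk']
      convert (ih hk).pair (isCanonicalOf_grafted d 0) (Or.inr (Or.inr ⟨d, by omega⟩)) using 1
      rw [pow_succ]
      omega
    · have hl := length_lowerParents d (k - 2 ^ d)
      rw [rtake_append_of_le_length (by rw [List.length_map]; omega), map_rtake, grafted,
        modifyEach_one_cons]
      convert (isCanonicalOf_grafted d k).pair (ih (k := k - 2 ^ d) (by omega))
        (Or.inr (Or.inr ⟨d, by omega⟩)) using 1
      rw [pow_succ]
      omega

theorem levelFilter_isLeaf_four_succ_succ (i : ℕ) : levelFilter isLeaf four (i + 2) = [] := by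
  simp [levelFilter, four, level, leaf]

theorem levelFilter_isLeaf_grafted {d k i : ℕ} (h : d + 2 < i) :
    levelFilter isLeaf (grafted d k) i = [] := by
  induction d generalizing k i with
  | zero =>
    obtain ⟨i, rfl⟩ : ∃ j, i = j + 3 := ⟨i - 3, by omega⟩
    rw [grafted]
    split_ifs
    · exact levelFilter_isLeaf_four_succ_succ _
    · rw [nine, levelFilter_succ, levelFilter_isLeaf_four_succ_succ]
      rfl
  | succ d ih =>
    obtain ⟨i, rfl⟩ : ∃ j, i = j + 1 := ⟨i - 1, by omega⟩
    rw [grafted, levelFilter_succ, ih (by omega), ih (by omega)]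
    rfl

theorem levelFilter_isLeaf_grafted_zero (d : ℕ) :
    levelFilter isLeaf (grafted d 0) (d + 2) = [] := by
  induction d with
  | zero => exact levelFilter_isLeaf_four_succ_succ 0
  | succ d ih => rw [grafted, levelFilter_succ, Nat.zero_sub, ih]; rfl

/-- The last leaf of the lowest level, whose removal gives a canonical tree; it belongs to the last
copy of `nine`. -/
theorem exists_getLast?_levelFilter {d k : ℕ} (hk : 0 < k) :
    ∃ q i, (levelFilter isLeaf (grafted d k) (d + 2)).getLast? = some (q ++ [i]) ∧
      IsCanonicalOf (modifyAt (eraseChild i) q (grafted d k))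
        (5 * (2 ^ d + min k (2 ^ d)) - 1) := by
  induction d generalizing k with
  | zero =>
    obtain ⟨k, rfl⟩ : ∃ j, k = j + 1 := ⟨k - 1, by omega⟩
    have h₂ := isCanonicalOf_star (k := 2) le_rfl (by norm_num)
    refine ⟨[1], 2, rfl, ?_⟩
    rw [pow_zero, min_eq_right (by omega)]
    exact isCanonicalOf_four.pair h₂ (Or.inr (Or.inl ⟨rfl, rfl⟩))
  | succ d ih =>
    have h₁ := Nat.one_le_two_pow (n := d)
    rw [grafted, levelFilter_succ]
    by_cases hk' : k ≤ 2 ^ d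
    · obtain ⟨q, i, hq, hc⟩ := ih hk
      refine ⟨0 :: q, i, ?_, ?_⟩
      · rw [Nat.sub_eq_zero_of_le hk', levelFilter_isLeaf_grafted_zero]
        simp [hq]
      · rw [modifyAt_zero_cons]
        convert hc.pair (isCanonicalOf_grafted d (k - 2 ^ d))
          (Or.inr (Or.inr ⟨d, by omega⟩)) using 1
        rw [pow_succ]
        omega
    · obtain ⟨q, i, hq, hc⟩ := ih (k := k - 2 ^ d) (by omega)
      refine ⟨1 :: q, i, ?_, ?_⟩
      · simp [hq]
      · rw [modifyAt_one_cons]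
        convert (isCanonicalOf_grafted d k).pair hc (Or.inr (Or.inr ⟨d, by omega⟩)) using 1
        rw [pow_succ]
        omega

theorem isCanonicalOf_removeLastLeaf {d k : ℕ} (hk : 0 < k) :
    IsCanonicalOf (grafted d k).removeLastLeaf (5 * (2 ^ d + min k (2 ^ d)) - 1) := by
  obtain ⟨q, i, hq, hc⟩ := exists_getLast?_levelFilter (d := d) hk
  have h := add_four_le_order_grafted d k
  have hl : (grafted d k).leaves.getLast? = some (q ++ [i]) := by
    rw [leaves, filter_canonicalOrder]
    exact getLast?_flatMap_range hq (fun j => levelFilter_isLeaf_grafted) (by omega)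
  simpa [removeLastLeaf, hl] using hc

theorem isCanonicalOf_minTree {h m n : ℕ} (hm : 2 ^ (h - 1) < m) (hm' : m ≤ 2 * 2 ^ (h - 1))
    (hn : n + 3 = 5 * m ∨ n + 2 = 5 * m ∨ n + 1 = 5 * m ∨ n = 5 * m ∨ n = 5 * m + 1) :
    IsCanonicalOf (minTree h m n) (n + 1) := by
  have hk : 0 < m - 2 ^ (h - 1) := by omega
  have hN : 5 * (2 ^ (h - 1) + min (m - 2 ^ (h - 1)) (2 ^ (h - 1))) = 5 * m := by omega
  simp only [minTree, base_eq_grafted, leafParents_grafted]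
  split_ifs with h₁ h₂ h₃ h₄
  · have := isCanonicalOf_grafted (h - 1) (m - 2 ^ (h - 1))
    rwa [hN, ← h₁] at this
  · have := isCanonicalOf_removeLastLeaf (d := h - 1) hk
    rwa [hN, ← h₂] at this
  · have := isCanonicalOf_modifyEach_removeLastChild (d := h - 1) hk
    rw [hN, ← h₃] at this
    rwa [rtake_append_of_le_length (by rw [length_lowerParents]; omega)]
  · have := isCanonicalOf_enlarged_one (h - 1) (m - 2 ^ (h - 1))
    rwa [hN, ← h₄] at this
  · have := isCanonicalOf_enlarged_two (d := h - 1) (Or.inr hk)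
    rwa [hN, show 5 * m + 2 = n + 1 by omega] at this

/-! ### Rounding and the height -/

/-- There are no ties when `(n + 1) / 5` is rounded, so that the nearest integer is determined by
the residue of `n`. -/
theorem forall_abs_le_iff {n m : ℕ} :
    (∀ k : ℤ, |((n : ℝ) + 1) / 5 - m| ≤ |((n : ℝ) + 1) / 5 - k|) ↔
      n + 3 = 5 * m ∨ n + 2 = 5 * m ∨ n + 1 = 5 * m ∨ n = 5 * m ∨ n = 5 * m + 1 := by
  constructor
  · intro h
    have h₁ := sq_le_sq.2 (h (m + 1))
    have h₂ := sq_le_sq.2 (h (m - 1))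
    push_cast at h₁ h₂
    have h₃ : 2 * (n : ℝ) ≤ 10 * m + 3 := by nlinarith
    have h₄ : 10 * (m : ℝ) ≤ 2 * n + 7 := by nlinarith
    norm_cast at h₃ h₄
    omega
  · intro h k
    have h₁ : (n : ℝ) + 1 ≤ 5 * m + 2 := by exact_mod_cast (by omega : n + 1 ≤ 5 * m + 2)
    have h₂ : 5 * (m : ℝ) ≤ n + 3 := by exact_mod_cast (by omega : 5 * m ≤ n + 3)
    rw [← sq_le_sq]
    rcases lt_trichotomy k m with hk | rfl | hk
    · have h₃ : (k : ℝ) + 1 ≤ m := by exact_mod_cast hk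
      nlinarith
    · simp
    · have h₃ : (m : ℝ) + 1 ≤ k := by exact_mod_cast hk
      nlinarith

theorem existsUnique_height {n : ℕ} (hn : 6 < n) :
    ∃! h : ℕ, 1 ≤ h ∧ 5 * 2 ^ (h - 1) + 1 < n ∧ n ≤ 5 * 2 ^ h + 1 := by
  have hex : ∃ h, n ≤ 5 * 2 ^ h + 1 := ⟨n, by have := Nat.lt_two_pow_self (n := n); omega⟩
  have hpos : 1 ≤ Nat.find hex := by
    rw [Nat.one_le_iff_ne_zero, Ne, Nat.find_eq_zero]
    omega
  have hmin := Nat.find_min hex (m := Nat.find hex - 1) (by omega)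
  refine ⟨Nat.find hex, ⟨hpos, by omega, Nat.find_spec hex⟩, fun h ⟨h₁, h₂, h₃⟩ => ?_⟩
  refine le_antisymm (Nat.le_of_pred_lt ((Nat.pow_lt_pow_iff_right one_lt_two).1 ?_))
    (Nat.find_min' hex h₃)
  have := Nat.find_spec hex
  rw [Nat.pred_eq_sub_one]
  omega

end PlaneTree

theorem theorem1 (n : ℕ) (hn : 6 < n) :
    (∃! h : ℕ, 1 ≤ h ∧ 5 * 2 ^ (h - 1) + 1 < n ∧ n ≤ 5 * 2 ^ h + 1) ∧
    (∃! m : ℕ, ∀ k : ℤ, |((n : ℝ) + 1) / 5 - m| ≤ |((n : ℝ) + 1) / 5 - k|) ∧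
    ∀ h m : ℕ,
      (1 ≤ h ∧ 5 * 2 ^ (h - 1) + 1 < n ∧ n ≤ 5 * 2 ^ h + 1) →
      (∀ k : ℤ, |((n : ℝ) + 1) / 5 - m| ≤ |((n : ℝ) + 1) / 5 - k|) →
      (n + 3 = 5 * m ∨ n + 2 = 5 * m ∨ n + 1 = 5 * m ∨ n = 5 * m ∨ n = 5 * m + 1) ∧
      2 ^ (h - 1) < m ∧ m ≤ 2 ^ h ∧
      (PlaneTree.completeBinary (h - 1)).order = 2 ^ h - 1 ∧
      (PlaneTree.completeBinary (h - 1)).leaves.length = 2 ^ (h - 1) ∧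
      (PlaneTree.base h m).order = 5 * m - 1 ∧
      (n % 5 ≠ 2 →
        ∀ T : RootedTree.{u}, T.IsMinimal n ↔
          Nonempty (T ≃o (PlaneTree.minTree h m n).toRootedTree)) ∧
      (n % 5 = 2 →
        ∃ p : List ℕ,
          (∀ q : List ℕ,
            (PlaneTree.minTree h m n).branchAt q = some PlaneTree.sevenA ↔ q = p) ∧
          IsEmpty ((PlaneTree.minTree h m n).toRootedTree ≃o
            (PlaneTree.replaceEach PlaneTree.sevenB [p]
              (PlaneTree.minTree h m n)).toRootedTree) ∧
          ∀ T : RootedTree.{u}, T.IsMinimal n ↔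
            (Nonempty (T ≃o (PlaneTree.minTree h m n).toRootedTree) ∨
              Nonempty (T ≃o (PlaneTree.replaceEach PlaneTree.sevenB [p]
                (PlaneTree.minTree h m n)).toRootedTree))) := by
  refine ⟨PlaneTree.existsUnique_height hn, ?_, fun h m ⟨h₁, h₂, h₃⟩ hm => ?_⟩
  · refine ⟨(n + 3) / 5, PlaneTree.forall_abs_le_iff.2 (by omega), fun m hm => ?_⟩
    have := PlaneTree.forall_abs_le_iff.1 hm
    omega
  rw [PlaneTree.forall_abs_le_iff] at hm
  have hpow : 2 ^ h = 2 * 2 ^ (h - 1) := by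
    rw [mul_comm, ← pow_succ, Nat.sub_add_cancel h₁]
  have hm₁ : 2 ^ (h - 1) < m := by omega
  have hm₂ : m ≤ 2 ^ h := by omega
  obtain ⟨hc, hn'⟩ := PlaneTree.isCanonicalOf_minTree hm₁ (hpow ▸ hm₂) hm
  have ho : (PlaneTree.minTree h m n).order = n := by omega
  refine ⟨hm, hm₁, hm₂, ?_, ?_, ?_, fun hmod => hc.isMinimal_iff_of_mod_ne ho hn hmod,
    fun hmod => ?_⟩
  · have := PlaneTree.order_completeBinary (h - 1)
    rw [Nat.sub_add_cancel h₁] at this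
    omega
  · rw [PlaneTree.leaves_completeBinary, PlaneTree.length_levelFilter_isLeaf_completeBinary]
  · have := (PlaneTree.isCanonicalOf_grafted (h - 1) (m - 2 ^ (h - 1))).2
    rw [PlaneTree.base_eq_grafted]
    omega
  · obtain ⟨p, hp⟩ := hc.exists_isTwin (by rw [ho, hmod])
    exact ⟨p, hp.branchAt_iff, hp.isEmpty, hp.isMinimal_iff hc.isMin ho⟩
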